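/- \textbf{Setting.} Consider the stochastic convex program $$f^*=\min_{x\in\mathcal X} f_0(x)\quad\text{s.t. } f_i(x)\le r_i,\ i=1,\dots,m,\qquad f_i(x)=\mathbb E[F_i(x,\xi_i)],$$ where $m\ge 1$, $\mathcal X\subset\mathbb R^d$ is nonempty, closed and convex, and $F_i(\cdot,\xi_i)$ is convex and continuous on $\mathcal X$ for every realization. Assume that some $\tilde x\in\mathcal X$ satisfies $f_i(\tilde x)<r_i$ for $i=1,\dots,m$ and $f_0(\tilde x)>f^*$. Put $\mathcal P(r,x)=\max\{f_0(x)-r,f_1(x)-r_1,\dots,f_m(x)-r_m\}$, $H(r)=\min_{x\in\mathcal X}\mathcal P(r,x)$, fix $r^{(0)}>f^*$, and let $\beta=-H(r^{(0)})/(r^{(0)}-f^*)\in(0,1]$. A feasible $x$ is called relative $\epsilon$-optimal if $(f_0(x)-f^*)/(r^{(0)}-f^*)\le\epsilon$ (for $r^{(0)}=f_0(x^0)$ this is relative optimality with respect to an initial feasible solution $x^0$). Let $\mathcal Y=\{y\in\mathbb R^{m+1}: y_i\ge0,\ \sum_{i=0}^m y_i=1\}$ and $\mathcal Z=\mathcal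 X\times\mathcal Y$. Let $\omega_x,\omega_y$ be distance-generating functions on $\mathcal X,\mathcal Y$ (continuous, $\alpha_x$- resp. $\alpha_y$-strongly convex with respect to norms $\|\cdot\|_x,\|\cdot\|_y$, continuously differentiable where the subdifferential is nonempty), with finite $D_x^2=\max_{\mathcal X}\omega_x-\min_{\mathcal X}\omega_x$ and $D_y^2=\max_{\mathcal Y}\omega_y-\min_{\mathcal Y}\omega_y$. Put $\omega_z(x,y)=\omega_x(x)/(2D_x^2)+\omega_y(y)/(2D_y^2)$, with Bregman divergence $V(z',z)=\omega_z(z)-\omega_z(z')-\nabla\omega_z(z')^\top(z-z')$ and prox-mapping $P_{z'}(\zeta)=\arg\min_{z\in\mathcal Z}\{\zeta^\top(z-z')+V(z',z)\}$. With $F_i'(x,\xi_i)\in\partial F_i(x,\xi_i)$ and, at level $r$, $r_0:=r$, let $G_x=\sum_i y_iF_i'(x,\xi_i)$, $G_y=(F_i(x,\xi_i)-r_i)_{i=0}^m$, $\Phi=\sum_i y_i(F_i(x,\xi_i)-r_i)$ and $\phi=\mathbb E\Phi$. Assume that there are constants $M_x,M_y,Q>0$ such that for all $(x,y)\in\mathcal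 Z$ and all levels $r\in(f^*,r^{(0)}]$ $$\mathbb E\,e^{\|G_x\|_{*,x}^2/M_x^2}\le e,\qquad \mathbb E\,e^{\|G_y\|_{*,y}^2/M_y^2}\le e,\qquad \mathbb E\,e^{|\Phi-\phi|^2/Q^2}\le e,$$ where $\|\cdot\|_{*,x},\|\cdot\|_{*,y}$ are the dual norms. Let $M=\sqrt{2D_x^2M_x^2/\alpha_x+2D_y^2M_y^2/\alpha_y}$ and $\gamma_t=1/(M\sqrt{t+1})$. \textbf{Algorithms.} OVSMD with iteration limit $T$ at level $r$ starts from $z^{(0)}=\arg\min_{\mathcal Z}\omega_z$; for $t=0,\dots,T$ (one gradient iteration each) it draws a fresh independent sample $\xi^{(t)}$ and sets $z^{(t+1)}=P_{z^{(t)}}\big(\gamma_t(G_x,-G_y)(x^{(t)},y^{(t)},\xi^{(t)})\big)$. It returns $\bar x=\sum_{t\le T}\gamma_tx^{(t)}/\sum_{t\le T}\gamma_t$ and $$U=\max_{y\in\mathcal Y}\frac{\sum_{t\le T}\gamma_t\big[\Phi(x^{(t)},y^{(t)},\xi^{(t)})+G_y(x^{(t)},\xi^{(t)})^\top(y-y^{(t)})\big]}{\sum_{t\le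 T}\gamma_t}.$$ SFLS with step parameter $\theta>1$ calls OVSMD (with fixed $T$) at level $r^{(k)}$, $k=0,1,\dots$, receives $(U^{(k)},x^{(k)})$ and sets $r^{(k+1)}=r^{(k)}+U^{(k)}/(2\theta)$; with tolerance $\epsilon_{\rm opt}$ it halts and returns $x^{(k)}$ at the first $k$ with $U^{(k)}\ge-\epsilon_{\rm opt}$. \textbf{Claim.} For all $\bar M,\bar Q\in\mathbb R$, $g>0$ and $\delta_0\in(0,1)$ there is a constant $C>0$, depending only on these four numbers, such that the following holds for every problem and setup as above with $M\le\bar M$, $Q\le\bar Q$, $r^{(0)}-f^*\ge g$, every $\theta>1$, every $\delta\in(0,\delta_0]$ and every integer $T\ge2$. Let $$\epsilon=C\,\frac{\theta^4\ln(1/\delta)\,\ln T\,\ln(T/\beta)}{\beta\sqrt T}$$ and suppose that $T$ is large enough that $\epsilon\le1$. Then there are an outer iteration limit $K\le C\frac{\theta^2}{\beta}\ln\frac T\beta$, whose $K$ OVSMD calls take altogether at most $C\frac{\theta^2T}{\beta}\ln\frac T\beta$ gradient iterations, and a tolerance $\epsilon_{\rm opt}\in\big(0,-\tfrac1\theta H(r^{(0)})\epsilon\big]$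 such that, with probability at least $1-\delta$, SFLS halts at some iteration $k<K$, all iterates $x^{(0)},\dots,x^{(k)}$ are feasible, and the returned solution $x^{(k)}$ is feasible and relative $\epsilon$-optimal. -/

import Mathlib

open MeasureTheory ProbabilityTheory

noncomputable section

/-! ## The stochastic convex program with expectation constraints -/

/-- A stochastic convex program with expectation constraints in `ℝ^d`:
minimize `E[F 0 x ξ_0]` over `x ∈ X` subject to `E[F i x ξ_i] ≤ b_i` for `i = 1, …, m`.
The index `0` is the objective; `law` is the joint law of `ξ = (ξ_0, …, ξ_m)`.
Only the values of `F` at points of `X` matter. -/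
structure SOEC (d m : ℕ) (Ξ : Fin (m + 1) → Type*) [∀ i, MeasurableSpace (Ξ i)] where
  X : Set (Fin d → ℝ)
  F : (i : Fin (m + 1)) → (Fin d → ℝ) → Ξ i → ℝ
  b : Fin m → ℝ
  law : Measure (∀ i, Ξ i)
  isProb : IsProbabilityMeasure law
  nonempty : X.Nonempty
  closed : IsClosed X
  convex : Convex ℝ X
  convexOn_F : ∀ i s, ConvexOn ℝ X (fun x => F i x s)
  continuousOn_F : ∀ i s, ContinuousOn (fun x => F i x s) X
  measurable_F : ∀ i, ∀ x ∈ X, Measurable (F i x)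
  integrable_F : ∀ i, ∀ x ∈ X, Integrable (fun ξ => F i x (ξ i)) law

namespace SOEC

variable {d m : ℕ} {Ξ : Fin (m + 1) → Type*} [∀ i, MeasurableSpace (Ξ i)] (S : SOEC d m Ξ)

/-- `f_i(x) = E[F_i(x, ξ_i)]`. -/
def f (i : Fin (m + 1)) (x : Fin d → ℝ) : ℝ := ∫ ξ, S.F i x (ξ i) ∂S.law

/-- Feasibility: `x ∈ X` and `f_i(x) ≤ b_i` for `i = 1, …, m`. -/
def Feasible (x : Fin d → ℝ) : Prop := x ∈ S.X ∧ ∀ i : Fin m, S.f i.succ x ≤ S.b i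

/-- The optimal value `f^*`. -/
def fstar : ℝ := sInf (S.f 0 '' {x | S.Feasible x})

/-- There is a strictly feasible point that is not optimal. -/
def StrictlyFeasible : Prop :=
  ∃ x ∈ S.X, (∀ i : Fin m, S.f i.succ x - S.b i < 0) ∧ S.fstar < S.f 0 x

/-- The right-hand sides `(r, b_1, …, b_m)`, with the level parameter `r` at index `0`. -/
def level (r : ℝ) : Fin (m + 1) → ℝ := Fin.cons r S.b

/-- `P(r, x) = max {f_0(x) - r, f_1(x) - b_1, …, f_m(x) - b_m}`. -/
def P (r : ℝ) (x : Fin d → ℝ) : ℝ := ⨆ i, (S.f i x - S.level r i)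

/-- The level-set function `H(r) = min_{x ∈ X} P(r, x)`. -/
def H (r : ℝ) : ℝ := sInf (S.P r '' S.X)

/-- The condition measure `β = -H(r₀) / (r₀ - f^*)`. -/
def beta (r₀ : ℝ) : ℝ := -S.H r₀ / (r₀ - S.fstar)

/-- `x` is relative `ε`-optimal with respect to the reference objective value `v`
(for an initial feasible solution `x⁰`, this is `v = f_0(x⁰)`). -/
def RelOptimal (v ε : ℝ) (x : Fin d → ℝ) : Prop :=
  (S.f 0 x - S.fstar) / (v - S.fstar) ≤ ε

end SOEC

/-! ## Norms, subgradients and distance-generating functions -/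

/-- The norm dual to `p` with respect to the dot product. -/
def dualNorm {n : ℕ} (p : Seminorm ℝ (Fin n → ℝ)) (g : Fin n → ℝ) : ℝ :=
  sSup {a | ∃ v, p v ≤ 1 ∧ a = g ⬝ᵥ v}

/-- `g` is a subgradient at `x` of the function `h : A → ℝ`. -/
def IsSubgrad {n : ℕ} (A : Set (Fin n → ℝ)) (h : (Fin n → ℝ) → ℝ) (x g : Fin n → ℝ) : Prop :=
  ∀ y ∈ A, h x + g ⬝ᵥ (y - x) ≤ h y

/-- The linear form `v ↦ g ⬝ᵥ v`. -/
def dotForm {n : ℕ} (g : Fin n → ℝ) : (Fin n → ℝ) →L[ℝ] ℝ :=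
  ∑ i, g i • ContinuousLinearMap.proj i

/-- The points of `A` at which the function `h : A → ℝ` has a subgradient. -/
def subgradDomain {n : ℕ} (A : Set (Fin n → ℝ)) (h : (Fin n → ℝ) → ℝ) : Set (Fin n → ℝ) :=
  {x | x ∈ A ∧ ∃ g, IsSubgrad A h x g}

/-- A distance-generating function `ω : A → ℝ` of modulus `α` with respect to a norm `nrm`:
it is continuous and `α`-strongly convex on `A`, bounded on `A`, and continuously differentiable
(relative to `A`, with gradient `grad`) on the set where its subdifferential is not empty. -/
structure DistGen {n : ℕ} (A : Set (Fin n → ℝ)) where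
  nrm : Seminorm ℝ (Fin n → ℝ)
  nrm_definite : ∀ v, nrm v = 0 → v = 0
  α : ℝ
  α_pos : 0 < α
  ω : (Fin n → ℝ) → ℝ
  grad : (Fin n → ℝ) → (Fin n → ℝ)
  strongly_convex : ∀ x ∈ A, ∀ y ∈ A, ∀ a b : ℝ, 0 ≤ a → 0 ≤ b → a + b = 1 →
    ω (a • x + b • y) ≤ a * ω x + b * ω y - a * b * (α / 2 * nrm (x - y) ^ 2)
  continuousOn : ContinuousOn ω A
  bddAbove : BddAbove (ω '' A)
  bddBelow : BddBelow (ω '' A)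
  hasGrad : ∀ x ∈ subgradDomain A ω, HasFDerivWithinAt ω (dotForm (grad x)) A x
  continuousOn_grad : ContinuousOn grad (subgradDomain A ω)

/-- The diameter `√(max_A ω - min_A ω)`. -/
def DistGen.diam {n : ℕ} {A : Set (Fin n → ℝ)} (D : DistGen A) : ℝ :=
  Real.sqrt (sSup (D.ω '' A) - sInf (D.ω '' A))

/-- A minimizer of `h` over `A` (an arbitrary point if there is none). -/
def argminOn {E : Type*} [Nonempty E] (h : E → ℝ) (A : Set E) : E :=
  Classical.epsilon (fun z => z ∈ A ∧ IsMinOn h A z)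

/-! ## Online validation based stochastic mirror descent (OVSMD) and SFLS -/

/-- What the first order methods use: stochastic subgradients `F'_i(x, ξ_i) ∈ ∂F_i(x, ξ_i)`,
distance-generating functions on `X` and on the simplex, and the light-tail constants. -/
structure FirstOrder {d m : ℕ} {Ξ : Fin (m + 1) → Type*} [∀ i, MeasurableSpace (Ξ i)]
    (S : SOEC d m Ξ) where
  F' : (i : Fin (m + 1)) → (Fin d → ℝ) → Ξ i → (Fin d → ℝ)
  subgrad : ∀ i, ∀ x ∈ S.X, ∀ s, IsSubgrad S.X (fun y => S.F i y s) x (F' i x s)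
  measurable_F' : ∀ i, Measurable (fun p : S.X × Ξ i => F' i p.1 p.2)
  dx : DistGen S.X
  dy : DistGen (stdSimplex ℝ (Fin (m + 1)))
  Mx : ℝ
  My : ℝ
  Q : ℝ
  Mx_pos : 0 < Mx
  My_pos : 0 < My
  Q_pos : 0 < Q

namespace FirstOrder

variable {d m : ℕ} {Ξ : Fin (m + 1) → Type*} [∀ i, MeasurableSpace (Ξ i)] {S : SOEC d m Ξ}
  (A : FirstOrder S)

/-- `G_x(x, y, ξ) = ∑ y_i F'_i(x, ξ_i)`. -/
def Gx (x : Fin d → ℝ) (y : Fin (m + 1) → ℝ) (ξ : ∀ i, Ξ i) : Fin d → ℝ :=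
  ∑ i, y i • A.F' i x (ξ i)

/-- `G_y(x, y, ξ) = (F_0(x, ξ_0) - r, F_1(x, ξ_1) - b_1, …, F_m(x, ξ_m) - b_m)`;
it does not depend on `y`. -/
def Gy (_A : FirstOrder S) (r : ℝ) (x : Fin d → ℝ) (ξ : ∀ i, Ξ i) : Fin (m + 1) → ℝ :=
  fun i => S.F i x (ξ i) - S.level r i

/-- `Φ(x, y, ξ) = ∑ y_i (F_i(x, ξ_i) - r_i)`, at level `r_0 = r`. -/
def Phi (_A : FirstOrder S) (r : ℝ) (x : Fin d → ℝ) (y : Fin (m + 1) → ℝ) (ξ : ∀ i, Ξ i) : ℝ :=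
  ∑ i, y i * (S.F i x (ξ i) - S.level r i)

/-- `φ(x, y) = E[Φ(x, y, ξ)]`. -/
def phi (r : ℝ) (x : Fin d → ℝ) (y : Fin (m + 1) → ℝ) : ℝ := ∫ ξ, A.Phi r x y ξ ∂S.law

/-- The light-tail conditions at level `r`. -/
def LightTailed (r : ℝ) : Prop :=
  ∀ x ∈ S.X, ∀ y ∈ stdSimplex ℝ (Fin (m + 1)),
    (∫⁻ ξ, ENNReal.ofReal (Real.exp (dualNorm A.dx.nrm (A.Gx x y ξ) ^ 2 / A.Mx ^ 2)) ∂S.law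
        ≤ ENNReal.ofReal (Real.exp 1)) ∧
    (∫⁻ ξ, ENNReal.ofReal (Real.exp (dualNorm A.dy.nrm (A.Gy r x ξ) ^ 2 / A.My ^ 2)) ∂S.law
        ≤ ENNReal.ofReal (Real.exp 1)) ∧
    (∫⁻ ξ, ENNReal.ofReal (Real.exp (|A.Phi r x y ξ - A.phi r x y| ^ 2 / A.Q ^ 2)) ∂S.law
        ≤ ENNReal.ofReal (Real.exp 1))

/-- `M = √(2 D_x² M_x² / α_x + 2 D_y² M_y² / α_y)`. -/
def M : ℝ :=
  Real.sqrt (2 * A.dx.diam ^ 2 / A.dx.α * A.Mx ^ 2 + 2 * A.dy.diam ^ 2 / A.dy.α * A.My ^ 2)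

/-- The step lengths `γ_t = 1 / (M √(t+1))`. -/
def step (t : ℕ) : ℝ := 1 / (A.M * Real.sqrt (t + 1))

/-- `Z = X × Y`, where `Y` is the simplex. -/
def Z (_A : FirstOrder S) : Set ((Fin d → ℝ) × (Fin (m + 1) → ℝ)) :=
  S.X ×ˢ stdSimplex ℝ (Fin (m + 1))

/-- `ω_z(x, y) = ω_x(x) / (2 D_x²) + ω_y(y) / (2 D_y²)`. -/
def omegaZ (z : (Fin d → ℝ) × (Fin (m + 1) → ℝ)) : ℝ :=
  A.dx.ω z.1 / (2 * A.dx.diam ^ 2) + A.dy.ω z.2 / (2 * A.dy.diam ^ 2)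

/-- The Bregman divergence `V(z', z) = ω_z(z) - [ω_z(z') + ∇ω_z(z')ᵀ (z - z')]`. -/
def bregman (z' z : (Fin d → ℝ) × (Fin (m + 1) → ℝ)) : ℝ :=
  A.omegaZ z - (A.omegaZ z' +
    (A.dx.grad z'.1 ⬝ᵥ (z.1 - z'.1) / (2 * A.dx.diam ^ 2) +
      A.dy.grad z'.2 ⬝ᵥ (z.2 - z'.2) / (2 * A.dy.diam ^ 2)))

/-- The prox-mapping `P_{z'}(ζ) = argmin_{z ∈ Z} {ζᵀ (z - z') + V(z', z)}`. -/
def prox (z' ζ : (Fin d → ℝ) × (Fin (m + 1) → ℝ)) : (Fin d → ℝ) × (Fin (m + 1) → ℝ) :=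
  argminOn (fun z => ζ.1 ⬝ᵥ (z.1 - z'.1) + ζ.2 ⬝ᵥ (z.2 - z'.2) + A.bregman z' z) A.Z

/-- The iterates `z^(t) = (x^(t), y^(t))` of OVSMD at level `r` on the samples `s 0, s 1, …`. -/
def iter (r : ℝ) (s : ℕ → ∀ i, Ξ i) : ℕ → (Fin d → ℝ) × (Fin (m + 1) → ℝ)
  | 0 => argminOn A.omegaZ A.Z
  | t + 1 => A.prox (iter r s t)
      (A.step t • (A.Gx (iter r s t).1 (iter r s t).2 (s t), -A.Gy r (iter r s t).1 (s t)))

/-- The point returned by OVSMD with iteration limit `T` (the loop runs over `t = 0, …, T`):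
the weighted average of `x^(0), …, x^(T)`. -/
def ovsmdX (T : ℕ) (r : ℝ) (s : ℕ → ∀ i, Ξ i) : Fin d → ℝ :=
  (∑ t ∈ Finset.range (T + 1), A.step t)⁻¹ •
    ∑ t ∈ Finset.range (T + 1), A.step t • (A.iter r s t).1

/-- The value returned by OVSMD with iteration limit `T`: the online validation upper bound. -/
def ovsmdU (T : ℕ) (r : ℝ) (s : ℕ → ∀ i, Ξ i) : ℝ :=
  sSup ((fun y => (∑ t ∈ Finset.range (T + 1), A.step t)⁻¹ *
      ∑ t ∈ Finset.range (T + 1), A.step t *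
        (A.Phi r (A.iter r s t).1 (A.iter r s t).2 (s t) +
          A.Gy r (A.iter r s t).1 (s t) ⬝ᵥ (y - (A.iter r s t).2))) ''
    stdSimplex ℝ (Fin (m + 1)))

/-- The level parameters `r^(k)` of SFLS with OVSMD (iteration limit `T`) as its oracle;
`s k` is the sequence of samples that the `k`-th oracle call draws. -/
def sflsLevel (T : ℕ) (θ r₀ : ℝ) (s : ℕ → ℕ → ∀ i, Ξ i) : ℕ → ℝ
  | 0 => r₀
  | k + 1 => sflsLevel T θ r₀ s k + A.ovsmdU T (sflsLevel T θ r₀ s k) (s k) / (2 * θ)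

/-- The value `U(r^(k))` that SFLS receives from its `k`-th oracle call. -/
def sflsU (T : ℕ) (θ r₀ : ℝ) (s : ℕ → ℕ → ∀ i, Ξ i) (k : ℕ) : ℝ :=
  A.ovsmdU T (A.sflsLevel T θ r₀ s k) (s k)

/-- The solution `x^(k)` that SFLS receives from its `k`-th oracle call. -/
def sflsX (T : ℕ) (θ r₀ : ℝ) (s : ℕ → ℕ → ∀ i, Ξ i) (k : ℕ) : Fin d → ℝ :=
  A.ovsmdX T (A.sflsLevel T θ r₀ s k) (s k)

/-- With optimality tolerance `εopt`, SFLS halts at iteration `k` (and returns `x^(k)`). -/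
def HaltsAt (T : ℕ) (θ r₀ εopt : ℝ) (s : ℕ → ℕ → ∀ i, Ξ i) (k : ℕ) : Prop :=
  -εopt ≤ A.sflsU T θ r₀ s k ∧ ∀ j < k, A.sflsU T θ r₀ s j < -εopt

end FirstOrder

/-- The number of gradient iterations in `K` calls of OVSMD with iteration limit `T`;
each call performs one for every `t = 0, …, T`. -/
def gradientIterations (T K : ℕ) : ℕ := ∑ _k ∈ Finset.range K, (Finset.range (T + 1)).card

end

/-! The proof separates the randomness of one oracle call from a deterministic study of the levels.

One call. OVSMD is stochastic mirror descent for the saddle function φ. On every sample path the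
regret bound `sum_step_Phi_le` compares the iterates with an arbitrary w in X; for w nearly
minimizing P(r, ·) it gives U ≤ H(r) + η, up to the noise of Φ(w, y^(t), ξ^(t)). Conversely,
convexity gives P(r, x̄) ≤ U + η, up to the fluctuations F_i - f_i summed along the iterates. All
coordinates i must be controlled at once; an auxiliary mirror descent in the simplex, driven by
these fluctuations (`sum_step_fluct_le`), does so at a cost that does not depend on m. Four adapted
sums remain, each bounded by an exponential supermartingale (`measure_sum_gt_le`). The outcome is
`measure_ovsmd_bad_le`: η is of order (Q + M)(log T + τ)/√T and the failure probability is at most 4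
exp(-τ).

The levels. H is convex with H(f*) ≤ 0 and H(r) ≥ -(r - f*), so H(r) ≤ -β (r - f*) for r between f*
and r^(0). As long as U < -εopt with εopt ≥ 9η, an update multiplies r - f* by at most
exp(-9β/(20θ)), but never by less than 7/16. The first bound forces a halt after order (θ/β)
log(T/β) calls. The second keeps H(r^(k)) ≤ -2η at the halt, whence P(r^(k), x^(k)) ≤ H(r^(k)) + 2η
≤ 0. So the output is feasible with f_0(x^(k)) ≤ r^(k), and the halting test gives β (r^(k) - f*) ≤
2 εopt. This is `level_iteration`.

A union bound over the calls joins the two halves, with εopt = -H(r^(0)) ε/(2θ);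
`level_iteration_parameters` checks that one C meets all requirements. -/

/-! ### Seminorms and dual norms in finite dimension -/

section DualNorm

variable {n : ℕ} (p : Seminorm ℝ (Fin n → ℝ))

theorem Seminorm.le_sum_single (v : Fin n → ℝ) :
    p v ≤ (∑ i, p (Pi.single i 1)) * ‖v‖ := by
  have h : v = ∑ i, v i • (Pi.single i 1 : Fin n → ℝ) := by
    ext j; simp [Finset.sum_apply, Pi.single_apply]
  calc p v = p (∑ i, v i • (Pi.single i 1 : Fin n → ℝ)) := by rw [← h]
    _ ≤ ∑ i, p (v i • (Pi.single i 1 : Fin n → ℝ)) :=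
        Finset.le_sum_of_subadditive p (map_zero p).le (map_add_le_add p) _ _
    _ ≤ ∑ i, p (Pi.single i 1) * ‖v‖ := by
        refine Finset.sum_le_sum fun i _ => ?_
        rw [map_smul_eq_mul, mul_comm]
        exact mul_le_mul_of_nonneg_left (norm_le_pi_norm v i) (apply_nonneg _ _)
    _ = _ := by rw [Finset.sum_mul]

theorem Seminorm.continuous_pi_fin : Continuous p := by
  have : LipschitzWith (Real.toNNReal (∑ i, p (Pi.single i 1))) p := by
    refine LipschitzWith.of_le_add_mul _ fun x y => ?_
    rw [Real.coe_toNNReal _ (Finset.sum_nonneg fun i _ => apply_nonneg _ _)]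
    have h1 := p.le_sum_single (x - y)
    have h2 : p x ≤ p y + p (x - y) := by
      simpa using map_add_le_add p y (x - y)
    rw [dist_eq_norm]; linarith
  exact this.continuous

theorem Seminorm.exists_norm_le (hp : ∀ v, p v = 0 → v = 0) :
    ∃ c, 0 < c ∧ ∀ v, ‖v‖ ≤ c * p v := by
  -- The sphere is empty only in dimension 0; otherwise the constant is the inverse of the minimum
  -- of `p` on it.
  rcases (Metric.sphere (0 : Fin n → ℝ) 1).eq_empty_or_nonempty with he | hne
  · refine ⟨1, one_pos, fun v => ?_⟩
    by_cases hv : v = 0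
    · simp [hv]
    · exfalso
      have : ‖v‖⁻¹ • v ∈ Metric.sphere (0 : Fin n → ℝ) 1 := by
        simp [norm_smul, hv]
      simp [he] at this
  · obtain ⟨u, hu, hmin⟩ := (isCompact_sphere (0 : Fin n → ℝ) 1).exists_isMinOn hne
      p.continuous_pi_fin.continuousOn
    have hu0 : 0 < p u := by
      refine lt_of_le_of_ne (apply_nonneg _ _) fun h => ?_
      have := hp u h.symm
      simp [this] at hu
    refine ⟨(p u)⁻¹, inv_pos.2 hu0, fun v => ?_⟩
    by_cases hv : v = 0
    · simp [hv]
    · have hv' : 0 < ‖v‖ := norm_pos_iff.2 hv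
      have hs : ‖v‖⁻¹ • v ∈ Metric.sphere (0 : Fin n → ℝ) 1 := by simp [norm_smul, hv]
      have := isMinOn_iff.1 hmin _ hs
      rw [map_smul_eq_mul, norm_inv, norm_norm, inv_mul_eq_div, le_div_iff₀ hv'] at this
      rw [inv_mul_eq_div, le_div_iff₀ hu0]; linarith

theorem abs_dotProduct_le_norm (g v : Fin n → ℝ) : |g ⬝ᵥ v| ≤ n * ‖g‖ * ‖v‖ := by
  calc |g ⬝ᵥ v| ≤ ∑ i, |g i * v i| := Finset.abs_sum_le_sum_abs _ _
    _ ≤ ∑ _i : Fin n, ‖g‖ * ‖v‖ := by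
        refine Finset.sum_le_sum fun i _ => ?_
        rw [abs_mul]
        exact mul_le_mul (norm_le_pi_norm g i) (norm_le_pi_norm v i) (abs_nonneg _)
          (norm_nonneg _)
    _ = _ := by simp; ring

variable {p}

theorem dualNorm_bddAbove (hp : ∀ v, p v = 0 → v = 0) (g : Fin n → ℝ) :
    BddAbove {a | ∃ v, p v ≤ 1 ∧ a = g ⬝ᵥ v} := by
  obtain ⟨c, hc, h⟩ := p.exists_norm_le hp
  refine ⟨n * ‖g‖ * c, ?_⟩
  rintro _ ⟨v, hv, rfl⟩
  refine (le_abs_self _).trans ((abs_dotProduct_le_norm g v).trans ?_)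
  refine mul_le_mul_of_nonneg_left ((h v).trans ?_) (by positivity)
  nlinarith

theorem dualNorm_nonneg (hp : ∀ v, p v = 0 → v = 0) (g : Fin n → ℝ) : 0 ≤ dualNorm p g :=
  le_csSup (dualNorm_bddAbove hp g) ⟨0, by simp, by simp⟩

theorem dotProduct_le_dualNorm_mul (hp : ∀ v, p v = 0 → v = 0) (g v : Fin n → ℝ) :
    g ⬝ᵥ v ≤ dualNorm p g * p v := by
  by_cases h : p v = 0
  · simp [hp v h]
  · have hv : 0 < p v := lt_of_le_of_ne (apply_nonneg _ _) (Ne.symm h)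
    have : g ⬝ᵥ ((p v)⁻¹ • v) ≤ dualNorm p g := by
      refine le_csSup (dualNorm_bddAbove hp g) ⟨_, ?_, rfl⟩
      rw [map_smul_eq_mul, norm_inv, Real.norm_of_nonneg hv.le, inv_mul_cancel₀ h]
    rw [dotProduct_smul, smul_eq_mul, inv_mul_eq_div, div_le_iff₀ hv] at this
    exact this

theorem dualNorm_le (g : Fin n → ℝ) {c : ℝ} (h : ∀ v, p v ≤ 1 → g ⬝ᵥ v ≤ c) :
    dualNorm p g ≤ c := by
  refine csSup_le ⟨0, 0, by simp, by simp⟩ ?_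
  rintro _ ⟨v, hv, rfl⟩
  exact h v hv

theorem dualNorm_neg (g : Fin n → ℝ) : dualNorm p (-g) = dualNorm p g := by
  have (g : Fin n → ℝ) : {a | ∃ v, p v ≤ 1 ∧ a = -g ⬝ᵥ v} ⊆ {a | ∃ v, p v ≤ 1 ∧ a = g ⬝ᵥ v} := by
    rintro _ ⟨v, hv, rfl⟩
    exact ⟨-v, by rwa [map_neg_eq_map], by simp⟩
  have h2 := this (-g)
  rw [neg_neg] at h2
  exact congrArg sSup (Set.Subset.antisymm (this g) h2)

theorem dualNorm_smul_of_nonneg (hp : ∀ v, p v = 0 → v = 0) (g : Fin n → ℝ) {c : ℝ}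
    (hc : 0 ≤ c) : dualNorm p (c • g) ≤ c * dualNorm p g := by
  refine dualNorm_le _ fun v hv => ?_
  rw [smul_dotProduct, smul_eq_mul]
  exact mul_le_mul_of_nonneg_left (le_csSup (dualNorm_bddAbove hp g) ⟨v, hv, rfl⟩) hc

theorem dualNorm_sub_le (hp : ∀ v, p v = 0 → v = 0) (g h : Fin n → ℝ) :
    dualNorm p (g - h) ≤ dualNorm p g + dualNorm p h := by
  refine dualNorm_le _ fun v hv => ?_
  have h1 := le_csSup (dualNorm_bddAbove hp g) ⟨v, hv, rfl⟩
  have h2 := le_csSup (dualNorm_bddAbove hp h) ⟨-v, by rwa [map_neg_eq_map], rfl⟩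
  rw [dotProduct_neg] at h2
  rw [sub_dotProduct]
  unfold dualNorm
  linarith

/-- Needed to make the dual norms of the random gradients measurable. -/
theorem continuous_dualNorm (hp : ∀ v, p v = 0 → v = 0) : Continuous (dualNorm p) := by
  obtain ⟨c, hc, h⟩ := p.exists_norm_le hp
  have : LipschitzWith (Real.toNNReal (n * c)) (dualNorm p) := by
    refine LipschitzWith.of_le_add_mul _ fun x y => ?_
    rw [Real.coe_toNNReal _ (by positivity)]
    have h2 : dualNorm p (x - y) ≤ n * c * dist x y := by
      refine dualNorm_le _ fun v hv => ?_
      refine (le_abs_self _).trans ((abs_dotProduct_le_norm _ v).trans ?_)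
      rw [dist_eq_norm]
      have h1 : ‖v‖ ≤ c := (h v).trans (by nlinarith)
      calc (n : ℝ) * ‖x - y‖ * ‖v‖ ≤ n * ‖x - y‖ * c :=
            mul_le_mul_of_nonneg_left h1 (by positivity)
        _ = _ := by ring
    refine dualNorm_le _ fun v hv => ?_
    have h3 := le_csSup (dualNorm_bddAbove hp y) ⟨v, hv, rfl⟩
    have h4 := le_csSup (dualNorm_bddAbove hp (x - y)) ⟨v, hv, rfl⟩
    rw [sub_dotProduct] at h4
    unfold dualNorm at h2 ⊢
    linarith
  exact this.continuous

end DualNorm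

/-! ### Distance-generating functions, mirror maps and the regret inequality -/

theorem continuous_dot {n : ℕ} (g : Fin n → ℝ) : Continuous fun v => g ⬝ᵥ v := by
  unfold dotProduct; fun_prop

theorem dotForm_apply {n : ℕ} (g v : Fin n → ℝ) : dotForm g v = g ⬝ᵥ v := by
  simp [dotForm, dotProduct]

theorem argminOn_spec {E : Type*} [Nonempty E] {h : E → ℝ} {A : Set E}
    (hex : ∃ z ∈ A, IsMinOn h A z) : argminOn h A ∈ A ∧ IsMinOn h A (argminOn h A) :=
  Classical.epsilon_spec (p := fun z => z ∈ A ∧ IsMinOn h A z) hex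

namespace DistGen

variable {n : ℕ} {A : Set (Fin n → ℝ)} (D : DistGen A)

theorem diam_sq : D.diam ^ 2 = sSup (D.ω '' A) - sInf (D.ω '' A) := by
  refine Real.sq_sqrt ?_
  rcases A.eq_empty_or_nonempty with rfl | h
  · simp
  · rw [sub_nonneg]
    obtain ⟨x, hx⟩ := h
    exact (csInf_le D.bddBelow ⟨x, hx, rfl⟩).trans (le_csSup D.bddAbove ⟨x, hx, rfl⟩)

theorem sub_le_diam_sq {x y : Fin n → ℝ} (hx : x ∈ A) (hy : y ∈ A) :
    D.ω x - D.ω y ≤ D.diam ^ 2 := by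
  rw [D.diam_sq]
  have h1 := le_csSup D.bddAbove ⟨x, hx, rfl⟩
  have h2 := csInf_le D.bddBelow ⟨y, hy, rfl⟩
  linarith

/-- Strong convexity at the midpoint: ω exceeds its midpoint value by at least α/8 times the squared
distance, on average over the two ends. -/
theorem nrm_sq_le (hA : Convex ℝ A) {x y : Fin n → ℝ} (hx : x ∈ A) (hy : y ∈ A) :
    D.α / 8 * D.nrm (x - y) ^ 2 ≤ D.diam ^ 2 := by
  have h := D.strongly_convex x hx y hy (1/2) (1/2) (by norm_num) (by norm_num) (by norm_num)
  have hm : (1/2 : ℝ) • x + (1/2 : ℝ) • y ∈ A := hA hx hy (by norm_num) (by norm_num) (by norm_num)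
  have h1 := D.sub_le_diam_sq hx hm
  have h2 := D.sub_le_diam_sq hy hm
  linarith

theorem diam_sq_pos (hA : Convex ℝ A) {x y : Fin n → ℝ} (hx : x ∈ A) (hy : y ∈ A) (h : x ≠ y) :
    0 < D.diam ^ 2 := by
  refine lt_of_lt_of_le ?_ (D.nrm_sq_le hA hx hy)
  have h1 : D.nrm (x - y) ≠ 0 := fun h0 => h (sub_eq_zero.1 (D.nrm_definite _ h0))
  have := D.α_pos
  positivity

/-- A bounded strongly convex function can only live on a bounded set. This supplies every minimizer
that the algorithms ask for. -/
theorem isCompact (D : DistGen A) (hA : Convex ℝ A) (hc : IsClosed A) : IsCompact A := by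
  rcases A.eq_empty_or_nonempty with rfl | ⟨x, hx⟩
  · exact isCompact_empty
  obtain ⟨c, hc0, h⟩ := D.nrm.exists_norm_le D.nrm_definite
  refine Metric.isCompact_of_isClosed_isBounded hc ?_
  refine (Metric.isBounded_iff_subset_closedBall x).2
    ⟨c * Real.sqrt (D.diam ^ 2 / (D.α / 8)), fun y hy => ?_⟩
  rw [Metric.mem_closedBall, dist_eq_norm]
  refine (h _).trans (mul_le_mul_of_nonneg_left ?_ hc0.le)
  refine Real.le_sqrt_of_sq_le ?_
  have := D.α_pos
  rw [le_div_iff₀ (by positivity), mul_comm]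
  exact D.nrm_sq_le hA hy hx

/-- Growth of a linearly perturbed, scaled distance-generating function away from a minimizer. -/
theorem growth_of_isMinOn (hA : Convex ℝ A) {c : ℝ} (hc : 0 < c) {w x y : Fin n → ℝ}
    (hx : x ∈ A) (hmin : IsMinOn (fun u => w ⬝ᵥ u + c * D.ω u) A x) (hy : y ∈ A) :
    w ⬝ᵥ x + c * D.ω x + c * D.α / 4 * D.nrm (x - y) ^ 2 ≤ w ⬝ᵥ y + c * D.ω y := by
  have h := D.strongly_convex x hx y hy (1/2) (1/2) (by norm_num) (by norm_num) (by norm_num)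
  have hm : (1/2 : ℝ) • x + (1/2 : ℝ) • y ∈ A := hA hx hy (by norm_num) (by norm_num) (by norm_num)
  have h1 := isMinOn_iff.1 hmin _ hm
  simp only [dotProduct_add, dotProduct_smul, smul_eq_mul] at h1
  have h2 := mul_le_mul_of_nonneg_left h hc.le
  nlinarith

theorem exists_isMinOn (hA : Convex ℝ A) (hcl : IsClosed A) (hne : A.Nonempty) (c : ℝ)
    (w : Fin n → ℝ) : ∃ x ∈ A, IsMinOn (fun u => w ⬝ᵥ u + c * D.ω u) A x :=
  (D.isCompact hA hcl).exists_isMinOn hne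
    ((continuous_dot w).continuousOn.add (continuousOn_const.mul D.continuousOn))

/-- The mirror map: the minimizer over `A` of `u ↦ w ⬝ᵥ u + c * ω u`. -/
noncomputable def mirror (c : ℝ) (w : Fin n → ℝ) : Fin n → ℝ :=
  argminOn (fun u => w ⬝ᵥ u + c * D.ω u) A

theorem mirror_spec (hA : Convex ℝ A) (hcl : IsClosed A) (hne : A.Nonempty) (c : ℝ)
    (w : Fin n → ℝ) : D.mirror c w ∈ A ∧ IsMinOn (fun u => w ⬝ᵥ u + c * D.ω u) A (D.mirror c w) :=
  argminOn_spec (D.exists_isMinOn hA hcl hne c w)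

/-- The values of ω cancel when the two growth inequalities are added. Uniqueness of the minimizer
and Lipschitz dependence on `w` both follow. -/
theorem nrm_sq_le_of_isMinOn (hA : Convex ℝ A) {c : ℝ} (hc : 0 < c) {w w' x x' : Fin n → ℝ}
    (hx : x ∈ A) (hmin : IsMinOn (fun u => w ⬝ᵥ u + c * D.ω u) A x)
    (hx' : x' ∈ A) (hmin' : IsMinOn (fun u => w' ⬝ᵥ u + c * D.ω u) A x') :
    c * D.α / 2 * D.nrm (x - x') ^ 2 ≤ (w - w') ⬝ᵥ (x' - x) := by
  have h1 := D.growth_of_isMinOn hA hc hx hmin hx'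
  have h2 := D.growth_of_isMinOn hA hc hx' hmin' hx
  rw [map_sub_rev D.nrm x' x] at h2
  simp only [sub_dotProduct, dotProduct_sub]
  linarith

theorem eq_of_isMinOn (hA : Convex ℝ A) {c : ℝ} (hc : 0 < c) {w x x' : Fin n → ℝ}
    (hx : x ∈ A) (hmin : IsMinOn (fun u => w ⬝ᵥ u + c * D.ω u) A x)
    (hx' : x' ∈ A) (hmin' : IsMinOn (fun u => w ⬝ᵥ u + c * D.ω u) A x') : x = x' := by
  have h := D.nrm_sq_le_of_isMinOn hA hc hx hmin hx' hmin'
  simp only [sub_self, zero_dotProduct] at h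
  have h0 : D.nrm (x - x') ^ 2 ≤ 0 := by
    have : 0 < c * D.α / 2 := by have := D.α_pos; positivity
    by_contra! h3
    nlinarith
  exact sub_eq_zero.1 (D.nrm_definite _ (pow_eq_zero_iff two_ne_zero |>.1
    (le_antisymm h0 (sq_nonneg _))))

theorem continuous_mirror (hA : Convex ℝ A) (hcl : IsClosed A) (hne : A.Nonempty) {c : ℝ}
    (hc : 0 < c) : Continuous (D.mirror c) := by
  obtain ⟨e, he, hle⟩ := D.nrm.exists_norm_le D.nrm_definite
  have hα := D.α_pos
  have : LipschitzWith (Real.toNNReal (n * e ^ 2 / (c * D.α / 2))) (D.mirror c) := by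
    refine LipschitzWith.of_dist_le_mul fun w w' => ?_
    rw [Real.coe_toNNReal _ (by positivity), dist_eq_norm, dist_eq_norm]
    obtain ⟨hx, hmin⟩ := D.mirror_spec hA hcl hne c w
    obtain ⟨hx', hmin'⟩ := D.mirror_spec hA hcl hne c w'
    have h := D.nrm_sq_le_of_isMinOn hA hc hx hmin hx' hmin'
    set x := D.mirror c w
    set x' := D.mirror c w'
    have h2 := (le_abs_self _).trans (abs_dotProduct_le_norm (w - w') (x' - x))
    rw [norm_sub_rev x' x] at h2
    have h3 := hle (x - x')
    have h4 : ‖x - x'‖ ^ 2 ≤ e ^ 2 * D.nrm (x - x') ^ 2 := by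
      rw [← mul_pow]; exact pow_le_pow_left₀ (norm_nonneg _) h3 2
    by_cases h0 : ‖x - x'‖ = 0
    · rw [h0]; positivity
    · have hpos : 0 < ‖x - x'‖ := lt_of_le_of_ne (norm_nonneg _) (Ne.symm h0)
      rw [div_mul_eq_mul_div, le_div_iff₀ (by positivity)]
      refine le_of_mul_le_mul_right ?_ hpos
      have h5 : e ^ 2 * (c * D.α / 2 * D.nrm (x - x') ^ 2) ≤ e ^ 2 * (n * ‖w - w'‖ * ‖x - x'‖) :=
        mul_le_mul_of_nonneg_left (h.trans h2) (by positivity)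
      have h6 := mul_le_mul_of_nonneg_left h4 (show 0 ≤ c * D.α / 2 by positivity)
      nlinarith
  exact this.continuous

/-- Optimality says that -w/c is a subgradient. Hence all mirror descent iterates stay where ω has a
gradient. -/
theorem mem_subgradDomain_of_isMinOn {c : ℝ} (hc : 0 < c) {w x : Fin n → ℝ}
    (hx : x ∈ A) (hmin : IsMinOn (fun u => w ⬝ᵥ u + c * D.ω u) A x) :
    x ∈ subgradDomain A D.ω := by
  refine ⟨hx, -(c⁻¹ • w), fun y hy => ?_⟩
  have h := isMinOn_iff.1 hmin y hy
  simp only [neg_dotProduct, smul_dotProduct, dotProduct_sub, smul_eq_mul]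
  have h2 : c⁻¹ * (w ⬝ᵥ x + c * D.ω x) ≤ c⁻¹ * (w ⬝ᵥ y + c * D.ω y) :=
    mul_le_mul_of_nonneg_left h (inv_pos.2 hc).le
  have h3 : c⁻¹ * c = 1 := inv_mul_cancel₀ hc.ne'
  have e1 : c⁻¹ * (w ⬝ᵥ x + c * D.ω x) = c⁻¹ * w ⬝ᵥ x + D.ω x := by
    rw [mul_add, ← mul_assoc, h3, one_mul]
  have e2 : c⁻¹ * (w ⬝ᵥ y + c * D.ω y) = c⁻¹ * w ⬝ᵥ y + D.ω y := by
    rw [mul_add, ← mul_assoc, h3, one_mul]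
  rw [e1, e2] at h2
  linarith

/-- The gradient exists only relative to A, so the one-sided derivative along a segment inside A
replaces the usual directional derivative. -/
theorem tendsto_slope (hA : Convex ℝ A) {u v : Fin n → ℝ} (hu : u ∈ subgradDomain A D.ω)
    (hv : v ∈ A) :
    Filter.Tendsto (fun b : ℝ => b⁻¹ * (D.ω (u + b • (v - u)) - D.ω u))
      (nhdsWithin 0 (Set.Ioi 0)) (nhds (D.grad u ⬝ᵥ (v - u))) := by
  have h1 := D.hasGrad u hu
  have h2 : HasDerivWithinAt (fun b : ℝ => u + b • (v - u)) (v - u) (Set.Icc 0 1) 0 := by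
    have : HasDerivAt (fun b : ℝ => u + b • (v - u)) ((1 : ℝ) • (v - u)) 0 :=
      ((hasDerivAt_id (0 : ℝ)).smul_const (v - u)).const_add u
    rw [one_smul] at this
    exact this.hasDerivWithinAt
  have hm : Set.MapsTo (fun b : ℝ => u + b • (v - u)) (Set.Icc 0 1) A := by
    intro b hb
    have := hA hu.1 hv (sub_nonneg.2 hb.2) hb.1 (sub_add_cancel 1 b)
    convert this using 1
    module
  have h3 : HasDerivWithinAt (D.ω ∘ fun b : ℝ => u + b • (v - u)) (dotForm (D.grad u) (v - u))
      (Set.Icc 0 1) 0 := by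
    refine HasFDerivWithinAt.comp_hasDerivWithinAt (0 : ℝ) ?_ h2 hm
    simpa using h1
  rw [dotForm_apply] at h3
  have h4 := hasDerivWithinAt_iff_tendsto_slope.1 h3
  have h5 : nhdsWithin (0 : ℝ) (Set.Ioi 0) ≤ nhdsWithin 0 (Set.Icc 0 1 \ {0}) := by
    have : Set.Icc (0 : ℝ) 1 \ {0} = Set.Ioc 0 1 := Set.Icc_sdiff_left
    rw [this, nhdsWithin_Ioc_eq_nhdsGT one_pos]
  refine (h4.mono_left h5).congr fun b => ?_
  simp [slope, vsub_eq_sub]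

theorem strong_gradient_ineq (hA : Convex ℝ A) {u v : Fin n → ℝ} (hu : u ∈ subgradDomain A D.ω)
    (hv : v ∈ A) : D.ω u + D.grad u ⬝ᵥ (v - u) + D.α / 2 * D.nrm (v - u) ^ 2 ≤ D.ω v := by
  have h1 := D.tendsto_slope hA hu hv
  have h2 : Filter.Tendsto (fun b : ℝ => D.ω v - D.ω u - (1 - b) * (D.α / 2 * D.nrm (u - v) ^ 2))
      (nhdsWithin 0 (Set.Ioi 0)) (nhds (D.ω v - D.ω u - (1 - 0) * (D.α / 2 * D.nrm (u - v) ^ 2))) := by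
    refine Filter.Tendsto.mono_left ?_ nhdsWithin_le_nhds
    refine Continuous.tendsto (f := fun b : ℝ =>
      D.ω v - D.ω u - (1 - b) * (D.α / 2 * D.nrm (u - v) ^ 2)) (by fun_prop) 0
  have h3 := le_of_tendsto_of_tendsto h1 h2 (by
    filter_upwards [Ioc_mem_nhdsGT (zero_lt_one' ℝ)] with b hb
    have := D.strongly_convex u hu.1 v hv (1 - b) b (sub_nonneg.2 hb.2) hb.1.le (by ring)
    have e : u + b • (v - u) = (1 - b) • u + b • v := by module
    rw [e, inv_mul_le_iff₀ hb.1]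
    linarith)
  rw [map_sub_rev D.nrm v u]
  linarith

theorem first_order_of_isMinOn (hA : Convex ℝ A) {c : ℝ} (hc : 0 < c) {w x y : Fin n → ℝ}
    (hx : x ∈ A) (hmin : IsMinOn (fun u => w ⬝ᵥ u + c * D.ω u) A x) (hy : y ∈ A) :
    0 ≤ w ⬝ᵥ (y - x) + c * D.grad x ⬝ᵥ (y - x) := by
  have h1 := D.tendsto_slope hA (D.mem_subgradDomain_of_isMinOn hc hx hmin) hy
  have h2 := (h1.const_mul c).const_add (w ⬝ᵥ (y - x))
  rw [mul_comm c (D.grad x ⬝ᵥ (y - x))] at h2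
  rw [mul_comm c]
  refine ge_of_tendsto h2 ?_
  filter_upwards [Ioc_mem_nhdsGT (zero_lt_one' ℝ)] with b hb
  have hm : x + b • (y - x) ∈ A := by
    have := hA hx hy (sub_nonneg.2 hb.2) hb.1.le (sub_add_cancel 1 b)
    convert this using 1
    module
  have h3 := isMinOn_iff.1 hmin _ hm
  simp only [dotProduct_add, dotProduct_smul, smul_eq_mul] at h3
  have h4 : 0 ≤ b⁻¹ * (b * w ⬝ᵥ (y - x) + c * (D.ω (x + b • (y - x)) - D.ω x)) :=
    mul_nonneg (inv_pos.2 hb.1).le (by linarith)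
  rw [mul_add, inv_mul_cancel_left₀ hb.1.ne'] at h4
  linarith

/-- The mirror descent inequality for the scaled distance-generating function `c * ω`. -/
theorem mirror_descent (hA : Convex ℝ A) {c : ℝ} (hc : 0 < c) (hcd : c * D.diam ^ 2 ≤ 1 / 2)
    (u g : ℕ → Fin n → ℝ) (hu : ∀ t, u t ∈ A) (h0 : IsMinOn D.ω A (u 0))
    (hstep : ∀ t, IsMinOn (fun v => (g t - c • D.grad (u t)) ⬝ᵥ v + c * D.ω v) A (u (t + 1)))
    (N : ℕ) {v : Fin n → ℝ} (hv : v ∈ A) :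
    ∑ t ∈ Finset.range N, g t ⬝ᵥ (u t - v) ≤
      1 / 2 + ∑ t ∈ Finset.range N, dualNorm D.nrm (g t) ^ 2 / (2 * c * D.α) := by
  have hα := D.α_pos
  have h0' : IsMinOn (fun v => (0 : Fin n → ℝ) ⬝ᵥ v + c * D.ω v) A (u 0) := by
    refine isMinOn_iff.2 fun y hy => ?_
    simpa using mul_le_mul_of_nonneg_left (isMinOn_iff.1 h0 y hy) hc.le
  have hdom : ∀ t, u t ∈ subgradDomain A D.ω := by
    rintro (_ | t)
    · exact D.mem_subgradDomain_of_isMinOn hc (hu 0) h0'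
    · exact D.mem_subgradDomain_of_isMinOn hc (hu _) (hstep t)
  -- The potential is the scaled Bregman divergence from the current iterate to `v`; each step pays
  -- for its regret with a drop of the potential.
  have key : ∀ N, ∑ t ∈ Finset.range N, g t ⬝ᵥ (u t - v) +
      c * (D.ω v - D.ω (u N) - D.grad (u N) ⬝ᵥ (v - u N)) ≤
      c * (D.ω v - D.ω (u 0) - D.grad (u 0) ⬝ᵥ (v - u 0)) +
        ∑ t ∈ Finset.range N, dualNorm D.nrm (g t) ^ 2 / (2 * c * D.α) := by
    intro N
    induction N with
    | zero => simp
    | succ N ih =>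
      rw [Finset.sum_range_succ, Finset.sum_range_succ]
      have h1 := D.first_order_of_isMinOn hA hc (hu _) (hstep N) hv
      have h2 := mul_le_mul_of_nonneg_left (D.strong_gradient_ineq hA (hdom N) (hu (N + 1))) hc.le
      -- Young's inequality, weighted so that the quadratic term is the one gained from strong
      -- convexity in `h2`.
      have h3 : g N ⬝ᵥ (u N - u (N + 1)) ≤
          dualNorm D.nrm (g N) ^ 2 / (2 * c * D.α) + c * (D.α / 2 * D.nrm (u (N + 1) - u N) ^ 2) := by
        refine (dotProduct_le_dualNorm_mul D.nrm_definite _ _).trans ?_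
        rw [map_sub_rev D.nrm (u N) (u (N + 1))]
        set a := dualNorm D.nrm (g N)
        set b := D.nrm (u (N + 1) - u N)
        have : a ^ 2 / (2 * c * D.α) + c * (D.α / 2 * b ^ 2) - a * b =
            (a - c * D.α * b) ^ 2 / (2 * c * D.α) := by
          field_simp; ring
        have h5 : 0 ≤ (a - c * D.α * b) ^ 2 / (2 * c * D.α) := by positivity
        linarith
      simp only [sub_dotProduct, smul_dotProduct, dotProduct_sub, smul_eq_mul] at h1 h2 h3 ih ⊢
      linarith
  have h1 := key N
  have h2 := mul_le_mul_of_nonneg_left (D.strong_gradient_ineq hA (hdom N) hv) hc.le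
  -- Since `u 0` minimizes ω, the initial Bregman divergence is at most the oscillation of ω, and
  -- after scaling at most 1/2.
  have h3 : 0 ≤ D.grad (u 0) ⬝ᵥ (v - u 0) := by
    have := D.first_order_of_isMinOn hA hc (hu 0) h0' hv
    rw [zero_dotProduct, zero_add] at this
    exact nonneg_of_mul_nonneg_right this hc
  have h4 : 0 ≤ c * (D.α / 2 * D.nrm (v - u N) ^ 2) := by positivity
  have h5 := mul_le_mul_of_nonneg_left (D.sub_le_diam_sq hv (hu 0)) hc.le
  have h6 := mul_nonneg hc.le h3
  linarith

end DistGen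

/-! ### Pathwise regret bounds for OVSMD -/

/-- A separable objective decouples on a product, so the prox step on Z is one mirror step in X and
one in the simplex. The constant `k` absorbs the terms of the prox objective that do not depend on
z. -/
theorem argminOn_prod_spec {E F : Type*} [Nonempty E] [Nonempty F] {X : Set E} {Y : Set F}
    {h : E × F → ℝ} {a : E → ℝ} {b : F → ℝ} (k : ℝ) (hh : ∀ z, h z = a z.1 + b z.2 + k)
    (ha : ∃ x ∈ X, IsMinOn a X x) (hb : ∃ y ∈ Y, IsMinOn b Y y) :
    argminOn h (X ×ˢ Y) ∈ X ×ˢ Y ∧ IsMinOn a X (argminOn h (X ×ˢ Y)).1 ∧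
      IsMinOn b Y (argminOn h (X ×ˢ Y)).2 := by
  obtain ⟨x, hx, hxm⟩ := ha
  obtain ⟨y, hy, hym⟩ := hb
  obtain ⟨hz, hm⟩ := argminOn_spec (h := h) (A := X ×ˢ Y) ⟨(x, y), ⟨hx, hy⟩, by
    refine isMinOn_iff.2 fun z hz => ?_
    rw [hh, hh]
    have h1 := isMinOn_iff.1 hxm _ hz.1
    have h2 := isMinOn_iff.1 hym _ hz.2
    simp only; linarith⟩
  refine ⟨hz, isMinOn_iff.2 fun u hu => ?_, isMinOn_iff.2 fun u hu => ?_⟩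
  · have := isMinOn_iff.1 hm (u, (argminOn h (X ×ˢ Y)).2) ⟨hu, hz.2⟩
    rw [hh, hh] at this
    simp only at this; linarith
  · have := isMinOn_iff.1 hm ((argminOn h (X ×ˢ Y)).1, u) ⟨hz.1, hu⟩
    rw [hh, hh] at this
    simp only at this; linarith

theorem stdSimplex_nonempty {m : ℕ} : (stdSimplex ℝ (Fin (m + 1))).Nonempty :=
  ⟨_, single_mem_stdSimplex ℝ 0⟩

theorem dotProduct_le_ciSup_of_mem_stdSimplex {m : ℕ} {y : Fin (m + 1) → ℝ}
    (hy : y ∈ stdSimplex ℝ (Fin (m + 1))) (c : Fin (m + 1) → ℝ) :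
    y ⬝ᵥ c ≤ ⨆ i, c i := by
  calc y ⬝ᵥ c ≤ ∑ i, y i * ⨆ i, c i :=
        Finset.sum_le_sum fun i _ =>
          mul_le_mul_of_nonneg_left (le_ciSup (Finite.bddAbove_range c) i) (hy.1 i)
    _ = _ := by rw [← Finset.sum_mul, hy.2, one_mul]

theorem csSup_image_dotProduct_stdSimplex {m : ℕ} (c : Fin (m + 1) → ℝ) :
    sSup ((fun y => y ⬝ᵥ c) '' stdSimplex ℝ (Fin (m + 1))) = ⨆ i, c i := by
  have hb : ∀ a ∈ (fun y => y ⬝ᵥ c) '' stdSimplex ℝ (Fin (m + 1)), a ≤ ⨆ i, c i := by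
    rintro _ ⟨y, hy, rfl⟩
    exact dotProduct_le_ciSup_of_mem_stdSimplex hy c
  refine le_antisymm (csSup_le (stdSimplex_nonempty.image _) hb) (ciSup_le fun i => ?_)
  exact le_csSup ⟨_, hb⟩ ⟨Pi.single i 1, single_mem_stdSimplex ℝ i, by simp⟩

namespace FirstOrder

variable {d m : ℕ} {Ξ : Fin (m + 1) → Type*} [∀ i, MeasurableSpace (Ξ i)] {S : SOEC d m Ξ}
  (A : FirstOrder S)

/-- The scale `1 / (2 D_x²)` of `ω_x` in `ω_z`. -/
noncomputable def cx : ℝ := 1 / (2 * A.dx.diam ^ 2)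

/-- The scale `1 / (2 D_y²)` of `ω_y` in `ω_z`. -/
noncomputable def cy : ℝ := 1 / (2 * A.dy.diam ^ 2)

theorem cx_pos (hx : 0 < A.dx.diam ^ 2) : 0 < A.cx := by unfold cx; positivity

theorem cy_pos (hy : 0 < A.dy.diam ^ 2) : 0 < A.cy := by unfold cy; positivity

theorem cx_mul (hx : 0 < A.dx.diam ^ 2) : A.cx * A.dx.diam ^ 2 ≤ 1 / 2 := by
  unfold cx; rw [one_div, mul_inv, mul_assoc, inv_mul_cancel₀ hx.ne']; norm_num

theorem cy_mul (hy : 0 < A.dy.diam ^ 2) : A.cy * A.dy.diam ^ 2 ≤ 1 / 2 := by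
  unfold cy; rw [one_div, mul_inv, mul_assoc, inv_mul_cancel₀ hy.ne']; norm_num

theorem simplex_exists_isMinOn (c : ℝ) (w : Fin (m + 1) → ℝ) :
    ∃ x ∈ stdSimplex ℝ (Fin (m + 1)),
      IsMinOn (fun u => w ⬝ᵥ u + c * A.dy.ω u) (stdSimplex ℝ (Fin (m + 1))) x :=
  A.dy.exists_isMinOn (convex_stdSimplex _ _) (isClosed_stdSimplex _ _) stdSimplex_nonempty _ _

theorem iter_zero_spec (r : ℝ)
    (s : ℕ → ∀ i, Ξ i) :
    A.iter r s 0 ∈ A.Z ∧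
      IsMinOn (fun u => (0 : Fin d → ℝ) ⬝ᵥ u + A.cx * A.dx.ω u) S.X (A.iter r s 0).1 ∧
      IsMinOn (fun u => (0 : Fin (m + 1) → ℝ) ⬝ᵥ u + A.cy * A.dy.ω u)
        (stdSimplex ℝ (Fin (m + 1))) (A.iter r s 0).2 := by
  refine argminOn_prod_spec 0 (fun z => ?_)
    (A.dx.exists_isMinOn S.convex S.closed S.nonempty _ _) (A.simplex_exists_isMinOn _ _)
  simp only [omegaZ, cx, cy, zero_dotProduct]; ring

theorem iter_succ_spec (r : ℝ) (s : ℕ → ∀ i, Ξ i) (t : ℕ) :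
    A.iter r s (t + 1) ∈ A.Z ∧
      IsMinOn (fun u => (A.step t • A.Gx (A.iter r s t).1 (A.iter r s t).2 (s t) -
        A.cx • A.dx.grad (A.iter r s t).1) ⬝ᵥ u + A.cx * A.dx.ω u) S.X (A.iter r s (t + 1)).1 ∧
      IsMinOn (fun u => (A.step t • -A.Gy r (A.iter r s t).1 (s t) -
        A.cy • A.dy.grad (A.iter r s t).2) ⬝ᵥ u + A.cy * A.dy.ω u)
        (stdSimplex ℝ (Fin (m + 1))) (A.iter r s (t + 1)).2 := by
  set z := A.iter r s t with hz
  have e : A.iter r s (t + 1) = A.prox z (A.step t • (A.Gx z.1 z.2 (s t), -A.Gy r z.1 (s t))) := rfl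
  rw [e]
  refine argminOn_prod_spec
    (-(A.step t • A.Gx z.1 z.2 (s t)) ⬝ᵥ z.1 - (A.step t • -A.Gy r z.1 (s t)) ⬝ᵥ z.2
      - A.omegaZ z + A.cx * A.dx.grad z.1 ⬝ᵥ z.1 + A.cy * A.dy.grad z.2 ⬝ᵥ z.2) (fun u => ?_)
    (A.dx.exists_isMinOn S.convex S.closed S.nonempty _ _) (A.simplex_exists_isMinOn _ _)
  simp only [bregman, omegaZ, cx, cy, Prod.smul_fst, Prod.smul_snd, sub_dotProduct,
    smul_dotProduct, dotProduct_sub, smul_eq_mul, neg_dotProduct]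
  ring

theorem iter_mem (r : ℝ)
    (s : ℕ → ∀ i, Ξ i) : ∀ t, A.iter r s t ∈ A.Z
  | 0 => (A.iter_zero_spec r s).1
  | t + 1 => (A.iter_succ_spec r s t).1

theorem iter_fst_mem (r : ℝ)
    (s : ℕ → ∀ i, Ξ i) (t : ℕ) : (A.iter r s t).1 ∈ S.X := (A.iter_mem r s t).1

theorem iter_snd_mem (r : ℝ)
    (s : ℕ → ∀ i, Ξ i) (t : ℕ) : (A.iter r s t).2 ∈ stdSimplex ℝ (Fin (m + 1)) :=
  (A.iter_mem r s t).2

/-- The fluctuation `F_i(x, ξ_i) - f_i(x)`. -/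
noncomputable def fluct (_A : FirstOrder S) (x : Fin d → ℝ) (ξ : ∀ i, Ξ i) : Fin (m + 1) → ℝ :=
  fun i => S.F i x (ξ i) - S.f i x

/-- The auxiliary mirror descent sequence in the simplex that is driven by the fluctuations. -/
noncomputable def auxIter (r : ℝ) (s : ℕ → ∀ i, Ξ i) : ℕ → Fin (m + 1) → ℝ
  | 0 => A.dy.mirror A.cy 0
  | t + 1 => A.dy.mirror A.cy
      (A.step t • A.fluct (A.iter r s t).1 (s t) - A.cy • A.dy.grad (auxIter r s t))

theorem mirror_simplex_spec (w : Fin (m + 1) → ℝ) :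
    A.dy.mirror A.cy w ∈ stdSimplex ℝ (Fin (m + 1)) ∧
      IsMinOn (fun u => w ⬝ᵥ u + A.cy * A.dy.ω u) (stdSimplex ℝ (Fin (m + 1)))
        (A.dy.mirror A.cy w) :=
  A.dy.mirror_spec (convex_stdSimplex _ _) (isClosed_stdSimplex _ _) stdSimplex_nonempty _ _

theorem auxIter_mem (r : ℝ) (s : ℕ → ∀ i, Ξ i) :
    ∀ t, A.auxIter r s t ∈ stdSimplex ℝ (Fin (m + 1))
  | 0 => (A.mirror_simplex_spec _).1
  | _ + 1 => (A.mirror_simplex_spec _).1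

theorem isMinOn_of_zero {n : ℕ} {B : Set (Fin n → ℝ)} {ω : (Fin n → ℝ) → ℝ} {c : ℝ} (hc : 0 < c)
    {u : Fin n → ℝ} (h : IsMinOn (fun u => (0 : Fin n → ℝ) ⬝ᵥ u + c * ω u) B u) :
    IsMinOn ω B u := by
  refine isMinOn_iff.2 fun y hy => ?_
  have := isMinOn_iff.1 h y hy
  simp only [zero_dotProduct, zero_add] at this
  exact le_of_mul_le_mul_left this hc

theorem dualNorm_term_le {n : ℕ} {B : Set (Fin n → ℝ)} (D : DistGen B) (hD : 0 < D.diam ^ 2)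
    {γ : ℝ} (hγ : 0 ≤ γ) (g : Fin n → ℝ) :
    dualNorm D.nrm (γ • g) ^ 2 / (2 * (1 / (2 * D.diam ^ 2)) * D.α) ≤
      γ ^ 2 * (2 * D.diam ^ 2 / D.α * dualNorm D.nrm g ^ 2) / 2 := by
  have hα := D.α_pos
  have h := pow_le_pow_left₀ (dualNorm_nonneg D.nrm_definite _)
    (dualNorm_smul_of_nonneg D.nrm_definite g hγ) 2
  rw [div_le_iff₀ (by positivity)]
  refine h.trans (le_of_eq ?_)
  have : D.diam ≠ 0 := by rintro h0; simp [h0] at hD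
  field_simp

/-- The squared dual norm of the stochastic gradient with respect to the norm of `ω_z`. -/
noncomputable def gradSq (r : ℝ) (x : Fin d → ℝ) (y : Fin (m + 1) → ℝ) (ξ : ∀ i, Ξ i) : ℝ :=
  2 * A.dx.diam ^ 2 / A.dx.α * dualNorm A.dx.nrm (A.Gx x y ξ) ^ 2 +
    2 * A.dy.diam ^ 2 / A.dy.α * dualNorm A.dy.nrm (A.Gy r x ξ) ^ 2

/-- The squared dual norm of the fluctuation with respect to the norm of `ω_y / (2 D_y²)`. -/
noncomputable def fluctSq (x : Fin d → ℝ) (ξ : ∀ i, Ξ i) : ℝ :=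
  2 * A.dy.diam ^ 2 / A.dy.α * dualNorm A.dy.nrm (A.fluct x ξ) ^ 2

theorem step_nonneg (t : ℕ) : 0 ≤ A.step t := by
  unfold step M; positivity

theorem Gy_dot (r : ℝ) (x : Fin d → ℝ) (y : Fin (m + 1) → ℝ) (ξ : ∀ i, Ξ i) :
    A.Gy r x ξ ⬝ᵥ y = A.Phi r x y ξ := by
  rw [dotProduct_comm]; rfl

theorem Gx_dot_le {w x : Fin d → ℝ} (hw : w ∈ S.X) (hx : x ∈ S.X) {y : Fin (m + 1) → ℝ}
    (hy : y ∈ stdSimplex ℝ (Fin (m + 1))) (r : ℝ) (ξ : ∀ i, Ξ i) :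
    A.Phi r x y ξ - A.Phi r w y ξ ≤ A.Gx x y ξ ⬝ᵥ (x - w) := by
  have h : ∀ i, y i * (S.F i x (ξ i) - S.F i w (ξ i)) ≤ y i * A.F' i x (ξ i) ⬝ᵥ (x - w) := by
    intro i
    refine mul_le_mul_of_nonneg_left ?_ (hy.1 i)
    have := A.subgrad i x hx (ξ i) w hw
    simp only [dotProduct_sub] at this ⊢
    linarith
  have h2 := Finset.sum_le_sum fun i (_ : i ∈ Finset.univ) => h i
  unfold Gx Phi
  rw [sum_dotProduct, ← Finset.sum_sub_distrib]
  simp only [smul_dotProduct, smul_eq_mul]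
  refine le_trans (le_of_eq (Finset.sum_congr rfl fun i _ => ?_)) h2
  ring

/-- The regrets of the x-player and the y-player are added: the terms Φ(x^(t), y^(t), ξ^(t)) cancel,
and the two initial divergences contribute 1/2 each. -/
theorem sum_step_Phi_le (hx : 0 < A.dx.diam ^ 2) (hy : 0 < A.dy.diam ^ 2) (r : ℝ)
    (s : ℕ → ∀ i, Ξ i) (N : ℕ) {w : Fin d → ℝ} (hw : w ∈ S.X) {y : Fin (m + 1) → ℝ}
    (hy' : y ∈ stdSimplex ℝ (Fin (m + 1))) :
    ∑ t ∈ Finset.range N, A.step t * A.Phi r (A.iter r s t).1 y (s t) ≤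
      ∑ t ∈ Finset.range N, A.step t * A.Phi r w (A.iter r s t).2 (s t) + 1 +
        (∑ t ∈ Finset.range N,
          A.step t ^ 2 * A.gradSq r (A.iter r s t).1 (A.iter r s t).2 (s t)) / 2 := by
  have h1 := A.dx.mirror_descent S.convex (A.cx_pos hx) (A.cx_mul hx) (fun t => (A.iter r s t).1)
    (fun t => A.step t • A.Gx (A.iter r s t).1 (A.iter r s t).2 (s t))
    (A.iter_fst_mem r s) (isMinOn_of_zero (A.cx_pos hx) (A.iter_zero_spec r s).2.1)
    (fun t => (A.iter_succ_spec r s t).2.1) N hw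
  have h2 := A.dy.mirror_descent (convex_stdSimplex _ _) (A.cy_pos hy) (A.cy_mul hy)
    (fun t => (A.iter r s t).2)
    (fun t => A.step t • -A.Gy r (A.iter r s t).1 (s t))
    (A.iter_snd_mem r s) (isMinOn_of_zero (A.cy_pos hy) (A.iter_zero_spec r s).2.2)
    (fun t => (A.iter_succ_spec r s t).2.2) N hy'
  have h3 : ∑ t ∈ Finset.range N, (dualNorm A.dx.nrm
        (A.step t • A.Gx (A.iter r s t).1 (A.iter r s t).2 (s t)) ^ 2 / (2 * A.cx * A.dx.α) +
      dualNorm A.dy.nrm (A.step t • -A.Gy r (A.iter r s t).1 (s t)) ^ 2 / (2 * A.cy * A.dy.α)) ≤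
      ∑ t ∈ Finset.range N,
          A.step t ^ 2 * A.gradSq r (A.iter r s t).1 (A.iter r s t).2 (s t) / 2 := by
    refine Finset.sum_le_sum fun t _ => ?_
    have e1 := dualNorm_term_le A.dx hx (A.step_nonneg t)
      (A.Gx (A.iter r s t).1 (A.iter r s t).2 (s t))
    have e2 := dualNorm_term_le A.dy hy (A.step_nonneg t) (-A.Gy r (A.iter r s t).1 (s t))
    rw [dualNorm_neg] at e2
    unfold gradSq cx cy
    linarith
  have h4 : ∑ t ∈ Finset.range N, (A.step t * A.Phi r (A.iter r s t).1 y (s t) -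
      A.step t * A.Phi r w (A.iter r s t).2 (s t)) ≤
      ∑ t ∈ Finset.range N, ((A.step t • A.Gx (A.iter r s t).1 (A.iter r s t).2 (s t)) ⬝ᵥ
        ((A.iter r s t).1 - w) + (A.step t • -A.Gy r (A.iter r s t).1 (s t)) ⬝ᵥ
        ((A.iter r s t).2 - y)) := by
    refine Finset.sum_le_sum fun t _ => ?_
    have e := A.Gx_dot_le hw (A.iter_fst_mem r s t) (A.iter_snd_mem r s t) r (s t)
    simp only [smul_dotProduct, neg_dotProduct, smul_eq_mul, dotProduct_sub, Gy_dot] at e ⊢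
    have e2 := mul_le_mul_of_nonneg_left e (A.step_nonneg t)
    linarith
  rw [Finset.sum_sub_distrib, Finset.sum_add_distrib] at h4
  rw [Finset.sum_add_distrib] at h3
  rw [Finset.sum_div]
  linarith

/-- Replaces a comparator `y` by the predictable sequence `auxIter`, along which the fluctuations
form a martingale difference sequence. The bound is pathwise and uniform in `y`; a union bound over
the vertices would instead bring in m. -/
theorem sum_step_fluct_le (hy : 0 < A.dy.diam ^ 2) (r : ℝ)
    (s : ℕ → ∀ i, Ξ i) (N : ℕ) {y : Fin (m + 1) → ℝ} (hy' : y ∈ stdSimplex ℝ (Fin (m + 1))) :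
    -∑ t ∈ Finset.range N, A.step t * A.fluct (A.iter r s t).1 (s t) ⬝ᵥ y ≤
      -∑ t ∈ Finset.range N, A.step t * A.fluct (A.iter r s t).1 (s t) ⬝ᵥ A.auxIter r s t + 1 / 2 +
        (∑ t ∈ Finset.range N, A.step t ^ 2 * A.fluctSq (A.iter r s t).1 (s t)) / 2 := by
  have h2 := A.dy.mirror_descent (convex_stdSimplex _ _) (A.cy_pos hy) (A.cy_mul hy)
    (A.auxIter r s) (fun t => A.step t • A.fluct (A.iter r s t).1 (s t))
    (A.auxIter_mem r s) (isMinOn_of_zero (A.cy_pos hy) (A.mirror_simplex_spec _).2)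
    (fun t => (A.mirror_simplex_spec _).2) N hy'
  have h3 : ∑ t ∈ Finset.range N,
      dualNorm A.dy.nrm (A.step t • A.fluct (A.iter r s t).1 (s t)) ^ 2 / (2 * A.cy * A.dy.α) ≤
      ∑ t ∈ Finset.range N, A.step t ^ 2 * A.fluctSq (A.iter r s t).1 (s t) / 2 :=
    Finset.sum_le_sum fun t _ => dualNorm_term_le A.dy hy (A.step_nonneg t) _
  simp only [smul_dotProduct, smul_eq_mul, dotProduct_sub,
    Finset.sum_sub_distrib] at h2
  rw [Finset.sum_div]
  linarith

/-- Since Φ = G_y · y^(t), the bracket in U collapses to G_y · y, and a linear form on the simplex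
is maximal at a vertex. -/
theorem ovsmdU_eq (T : ℕ) (r : ℝ) (s : ℕ → ∀ i, Ξ i) :
    A.ovsmdU T r s = ⨆ i, (∑ t ∈ Finset.range (T + 1), A.step t)⁻¹ *
      ∑ t ∈ Finset.range (T + 1), A.step t * A.Gy r (A.iter r s t).1 (s t) i := by
  rw [← csSup_image_dotProduct_stdSimplex]
  unfold ovsmdU
  congr 1
  refine Set.image_congr fun y _ => ?_
  simp only [dotProduct_sub, Gy_dot, add_sub_cancel]
  rw [dotProduct, Finset.mul_sum]
  simp only [Phi, Finset.mul_sum]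
  rw [Finset.sum_comm]
  refine Finset.sum_congr rfl fun i _ => Finset.sum_congr rfl fun t _ => ?_
  unfold Gy; ring

end FirstOrder

/-! ### Measurability of the iterates and of the levels -/

theorem DistGen.measurable_grad_comp {n : ℕ} {B : Set (Fin n → ℝ)} (D : DistGen B)
    {Ω : Type*} [MeasurableSpace Ω] {u : Ω → Fin n → ℝ} (hu : Measurable u)
    (hmem : ∀ ω, u ω ∈ subgradDomain B D.ω) : Measurable fun ω => D.grad (u ω) := by
  have h1 : Continuous ((subgradDomain B D.ω).domRestrict D.grad) :=
    continuousOn_iff_continuous_domRestrict.1 D.continuousOn_grad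
  exact h1.measurable.comp (hu.subtype_mk (h := hmem))

theorem Measurable.dotProduct_right {n : ℕ} {Ω : Type*} [MeasurableSpace Ω]
    {u v : Ω → Fin n → ℝ} (hu : Measurable u) (hv : Measurable v) :
    Measurable fun ω => u ω ⬝ᵥ v ω := by
  unfold dotProduct
  exact Finset.measurable_sum _ fun i _ =>
    ((measurable_pi_apply i).comp hu).mul ((measurable_pi_apply i).comp hv)

theorem Measurable.smul_sub_smul {n : ℕ} {Ω : Type*} [MeasurableSpace Ω]
    {u v : Ω → Fin n → ℝ} (hu : Measurable u) (hv : Measurable v) (a c : ℝ) :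
    Measurable fun ω => a • u ω - c • v ω :=
  (hu.const_smul a).sub (hv.const_smul c)

namespace SOEC

variable {d m : ℕ} {Ξ : Fin (m + 1) → Type*} [∀ i, MeasurableSpace (Ξ i)] (S : SOEC d m Ξ)

instance : IsProbabilityMeasure S.law := S.isProb

theorem measurable_F_prod (i : Fin (m + 1)) : Measurable fun p : S.X × Ξ i => S.F i p.1 p.2 := by
  refine measurable_uncurry_of_continuous_of_measurable (u := fun (x : S.X) s => S.F i x s)
    (fun s => ?_) (fun x => S.measurable_F i x x.2)
  exact continuousOn_iff_continuous_domRestrict.1 (S.continuousOn_F i s)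

theorem measurable_f_subtype (i : Fin (m + 1)) : Measurable fun x : S.X => S.f i x := by
  have h : Measurable fun p : S.X × (∀ i, Ξ i) => S.F i p.1 (p.2 i) :=
    (S.measurable_F_prod i).comp
      (measurable_fst.prodMk ((measurable_pi_apply i).comp measurable_snd))
  exact (h.stronglyMeasurable.integral_prod_right' (ν := S.law)).measurable

variable {Ω : Type*} [MeasurableSpace Ω] {x : Ω → Fin d → ℝ} {ζ : Ω → ∀ i, Ξ i}

theorem measurable_f_comp (hx : Measurable x) (hmem : ∀ ω, x ω ∈ S.X) (i : Fin (m + 1)) :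
    Measurable fun ω => S.f i (x ω) :=
  (S.measurable_f_subtype i).comp (hx.subtype_mk (h := hmem))

theorem measurable_F_comp (hx : Measurable x) (hmem : ∀ ω, x ω ∈ S.X) (hζ : Measurable ζ)
    (i : Fin (m + 1)) : Measurable fun ω => S.F i (x ω) (ζ ω i) :=
  (S.measurable_F_prod i).comp
    ((hx.subtype_mk (h := hmem)).prodMk ((measurable_pi_apply i).comp hζ))

theorem measurable_level (i : Fin (m + 1)) : Measurable fun r => S.level r i := by
  refine Fin.cases ?_ (fun j => ?_) i
  · exact measurable_id
  · exact measurable_const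

end SOEC

namespace FirstOrder

variable {d m : ℕ} {Ξ : Fin (m + 1) → Type*} [∀ i, MeasurableSpace (Ξ i)] {S : SOEC d m Ξ}
  (A : FirstOrder S)

theorem phi_eq {x : Fin d → ℝ} (hx : x ∈ S.X) (r : ℝ) (y : Fin (m + 1) → ℝ) :
    A.phi r x y = ∑ i, y i * (S.f i x - S.level r i) := by
  unfold phi Phi SOEC.f
  have h (i : Fin (m + 1)) : Integrable (fun ξ : ∀ i, Ξ i =>
      y i * (S.F i x (ξ i) - S.level r i)) S.law :=
    ((S.integrable_F i x hx).sub (integrable_const _)).const_mul _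
  rw [integral_finsetSum _ fun i _ => h i]
  refine Finset.sum_congr rfl fun i _ => ?_
  rw [integral_const_mul, integral_sub (S.integrable_F i x hx) (integrable_const _)]
  simp

theorem integrable_Phi {x : Fin d → ℝ} (hx : x ∈ S.X) (r : ℝ) (y : Fin (m + 1) → ℝ) :
    Integrable (A.Phi r x y) S.law :=
  integrable_finsetSum _ fun i _ => ((S.integrable_F i x hx).sub (integrable_const _)).const_mul _

theorem fluct_dot {x : Fin d → ℝ} (hx : x ∈ S.X) (r : ℝ) (y : Fin (m + 1) → ℝ) (ξ : ∀ i, Ξ i) :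
    A.fluct x ξ ⬝ᵥ y = A.Phi r x y ξ - A.phi r x y := by
  rw [A.phi_eq hx, Phi, ← Finset.sum_sub_distrib]
  refine Finset.sum_congr rfl fun i _ => ?_
  unfold fluct; ring

section Comp

variable {Ω : Type*} [MeasurableSpace Ω] {x : Ω → Fin d → ℝ} {y : Ω → Fin (m + 1) → ℝ}
  {ζ : Ω → ∀ i, Ξ i} {R : Ω → ℝ}

theorem measurable_Gx_comp (hx : Measurable x) (hmem : ∀ ω, x ω ∈ S.X) (hy : Measurable y)
    (hζ : Measurable ζ) : Measurable fun ω => A.Gx (x ω) (y ω) (ζ ω) := by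
  unfold Gx
  refine Finset.measurable_sum _ fun i _ => ((measurable_pi_apply i).comp hy).smul ?_
  exact (A.measurable_F' i).comp
    ((hx.subtype_mk (h := hmem)).prodMk ((measurable_pi_apply i).comp hζ))

theorem measurable_Gy_comp (hR : Measurable R) (hx : Measurable x) (hmem : ∀ ω, x ω ∈ S.X)
    (hζ : Measurable ζ) : Measurable fun ω => A.Gy (R ω) (x ω) (ζ ω) := by
  refine measurable_pi_lambda _ fun i => ?_
  exact (S.measurable_F_comp hx hmem hζ i).sub ((S.measurable_level i).comp hR)

theorem measurable_fluct_comp (hx : Measurable x) (hmem : ∀ ω, x ω ∈ S.X)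
    (hζ : Measurable ζ) : Measurable fun ω => A.fluct (x ω) (ζ ω) := by
  refine measurable_pi_lambda _ fun i => ?_
  exact (S.measurable_F_comp hx hmem hζ i).sub (S.measurable_f_comp hx hmem i)

theorem measurable_fluct_dot_comp (hx : Measurable x) (hmem : ∀ ω, x ω ∈ S.X) (hy : Measurable y)
    (hζ : Measurable ζ) : Measurable fun ω => A.fluct (x ω) (ζ ω) ⬝ᵥ y ω :=
  (A.measurable_fluct_comp hx hmem hζ).dotProduct_right hy

theorem measurable_gradSq_comp (hR : Measurable R) (hx : Measurable x) (hmem : ∀ ω, x ω ∈ S.X)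
    (hy : Measurable y) (hζ : Measurable ζ) :
    Measurable fun ω => A.gradSq (R ω) (x ω) (y ω) (ζ ω) :=
  ((((continuous_dualNorm A.dx.nrm_definite).measurable.comp
    (A.measurable_Gx_comp hx hmem hy hζ)).pow_const 2).const_mul _).add
  ((((continuous_dualNorm A.dy.nrm_definite).measurable.comp
    (A.measurable_Gy_comp hR hx hmem hζ)).pow_const 2).const_mul _)

theorem measurable_fluctSq_comp (hx : Measurable x) (hmem : ∀ ω, x ω ∈ S.X)
    (hζ : Measurable ζ) : Measurable fun ω => A.fluctSq (x ω) (ζ ω) :=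
  (((continuous_dualNorm A.dy.nrm_definite).measurable.comp
    (A.measurable_fluct_comp hx hmem hζ)).pow_const 2).const_mul _

end Comp

theorem iter_fst_mem_subgradDomain (hx : 0 < A.dx.diam ^ 2) (r : ℝ)
    (s : ℕ → ∀ i, Ξ i) : ∀ t, (A.iter r s t).1 ∈ subgradDomain S.X A.dx.ω
  | 0 => A.dx.mem_subgradDomain_of_isMinOn (A.cx_pos hx) (A.iter_fst_mem r s 0)
      (A.iter_zero_spec r s).2.1
  | t + 1 => A.dx.mem_subgradDomain_of_isMinOn (A.cx_pos hx) (A.iter_fst_mem r s _)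
      (A.iter_succ_spec r s t).2.1

theorem iter_snd_mem_subgradDomain (hy : 0 < A.dy.diam ^ 2) (r : ℝ)
    (s : ℕ → ∀ i, Ξ i) : ∀ t, (A.iter r s t).2 ∈ subgradDomain (stdSimplex ℝ (Fin (m + 1))) A.dy.ω
  | 0 => A.dy.mem_subgradDomain_of_isMinOn (A.cy_pos hy) (A.iter_snd_mem r s 0)
      (A.iter_zero_spec r s).2.2
  | t + 1 => A.dy.mem_subgradDomain_of_isMinOn (A.cy_pos hy) (A.iter_snd_mem r s _)
      (A.iter_succ_spec r s t).2.2

theorem auxIter_mem_subgradDomain (hy : 0 < A.dy.diam ^ 2) (r : ℝ)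
    (s : ℕ → ∀ i, Ξ i) : ∀ t, A.auxIter r s t ∈ subgradDomain (stdSimplex ℝ (Fin (m + 1))) A.dy.ω
  | 0 => A.dy.mem_subgradDomain_of_isMinOn (A.cy_pos hy) (A.mirror_simplex_spec _).1
      (A.mirror_simplex_spec _).2
  | _ + 1 => A.dy.mem_subgradDomain_of_isMinOn (A.cy_pos hy) (A.mirror_simplex_spec _).1
      (A.mirror_simplex_spec _).2

/-- Strong convexity makes the minimizer unique, so the arbitrary choice in `argminOn` is a pair of
mirror maps, which are continuous in their argument. -/
theorem iter_succ_eq (hx : 0 < A.dx.diam ^ 2) (hy : 0 < A.dy.diam ^ 2) (r : ℝ)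
    (s : ℕ → ∀ i, Ξ i) (t : ℕ) : A.iter r s (t + 1) =
      (A.dx.mirror A.cx (A.step t • A.Gx (A.iter r s t).1 (A.iter r s t).2 (s t) -
        A.cx • A.dx.grad (A.iter r s t).1),
      A.dy.mirror A.cy (A.step t • -A.Gy r (A.iter r s t).1 (s t) -
        A.cy • A.dy.grad (A.iter r s t).2)) := by
  obtain ⟨h1, h2, h3⟩ := A.iter_succ_spec r s t
  refine Prod.ext ?_ ?_
  · have h := A.dx.mirror_spec S.convex S.closed S.nonempty A.cx
      (A.step t • A.Gx (A.iter r s t).1 (A.iter r s t).2 (s t) - A.cx • A.dx.grad (A.iter r s t).1)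
    exact A.dx.eq_of_isMinOn S.convex (A.cx_pos hx) h1.1 h2 h.1 h.2
  · have h := A.mirror_simplex_spec (A.step t • -A.Gy r (A.iter r s t).1 (s t) -
        A.cy • A.dy.grad (A.iter r s t).2)
    exact A.dy.eq_of_isMinOn (convex_stdSimplex _ _) (A.cy_pos hy) h1.2 h3 h.1 h.2

variable {Ω : Type*} {mΩ : MeasurableSpace Ω} {R : Ω → ℝ} {ζ : ℕ → Ω → ∀ i, Ξ i}

/-- Only the samples before `t` are required to be measurable, and the σ-algebra is arbitrary:
applied to a filtration, this says that the iterates are predictable. -/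
theorem measurable_iter (hx : 0 < A.dx.diam ^ 2) (hy : 0 < A.dy.diam ^ 2) (hR : Measurable R) :
    ∀ t, (∀ k < t, Measurable (ζ k)) → Measurable fun ω => A.iter (R ω) (fun k => ζ k ω) t
  | 0, _ => by
    have : (fun ω => A.iter (R ω) (fun k => ζ k ω) 0) = fun _ => argminOn A.omegaZ A.Z := rfl
    rw [this]; exact measurable_const
  | t + 1, hζ => by
    have ih := measurable_iter hx hy hR t fun k hk => hζ k (hk.trans t.lt_succ_self)
    have hζt := hζ t t.lt_succ_self
    simp only [A.iter_succ_eq hx hy]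
    have h1 := measurable_fst.comp ih
    have h2 := measurable_snd.comp ih
    have hm : ∀ ω, (A.iter (R ω) (fun k => ζ k ω) t).1 ∈ S.X := fun ω => A.iter_fst_mem _ _ _
    refine Measurable.prodMk ?_ ?_
    · refine (A.dx.continuous_mirror S.convex S.closed S.nonempty (A.cx_pos hx)).measurable.comp ?_
      exact (A.measurable_Gx_comp h1 hm h2 hζt).smul_sub_smul
        (A.dx.measurable_grad_comp h1 fun ω => A.iter_fst_mem_subgradDomain hx _ _ _) _ _
    · refine (A.dy.continuous_mirror (convex_stdSimplex _ _) (isClosed_stdSimplex _ _)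
        stdSimplex_nonempty (A.cy_pos hy)).measurable.comp ?_
      exact (A.measurable_Gy_comp hR h1 hm hζt).neg.smul_sub_smul
        (A.dy.measurable_grad_comp h2 fun ω => A.iter_snd_mem_subgradDomain hy _ _ _) _ _

theorem measurable_auxIter (hx : 0 < A.dx.diam ^ 2) (hy : 0 < A.dy.diam ^ 2) (hR : Measurable R) :
    ∀ t, (∀ k < t, Measurable (ζ k)) → Measurable fun ω => A.auxIter (R ω) (fun k => ζ k ω) t
  | 0, _ => by simp only [auxIter]; exact measurable_const
  | t + 1, hζ => by
    have hlt : ∀ k < t, Measurable (ζ k) := fun k hk => hζ k (hk.trans t.lt_succ_self)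
    have ih := measurable_auxIter hx hy hR t hlt
    have h1 := measurable_fst.comp (A.measurable_iter hx hy hR t hlt)
    simp only [auxIter]
    refine (A.dy.continuous_mirror (convex_stdSimplex _ _) (isClosed_stdSimplex _ _)
      stdSimplex_nonempty (A.cy_pos hy)).measurable.comp ?_
    exact (A.measurable_fluct_comp h1 (fun ω => A.iter_fst_mem _ _ _)
      (hζ t t.lt_succ_self)).smul_sub_smul
        (A.dy.measurable_grad_comp ih fun ω => A.auxIter_mem_subgradDomain hy _ _ _) _ _

theorem measurable_ovsmdU (hx : 0 < A.dx.diam ^ 2) (hy : 0 < A.dy.diam ^ 2) (hR : Measurable R)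
    (T : ℕ) (hζ : ∀ k ≤ T, Measurable (ζ k)) :
    Measurable fun ω => A.ovsmdU T (R ω) (fun k => ζ k ω) := by
  simp only [ovsmdU_eq]
  refine Measurable.iSup fun i => Measurable.const_mul ?_ _
  refine Finset.measurable_sum _ fun t ht => Measurable.const_mul ?_ _
  have ht' : t ≤ T := Nat.lt_succ_iff.1 (Finset.mem_range.1 ht)
  have h1 := measurable_fst.comp
    (A.measurable_iter hx hy hR t fun k hk => hζ k (hk.le.trans ht'))
  exact (measurable_pi_apply i).comp
    (A.measurable_Gy_comp hR h1 (fun ω => A.iter_fst_mem _ _ _) (hζ t ht'))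

theorem measurable_sflsLevel (hx : 0 < A.dx.diam ^ 2) (hy : 0 < A.dy.diam ^ 2) (T : ℕ) (θ r₀ : ℝ)
    {ξ : ℕ → ℕ → Ω → ∀ i, Ξ i} :
    ∀ k, (∀ j < k, ∀ t, Measurable (ξ j t)) →
      Measurable fun ω => A.sflsLevel T θ r₀ (fun k t => ξ k t ω) k
  | 0, _ => measurable_const
  | k + 1, hξ => by
    have ih := measurable_sflsLevel hx hy T θ r₀ k fun j hj => hξ j (hj.trans k.lt_succ_self)
    simp only [sflsLevel]
    exact ih.add ((A.measurable_ovsmdU hx hy ih T fun t _ => hξ k k.lt_succ_self t).div_const _)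

end FirstOrder

/-! ### Exponential supermartingale bounds -/

section Concentration

/-- Conditioning on the past by Fubini: the pair (W, X) is independent of ζ, so their joint law is a
product and ζ can be integrated out first. -/
theorem lintegral_mul_comp_le {Ω α β : Type*} {m₀ mΩ : MeasurableSpace Ω} [MeasurableSpace α]
    [MeasurableSpace β] {μ : Measure Ω} [IsProbabilityMeasure μ] {ν : Measure β}
    [IsProbabilityMeasure ν] (hm₀ : m₀ ≤ mΩ) {W : Ω → ENNReal}
    {X : Ω → α} {ζ : Ω → β} (hW : Measurable[m₀] W) (hX : Measurable[m₀] X) (hζ : Measurable ζ)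
    (hind : Indep m₀ (MeasurableSpace.comap ζ inferInstance) μ) (hmap : μ.map ζ = ν)
    {g : α → β → ENNReal} (hg : Measurable (Function.uncurry g)) {c : ENNReal}
    (hc : ∀ ω, ∫⁻ s, g (X ω) s ∂ν ≤ c) :
    ∫⁻ ω, W ω * g (X ω) (ζ ω) ∂μ ≤ c * ∫⁻ ω, W ω ∂μ := by
  have hWX : Measurable[m₀] fun ω => (W ω, X ω) := hW.prodMk hX
  have hWX' : Measurable fun ω => (W ω, X ω) := hWX.mono hm₀ le_rfl
  have hI : IndepFun (fun ω => (W ω, X ω)) ζ μ :=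
    indep_of_indep_of_le_left hind hWX.comap_le
  have hprod := (indepFun_iff_map_prod_eq_prod_map_map hWX'.aemeasurable hζ.aemeasurable).1 hI
  rw [hmap] at hprod
  have hG : Measurable fun p : (ENNReal × α) × β => p.1.1 * g p.1.2 p.2 :=
    (measurable_fst.comp measurable_fst).mul
      (hg.comp ((measurable_snd.comp measurable_fst).prodMk measurable_snd))
  calc ∫⁻ ω, W ω * g (X ω) (ζ ω) ∂μ
      = ∫⁻ p, p.1.1 * g p.1.2 p.2 ∂(μ.map fun ω => ((W ω, X ω), ζ ω)) :=
        (lintegral_map hG (hWX'.prodMk hζ)).symm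
    _ = ∫⁻ q, ∫⁻ s, q.1 * g q.2 s ∂ν ∂(μ.map fun ω => (W ω, X ω)) := by
        rw [hprod, lintegral_prod _ hG.aemeasurable]
    _ = ∫⁻ ω, ∫⁻ s, W ω * g (X ω) s ∂ν ∂μ := lintegral_map hG.lintegral_prod_right' hWX'
    _ ≤ ∫⁻ ω, c * W ω ∂μ := by
        refine lintegral_mono fun ω => ?_
        simp only
        have hgx : Measurable (g (X ω)) := hg.comp measurable_prodMk_left
        rw [lintegral_const_mul _ hgx, mul_comm]
        exact mul_le_mul_left (hc ω) _
    _ = c * ∫⁻ ω, W ω ∂μ := lintegral_const_mul _ (hW.mono hm₀ le_rfl)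

variable {Ω α β : Type*} [mΩ : MeasurableSpace Ω] [MeasurableSpace α] [MeasurableSpace β]
  {μ : Measure Ω} [IsProbabilityMeasure μ] {ν : Measure β} [IsProbabilityMeasure ν]
  {𝓕 : ℕ → MeasurableSpace Ω} {X : ℕ → Ω → α} {ζ : ℕ → Ω → β} {h : ℕ → α → β → ℝ}
  {c : ℕ → ℝ}

/-- Peel off the last summand: the earlier factors are 𝓕 N-measurable, and the fresh sample
contributes at most exp(c N). -/
theorem lintegral_exp_sum_le (hle : ∀ t, 𝓕 t ≤ mΩ) (hmono : Monotone 𝓕)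
    (hζ : ∀ t, Measurable[𝓕 (t + 1)] (ζ t))
    (hind : ∀ t, Indep (𝓕 t) (MeasurableSpace.comap (ζ t) inferInstance) μ)
    (hmap : ∀ t, μ.map (ζ t) = ν) (hX : ∀ t, Measurable[𝓕 t] (X t))
    (hh : ∀ t, Measurable (Function.uncurry (h t)))
    (hc : ∀ t ω, ∫⁻ s, ENNReal.ofReal (Real.exp (h t (X t ω) s)) ∂ν ≤
      ENNReal.ofReal (Real.exp (c t))) (N : ℕ) :
    ∫⁻ ω, ENNReal.ofReal (Real.exp (∑ t ∈ Finset.range N, h t (X t ω) (ζ t ω))) ∂μ ≤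
      ENNReal.ofReal (Real.exp (∑ t ∈ Finset.range N, c t)) := by
  induction N with
  | zero => simp
  | succ N ih =>
    have hS : Measurable[𝓕 N] fun ω => ∑ t ∈ Finset.range N, h t (X t ω) (ζ t ω) := by
      refine Finset.measurable_sum _ fun t ht => ?_
      have ht' := Finset.mem_range.1 ht
      exact (hh t).comp (((hX t).mono (hmono ht'.le) le_rfl).prodMk
        ((hζ t).mono (hmono ht') le_rfl))
    have hW : Measurable[𝓕 N] fun ω =>
        ENNReal.ofReal (Real.exp (∑ t ∈ Finset.range N, h t (X t ω) (ζ t ω))) :=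
      ENNReal.measurable_ofReal.comp (Real.measurable_exp.comp hS)
    have key := lintegral_mul_comp_le (hle N) hW (hX N) ((hζ N).mono (hle (N + 1)) le_rfl) (hind N)
      (hmap N) (g := fun x s => ENNReal.ofReal (Real.exp (h N x s)))
      (ENNReal.measurable_ofReal.comp (Real.measurable_exp.comp (hh N))) (hc N)
    simp only [Finset.sum_range_succ, Real.exp_add]
    rw [ENNReal.ofReal_mul (Real.exp_nonneg _), mul_comm (ENNReal.ofReal _)]
    refine le_trans (le_of_eq (lintegral_congr fun ω => ?_)) (key.trans (mul_le_mul_right ih _))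
    rw [ENNReal.ofReal_mul (Real.exp_nonneg _)]

theorem measure_sum_gt_le (hle : ∀ t, 𝓕 t ≤ mΩ) (hmono : Monotone 𝓕)
    (hζ : ∀ t, Measurable[𝓕 (t + 1)] (ζ t))
    (hind : ∀ t, Indep (𝓕 t) (MeasurableSpace.comap (ζ t) inferInstance) μ)
    (hmap : ∀ t, μ.map (ζ t) = ν) (hX : ∀ t, Measurable[𝓕 t] (X t))
    (hh : ∀ t, Measurable (Function.uncurry (h t)))
    (hc : ∀ t ω, ∫⁻ s, ENNReal.ofReal (Real.exp (h t (X t ω) s)) ∂ν ≤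
      ENNReal.ofReal (Real.exp (c t))) (N : ℕ) (τ : ℝ) :
    μ {ω | ∑ t ∈ Finset.range N, c t + τ < ∑ t ∈ Finset.range N, h t (X t ω) (ζ t ω)} ≤
      ENNReal.ofReal (Real.exp (-τ)) := by
  have h1 := lintegral_exp_sum_le hle hmono hζ hind hmap hX hh hc N
  have hS : Measurable fun ω => ∑ t ∈ Finset.range N, h t (X t ω) (ζ t ω) :=
    Finset.measurable_sum _ fun t _ => (hh t).comp
      (((hX t).mono (hle t) le_rfl).prodMk ((hζ t).mono (hle _) le_rfl))
  have hW : Measurable fun ω =>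
      ENNReal.ofReal (Real.exp (∑ t ∈ Finset.range N, h t (X t ω) (ζ t ω))) :=
    ENNReal.measurable_ofReal.comp (Real.measurable_exp.comp hS)
  set e := ENNReal.ofReal (Real.exp (∑ t ∈ Finset.range N, c t + τ)) with he
  have he0 : e ≠ 0 := by simp [he, Real.exp_pos]
  have heT : e ≠ ⊤ := ENNReal.ofReal_ne_top
  have h2 := mul_meas_ge_le_lintegral (μ := μ) hW e
  have h3 : {ω | ∑ t ∈ Finset.range N, c t + τ < ∑ t ∈ Finset.range N, h t (X t ω) (ζ t ω)} ⊆
      {ω | e ≤ ENNReal.ofReal (Real.exp (∑ t ∈ Finset.range N, h t (X t ω) (ζ t ω)))} :=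
    fun ω hω => ENNReal.ofReal_le_ofReal (Real.exp_le_exp.2 (le_of_lt hω))
  have h4 : e * ENNReal.ofReal (Real.exp (-τ)) =
      ENNReal.ofReal (Real.exp (∑ t ∈ Finset.range N, c t)) := by
    rw [he, ← ENNReal.ofReal_mul (Real.exp_nonneg _), ← Real.exp_add, add_neg_cancel_right]
  refine (ENNReal.mul_le_mul_iff_right he0 heT).1 ?_
  rw [h4]
  exact (mul_le_mul_right (measure_mono h3) _).trans (h2.trans h1)

end Concentration

/-! ### Exponential moments of light-tailed variables -/

section ExpMoments

variable {β : Type*} [MeasurableSpace β] {ν : Measure β}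

/-- For a centered variable the linear term integrates to zero, which turns a bound on E exp(x²)
into a sub-Gaussian bound. -/
theorem Real.exp_le_self_add_exp_sq (x : ℝ) : Real.exp x ≤ x + Real.exp (x ^ 2) := by
  have h2 := Real.add_one_le_exp (x ^ 2)
  rcases le_total |x| 1 with h | h
  · have h1 := (abs_le.1 (Real.abs_exp_sub_one_sub_id_le h)).2
    linarith
  · rcases le_abs.1 h with h | h
    · have : Real.exp x ≤ Real.exp (x ^ 2) := Real.exp_le_exp.2 (by nlinarith)
      linarith
    · have : Real.exp x ≤ 1 := Real.exp_le_one_iff.2 (by linarith)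
      nlinarith

/-- Convexity of exp applied to the normalized exponents u - p and v - q. -/
theorem lintegral_exp_convex_comb_le {u v : β → ℝ} (hu : Measurable u) (hv : Measurable v)
    {a b p q : ℝ} (ha : 0 ≤ a) (hb : 0 ≤ b) (hab : a + b = 1)
    (h1 : ∫⁻ s, ENNReal.ofReal (Real.exp (u s)) ∂ν ≤ ENNReal.ofReal (Real.exp p))
    (h2 : ∫⁻ s, ENNReal.ofReal (Real.exp (v s)) ∂ν ≤ ENNReal.ofReal (Real.exp q)) :
    ∫⁻ s, ENNReal.ofReal (Real.exp (a * u s + b * v s)) ∂ν ≤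
      ENNReal.ofReal (Real.exp (a * p + b * q)) := by
  set E := Real.exp (a * p + b * q)
  have hE : 0 ≤ E := Real.exp_nonneg _
  have key : ∀ s, Real.exp (a * u s + b * v s) ≤
      E * a * Real.exp (-p) * Real.exp (u s) + E * b * Real.exp (-q) * Real.exp (v s) := by
    intro s
    have := convexOn_exp.2 (Set.mem_univ (u s - p)) (Set.mem_univ (v s - q)) ha hb hab
    simp only [smul_eq_mul] at this
    have h3 := mul_le_mul_of_nonneg_left this hE
    have h4 : E * Real.exp (a * (u s - p) + b * (v s - q)) = Real.exp (a * u s + b * v s) := by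
      rw [← Real.exp_add]; congr 1; ring
    rw [h4] at h3
    refine h3.trans (le_of_eq ?_)
    rw [sub_eq_add_neg, sub_eq_add_neg, Real.exp_add, Real.exp_add]; ring
  have hpq : E * a * Real.exp (-p) * Real.exp p + E * b * Real.exp (-q) * Real.exp q = E := by
    rw [mul_assoc _ (Real.exp (-p)), mul_assoc _ (Real.exp (-q)), ← Real.exp_add, ← Real.exp_add]
    simp only [neg_add_cancel, Real.exp_zero, mul_one]
    rw [← mul_add, hab, mul_one]
  calc ∫⁻ s, ENNReal.ofReal (Real.exp (a * u s + b * v s)) ∂ν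
      ≤ ∫⁻ s, (ENNReal.ofReal (E * a * Real.exp (-p)) * ENNReal.ofReal (Real.exp (u s)) +
          ENNReal.ofReal (E * b * Real.exp (-q)) * ENNReal.ofReal (Real.exp (v s))) ∂ν := by
        refine lintegral_mono fun s => ?_
        rw [← ENNReal.ofReal_mul (by positivity), ← ENNReal.ofReal_mul (by positivity),
          ← ENNReal.ofReal_add (by positivity) (by positivity)]
        exact ENNReal.ofReal_le_ofReal (key s)
    _ = ENNReal.ofReal (E * a * Real.exp (-p)) * ∫⁻ s, ENNReal.ofReal (Real.exp (u s)) ∂ν +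
          ENNReal.ofReal (E * b * Real.exp (-q)) * ∫⁻ s, ENNReal.ofReal (Real.exp (v s)) ∂ν := by
        rw [lintegral_add_left (by fun_prop), lintegral_const_mul _ (by fun_prop),
          lintegral_const_mul _ (by fun_prop)]
    _ ≤ ENNReal.ofReal (E * a * Real.exp (-p)) * ENNReal.ofReal (Real.exp p) +
          ENNReal.ofReal (E * b * Real.exp (-q)) * ENNReal.ofReal (Real.exp q) := by
        gcongr
    _ = ENNReal.ofReal E := by
        rw [← ENNReal.ofReal_mul (by positivity), ← ENNReal.ofReal_mul (by positivity),
          ← ENNReal.ofReal_add (by positivity) (by positivity), hpq]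

theorem lintegral_exp_mul_le [IsProbabilityMeasure ν] {v : β → ℝ} (hv : Measurable v) {p : ℝ} (hp : 0 ≤ p) (hp1 : p ≤ 1)
    (h : ∫⁻ s, ENNReal.ofReal (Real.exp (v s)) ∂ν ≤ ENNReal.ofReal (Real.exp 1)) :
    ∫⁻ s, ENNReal.ofReal (Real.exp (p * v s)) ∂ν ≤ ENNReal.ofReal (Real.exp p) := by
  have := lintegral_exp_convex_comb_le hv (measurable_const (a := (0 : ℝ))) hp
    (sub_nonneg.2 hp1) (add_sub_cancel p 1) h (q := 0) (by simp)
  simpa using this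

theorem integrable_exp_of_lintegral_le {v : β → ℝ} (hv : Measurable v) {p : ℝ}
    (h : ∫⁻ s, ENNReal.ofReal (Real.exp (v s)) ∂ν ≤ ENNReal.ofReal (Real.exp p)) :
    Integrable (fun s => Real.exp (v s)) ν ∧ ∫ s, Real.exp (v s) ∂ν ≤ Real.exp p := by
  have hi : Integrable (fun s => Real.exp (v s)) ν := by
    refine ⟨(Real.measurable_exp.comp hv).aestronglyMeasurable, ?_⟩
    rw [hasFiniteIntegral_iff_ofReal (Filter.Eventually.of_forall fun s => Real.exp_nonneg _)]
    exact h.trans_lt ENNReal.ofReal_lt_top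
  refine ⟨hi, ?_⟩
  rw [← ofReal_integral_eq_lintegral_ofReal hi
    (Filter.Eventually.of_forall fun s => Real.exp_nonneg _)] at h
  exact (ENNReal.ofReal_le_ofReal_iff (Real.exp_nonneg _)).1 h

theorem lintegral_exp_mul_le_of_centered [IsProbabilityMeasure ν] {n : β → ℝ} (hm : Measurable n) (hn : Integrable n ν)
    (hn0 : ∫ s, n s ∂ν = 0) {Q a : ℝ} (ha : a ^ 2 ≤ 1)
    (h : ∫⁻ s, ENNReal.ofReal (Real.exp (|n s| ^ 2 / Q ^ 2)) ∂ν ≤ ENNReal.ofReal (Real.exp 1)) :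
    ∫⁻ s, ENNReal.ofReal (Real.exp (a * n s / Q)) ∂ν ≤ ENNReal.ofReal (Real.exp (a ^ 2)) := by
  have hm2 : Measurable fun s => |n s| ^ 2 / Q ^ 2 := by fun_prop
  have h1 := lintegral_exp_mul_le hm2 (sq_nonneg a) ha h
  obtain ⟨hi, hle⟩ := integrable_exp_of_lintegral_le (hm2.const_mul (a ^ 2)) h1
  have hb : ∀ s, Real.exp (a * n s / Q) ≤ a / Q * n s + Real.exp (a ^ 2 * (|n s| ^ 2 / Q ^ 2)) := by
    intro s
    have := Real.exp_le_self_add_exp_sq (a * n s / Q)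
    rw [sq_abs]
    convert this using 2
    · ring
    · congr 1; ring
  have hsum : Integrable (fun s => a / Q * n s + Real.exp (a ^ 2 * (|n s| ^ 2 / Q ^ 2))) ν :=
    (hn.const_mul _).add hi
  calc ∫⁻ s, ENNReal.ofReal (Real.exp (a * n s / Q)) ∂ν
      ≤ ∫⁻ s, ENNReal.ofReal (a / Q * n s + Real.exp (a ^ 2 * (|n s| ^ 2 / Q ^ 2))) ∂ν :=
        lintegral_mono fun s => ENNReal.ofReal_le_ofReal (hb s)
    _ = ENNReal.ofReal (∫ s, a / Q * n s + Real.exp (a ^ 2 * (|n s| ^ 2 / Q ^ 2)) ∂ν) :=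
        (ofReal_integral_eq_lintegral_ofReal hsum (Filter.Eventually.of_forall fun s =>
          (Real.exp_nonneg _).trans (hb s))).symm
    _ ≤ ENNReal.ofReal (Real.exp (a ^ 2)) := by
        refine ENNReal.ofReal_le_ofReal ?_
        rw [integral_add (hn.const_mul _) hi, integral_const_mul, hn0, mul_zero, zero_add]
        exact hle

theorem integral_le_of_lintegral_exp_sq [IsProbabilityMeasure ν] {v : β → ℝ} (hv : Measurable v) {M : ℝ} (hM : 0 < M)
    (h : ∫⁻ s, ENNReal.ofReal (Real.exp (v s ^ 2 / M ^ 2)) ∂ν ≤ ENNReal.ofReal (Real.exp 1)) :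
    Integrable v ν ∧ ∫ s, v s ∂ν ≤ M := by
  have hm2 : Measurable fun s => v s ^ 2 / M ^ 2 := by fun_prop
  obtain ⟨hi, hle⟩ := integrable_exp_of_lintegral_le hm2 h
  -- First |v| ≤ M/2 + v²/(2M), then a ≤ exp(a - 1) with a = v²/M²; both are equalities at |v| = M,
  -- so the mean is at most M with no constant lost.
  have hb : ∀ s, |v s| ≤ M / 2 + M / 2 * Real.exp (-1) * Real.exp (v s ^ 2 / M ^ 2) := by
    intro s
    have h1 := Real.add_one_le_exp (v s ^ 2 / M ^ 2 - 1)
    rw [sub_add_cancel, sub_eq_add_neg, add_comm, Real.exp_add] at h1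
    have h2 : |v s| ≤ M / 2 + M / 2 * (v s ^ 2 / M ^ 2) := by
      have : M / 2 + M / 2 * (v s ^ 2 / M ^ 2) - |v s| = (M - |v s|) ^ 2 / (2 * M) := by
        rw [← sq_abs (v s)]; field_simp; ring
      have h3 : 0 ≤ (M - |v s|) ^ 2 / (2 * M) := by positivity
      linarith
    have h4 := mul_le_mul_of_nonneg_left h1 (show 0 ≤ M / 2 by positivity)
    linarith
  have hI : Integrable (fun s => M / 2 + M / 2 * Real.exp (-1) * Real.exp (v s ^ 2 / M ^ 2)) ν :=
    (integrable_const _).add (hi.const_mul _)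
  have hv' : Integrable v ν := hI.mono' hv.aestronglyMeasurable (Filter.Eventually.of_forall hb)
  refine ⟨hv', ?_⟩
  refine (integral_mono hv' hI fun s => (le_abs_self _).trans (hb s)).trans ?_
  rw [integral_add (integrable_const _) (hi.const_mul _), integral_const_mul]
  have h5 := mul_le_mul_of_nonneg_left hle (show 0 ≤ M / 2 * Real.exp (-1) by positivity)
  rw [mul_assoc (M / 2) (Real.exp (-1)) (Real.exp 1), ← Real.exp_add] at h5
  simp at h5 ⊢
  linarith

end ExpMoments

/-! ### Consequences of the light-tail conditions -/

namespace FirstOrder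

variable {d m : ℕ} {Ξ : Fin (m + 1) → Type*} [∀ i, MeasurableSpace (Ξ i)] {S : SOEC d m Ξ}
  (A : FirstOrder S)

theorem M_sq : A.M ^ 2 =
    2 * A.dx.diam ^ 2 / A.dx.α * A.Mx ^ 2 + 2 * A.dy.diam ^ 2 / A.dy.α * A.My ^ 2 := by
  have := A.dx.α_pos
  have := A.dy.α_pos
  exact Real.sq_sqrt (by positivity)

theorem M_pos (hx : 0 < A.dx.diam ^ 2) : 0 < A.M := by
  have := A.dx.α_pos
  have := A.dy.α_pos
  have := A.Mx_pos
  exact Real.sqrt_pos.2 (by positivity)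

theorem step_sq_mul (hx : 0 < A.dx.diam ^ 2) (t : ℕ) : A.step t ^ 2 * A.M ^ 2 = 1 / (t + 1) := by
  have h := A.M_pos hx
  have ht : (0 : ℝ) ≤ (t : ℝ) + 1 := by positivity
  unfold step
  rw [div_pow, mul_pow, Real.sq_sqrt ht]
  field_simp

theorem inv_succ_le_one (t : ℕ) : 1 / ((t : ℝ) + 1) ≤ 1 := by
  rw [div_le_one (by positivity)]
  have := Nat.cast_nonneg (α := ℝ) t
  linarith

variable {r : ℝ} {x : Fin d → ℝ} {y : Fin (m + 1) → ℝ}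

theorem measurable_Gx (hx : x ∈ S.X) (y : Fin (m + 1) → ℝ) : Measurable (A.Gx x y) :=
  A.measurable_Gx_comp measurable_const (fun _ => hx) measurable_const measurable_id

theorem measurable_Gy (r : ℝ) (hx : x ∈ S.X) : Measurable (A.Gy r x) :=
  A.measurable_Gy_comp measurable_const measurable_const (fun _ => hx) measurable_id

theorem measurable_fluct (hx : x ∈ S.X) : Measurable (A.fluct x) :=
  A.measurable_fluct_comp measurable_const (fun _ => hx) measurable_id

theorem measurable_dualNorm_Gx (hx : x ∈ S.X) (y : Fin (m + 1) → ℝ) :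
    Measurable fun ξ => dualNorm A.dx.nrm (A.Gx x y ξ) :=
  (continuous_dualNorm A.dx.nrm_definite).measurable.comp (A.measurable_Gx hx y)

theorem measurable_dualNorm_Gy (r : ℝ) (hx : x ∈ S.X) :
    Measurable fun ξ => dualNorm A.dy.nrm (A.Gy r x ξ) :=
  (continuous_dualNorm A.dy.nrm_definite).measurable.comp (A.measurable_Gy r hx)

/-- M² is exactly the weighted sum of M_x² and M_y², so dividing by it makes the exponent a convex
combination of the two light-tail exponents; γ_t² M² = 1/(t+1) does the rest. -/
theorem lintegral_exp_gradSq_le (hdx : 0 < A.dx.diam ^ 2) (hL : A.LightTailed r) (hx : x ∈ S.X)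
    (hy : y ∈ stdSimplex ℝ (Fin (m + 1))) (t : ℕ) :
    ∫⁻ ξ, ENNReal.ofReal (Real.exp (A.step t ^ 2 * A.gradSq r x y ξ)) ∂S.law ≤
      ENNReal.ofReal (Real.exp (1 / ((t : ℝ) + 1))) := by
  have hM := A.M_pos hdx
  have hMs := A.M_sq
  have := A.dx.α_pos
  have := A.dy.α_pos
  have hMx := A.Mx_pos
  have hMy := A.My_pos
  obtain ⟨h1, h2, -⟩ := hL x hx y hy
  have hu : Measurable fun ξ => dualNorm A.dx.nrm (A.Gx x y ξ) ^ 2 / A.Mx ^ 2 :=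
    ((A.measurable_dualNorm_Gx hx y).pow_const 2).div_const _
  have hv : Measurable fun ξ => dualNorm A.dy.nrm (A.Gy r x ξ) ^ 2 / A.My ^ 2 :=
    ((A.measurable_dualNorm_Gy r hx).pow_const 2).div_const _
  set wx := 2 * A.dx.diam ^ 2 / A.dx.α with hwx
  set wy := 2 * A.dy.diam ^ 2 / A.dy.α with hwy
  have hwx0 : 0 ≤ wx := by positivity
  have hwy0 : 0 ≤ wy := by positivity
  have key := lintegral_exp_convex_comb_le hu hv (a := wx * A.Mx ^ 2 / A.M ^ 2)
    (b := wy * A.My ^ 2 / A.M ^ 2) (by positivity) (by positivity)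
    (by rw [← add_div, ← hMs, div_self (by positivity)]) h1 h2
  have e1 : wx * A.Mx ^ 2 / A.M ^ 2 * 1 + wy * A.My ^ 2 / A.M ^ 2 * 1 = 1 := by
    rw [mul_one, mul_one, ← add_div, ← hMs, div_self (by positivity)]
  rw [e1] at key
  have := lintegral_exp_mul_le ((hu.const_mul _).add (hv.const_mul _))
    (show 0 ≤ 1 / ((t : ℝ) + 1) by positivity) (inv_succ_le_one t) key
  refine le_trans (le_of_eq (lintegral_congr fun ξ => ?_)) this
  congr 2
  rw [← A.step_sq_mul hdx, gradSq, ← hwx, ← hwy]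
  simp only [Pi.add_apply]
  field_simp

theorem lintegral_exp_fluct_dot_le (hdx : 0 < A.dx.diam ^ 2) (hL : A.LightTailed r) (hx : x ∈ S.X)
    (hy : y ∈ stdSimplex ℝ (Fin (m + 1))) {σ : ℝ} (hσ : σ ^ 2 = 1) (t : ℕ) :
    ∫⁻ ξ, ENNReal.ofReal (Real.exp (σ * A.step t * A.M * A.fluct x ξ ⬝ᵥ y / A.Q)) ∂S.law ≤
      ENNReal.ofReal (Real.exp (1 / ((t : ℝ) + 1))) := by
  obtain ⟨-, -, h3⟩ := hL x hx y hy
  have e : ∀ ξ, A.Phi r x y ξ - A.phi r x y = A.fluct x ξ ⬝ᵥ y := fun ξ => (A.fluct_dot hx r y ξ).symm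
  simp only [e] at h3
  have hi : Integrable (fun ξ => A.fluct x ξ ⬝ᵥ y) S.law := by
    simp only [← e]
    exact (A.integrable_Phi hx r y).sub (integrable_const _)
  have h0 : ∫ ξ, A.fluct x ξ ⬝ᵥ y ∂S.law = 0 := by
    simp only [← e]
    rw [integral_sub (A.integrable_Phi hx r y) (integrable_const _)]
    simp [phi]
  have ha : (σ * A.step t * A.M) ^ 2 = 1 / ((t : ℝ) + 1) := by
    rw [mul_pow, mul_pow, hσ, one_mul, A.step_sq_mul hdx]
  have := lintegral_exp_mul_le_of_centered
    ((A.measurable_fluct hx).dotProduct_right measurable_const) hi h0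
    (by rw [ha]; exact inv_succ_le_one t) h3
  rwa [ha] at this

/-- Jensen's inequality for the dual norm, tested on each v of the unit ball. -/
theorem dualNorm_integral_Gy_le (hL : A.LightTailed r) (hx : x ∈ S.X) :
    dualNorm A.dy.nrm (fun i => S.f i x - S.level r i) ≤ A.My := by
  obtain ⟨-, h2, -⟩ := hL x hx _ (single_mem_stdSimplex ℝ 0)
  obtain ⟨hi, hle⟩ := integral_le_of_lintegral_exp_sq (A.measurable_dualNorm_Gy r hx) A.My_pos h2
  refine dualNorm_le _ fun v hv => ?_
  rw [dotProduct_comm]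
  have e := A.phi_eq hx r v
  change ∑ i, v i * (S.f i x - S.level r i) ≤ A.My
  rw [← e]
  refine le_trans (integral_mono (A.integrable_Phi hx r v) hi fun ξ => ?_) hle
  rw [← A.Gy_dot]
  exact le_csSup (dualNorm_bddAbove A.dy.nrm_definite _) ⟨v, hv, rfl⟩

/-- The hypothesis concerns G_y, not G_y - E G_y. Centering costs ‖Δ‖² ≤ 2‖G_y‖² + 2 M_y², and the
division by 4 absorbs this. -/
theorem lintegral_exp_fluctSq_le (hdx : 0 < A.dx.diam ^ 2) (hL : A.LightTailed r) (hx : x ∈ S.X)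
    (t : ℕ) :
    ∫⁻ ξ, ENNReal.ofReal (Real.exp (A.step t ^ 2 * A.fluctSq x ξ / 4)) ∂S.law ≤
      ENNReal.ofReal (Real.exp (1 / ((t : ℝ) + 1))) := by
  obtain ⟨-, h2, -⟩ := hL x hx _ (single_mem_stdSimplex ℝ 0)
  have hMs := A.M_sq
  have := A.dx.α_pos
  have := A.dy.α_pos
  have hMx := A.Mx_pos
  have hMy := A.My_pos
  have hv : Measurable fun ξ => dualNorm A.dy.nrm (A.Gy r x ξ) ^ 2 / A.My ^ 2 :=
    ((A.measurable_dualNorm_Gy r hx).pow_const 2).div_const _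
  have key := lintegral_exp_convex_comb_le hv (measurable_const (a := (1 : ℝ)))
    (show (0 : ℝ) ≤ 1 / 2 by norm_num) (show (0 : ℝ) ≤ 1 / 2 by norm_num) (by norm_num) h2
    (q := 1) (by simp)
  have e1 : (1 : ℝ) / 2 * 1 + 1 / 2 * 1 = 1 := by norm_num
  rw [e1] at key
  have := lintegral_exp_mul_le ((hv.const_mul _).add measurable_const)
    (show 0 ≤ 1 / ((t : ℝ) + 1) by positivity) (inv_succ_le_one t) key
  refine le_trans (lintegral_mono fun ξ => ?_) this
  refine ENNReal.ofReal_le_ofReal (Real.exp_le_exp.2 ?_)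
  have hg := A.dualNorm_integral_Gy_le hL hx
  have hsub : A.fluct x ξ = A.Gy r x ξ - fun i => S.f i x - S.level r i := by
    funext i; simp [fluct, Gy]
  have h5 := dualNorm_sub_le A.dy.nrm_definite (A.Gy r x ξ) fun i => S.f i x - S.level r i
  rw [← hsub] at h5
  rw [← A.step_sq_mul hdx, fluctSq, mul_div_assoc, mul_assoc]
  simp only [Pi.add_apply]
  refine mul_le_mul_of_nonneg_left ?_ (sq_nonneg _)
  set G := dualNorm A.dy.nrm (A.Gy r x ξ)
  set Δ := dualNorm A.dy.nrm (A.fluct x ξ)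
  have hΔ : 0 ≤ Δ := dualNorm_nonneg A.dy.nrm_definite _
  have h6 : Δ ^ 2 ≤ 2 * G ^ 2 + 2 * A.My ^ 2 := by
    have : Δ ^ 2 ≤ (G + A.My) ^ 2 := pow_le_pow_left₀ hΔ (h5.trans (by linarith)) 2
    nlinarith [sq_nonneg (G - A.My)]
  set wy := 2 * A.dy.diam ^ 2 / A.dy.α with hwy
  have hwy0 : 0 ≤ wy := by positivity
  have h7 : wy * A.My ^ 2 ≤ A.M ^ 2 := by
    rw [hMs]
    exact le_add_of_nonneg_left (by positivity)
  calc wy * Δ ^ 2 / 4 ≤ wy * (2 * G ^ 2 + 2 * A.My ^ 2) / 4 := by gcongr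
    _ = wy * A.My ^ 2 * (1 / 2 * (G ^ 2 / A.My ^ 2) + 1 / 2 * 1) := by field_simp; ring
    _ ≤ A.M ^ 2 * (1 / 2 * (G ^ 2 / A.My ^ 2) + 1 / 2 * 1) := by gcongr

/-- One subgradient at one point has integrable norm and X is bounded. For i = 0 this makes the real
infima in f* and H genuine ones. -/
theorem bddBelow_f (hL : A.LightTailed r) (i : Fin (m + 1)) : BddBelow (S.f i '' S.X) := by
  obtain ⟨x, hx⟩ := S.nonempty
  have hy := single_mem_stdSimplex ℝ i
  obtain ⟨h1, -, -⟩ := hL x hx _ hy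
  obtain ⟨hi, hle⟩ := integral_le_of_lintegral_exp_sq (A.measurable_dualNorm_Gx hx _) A.Mx_pos h1
  have hα := A.dx.α_pos
  refine ⟨S.f i x - A.Mx * Real.sqrt (A.dx.diam ^ 2 / (A.dx.α / 8)), ?_⟩
  rintro _ ⟨w, hw, rfl⟩
  have hn : A.dx.nrm (x - w) ≤ Real.sqrt (A.dx.diam ^ 2 / (A.dx.α / 8)) := by
    refine Real.le_sqrt_of_sq_le ?_
    rw [le_div_iff₀ (by positivity), mul_comm]
    exact A.dx.nrm_sq_le S.convex hx hw
  have h2 : ∫ ξ, (A.Phi r x (Pi.single i 1) ξ - A.Phi r w (Pi.single i 1) ξ) ∂S.law ≤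
      ∫ ξ, dualNorm A.dx.nrm (A.Gx x (Pi.single i 1) ξ) * A.dx.nrm (x - w) ∂S.law := by
    refine integral_mono ((A.integrable_Phi hx r _).sub (A.integrable_Phi hw r _))
      (hi.mul_const _) fun ξ => ?_
    exact (A.Gx_dot_le hw hx hy r ξ).trans (dotProduct_le_dualNorm_mul A.dx.nrm_definite _ _)
  rw [integral_sub (A.integrable_Phi hx r _) (A.integrable_Phi hw r _), integral_mul_const] at h2
  have e {u : Fin d → ℝ} (hu : u ∈ S.X) :
      A.phi r u (Pi.single i 1) = S.f i u - S.level r i := by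
    rw [A.phi_eq hu]; simp [Pi.single_apply]
  change A.phi r x _ - A.phi r w _ ≤ _ at h2
  rw [e hx, e hw] at h2
  have h3 := mul_le_mul hle hn (apply_nonneg _ _) A.Mx_pos.le
  linarith

end FirstOrder

/-! ### The level-set function H -/

namespace SOEC

variable {d m : ℕ} {Ξ : Fin (m + 1) → Type*} [∀ i, MeasurableSpace (Ξ i)] (S : SOEC d m Ξ)

theorem convexOn_f (i : Fin (m + 1)) : ConvexOn ℝ S.X (S.f i) := by
  refine ⟨S.convex, fun x hx y hy a b ha hb hab => ?_⟩
  have hxy := S.convex hx hy ha hb hab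
  have h : ∫ ξ, S.F i (a • x + b • y) (ξ i) ∂S.law ≤
      ∫ ξ, (a * S.F i x (ξ i) + b * S.F i y (ξ i)) ∂S.law :=
    integral_mono (S.integrable_F i _ hxy)
      (((S.integrable_F i x hx).const_mul a).add ((S.integrable_F i y hy).const_mul b))
      fun ξ => (S.convexOn_F i (ξ i)).2 hx hy ha hb hab
  rw [integral_add ((S.integrable_F i x hx).const_mul a) ((S.integrable_F i y hy).const_mul b),
    integral_const_mul, integral_const_mul] at h
  exact h

variable {S} in
theorem P_le_iff {r c : ℝ} {x : Fin d → ℝ} : S.P r x ≤ c ↔ ∀ i, S.f i x - S.level r i ≤ c :=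
  ciSup_le_iff (Finite.bddAbove_range _)

theorem le_P (r : ℝ) (x : Fin d → ℝ) (i : Fin (m + 1)) : S.f i x - S.level r i ≤ S.P r x :=
  P_le_iff.1 le_rfl i

theorem f_zero_le (r : ℝ) (x : Fin d → ℝ) : S.f 0 x ≤ r + S.P r x := by
  have := S.le_P r x 0
  simp only [level, Fin.cons_zero] at this
  linarith

theorem f_succ_le (r : ℝ) (x : Fin d → ℝ) (i : Fin m) : S.f i.succ x ≤ S.b i + S.P r x := by
  have := S.le_P r x i.succ
  simp only [level, Fin.cons_succ] at this
  linarith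

variable {S} in
theorem P_le_of {r c : ℝ} {x : Fin d → ℝ} (h0 : S.f 0 x - r ≤ c)
    (h : ∀ i : Fin m, S.f i.succ x - S.b i ≤ c) : S.P r x ≤ c :=
  P_le_iff.2 fun i => by
    refine Fin.cases ?_ (fun j => ?_) i
    · simpa [level] using h0
    · simpa [level] using h j

variable {S} in
theorem feasible_of_P_nonpos {r : ℝ} {x : Fin d → ℝ} (hx : x ∈ S.X) (h : S.P r x ≤ 0) :
    S.Feasible x :=
  ⟨hx, fun i => (S.f_succ_le r x i).trans (by linarith)⟩

/-- Joint convexity in (r, x) is what makes the partial infimum H convex. -/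
theorem P_convex {r s : ℝ} {x y : Fin d → ℝ} (hx : x ∈ S.X) (hy : y ∈ S.X) {a b : ℝ}
    (ha : 0 ≤ a) (hb : 0 ≤ b) (hab : a + b = 1) :
    S.P (a * r + b * s) (a • x + b • y) ≤ a * S.P r x + b * S.P s y := by
  have hf i := (S.convexOn_f i).2 hx hy ha hb hab
  simp only [smul_eq_mul] at hf
  refine P_le_of ?_ fun i => ?_
  · have h1 := mul_le_mul_of_nonneg_left (S.f_zero_le r x) ha
    have h2 := mul_le_mul_of_nonneg_left (S.f_zero_le s y) hb
    linarith [hf 0]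
  · have h1 := mul_le_mul_of_nonneg_left (S.f_succ_le r x i) ha
    have h2 := mul_le_mul_of_nonneg_left (S.f_succ_le s y i) hb
    have h3 : a * S.b i + b * S.b i = S.b i := by rw [← add_mul, hab, one_mul]
    linarith [hf i.succ]

theorem P_le_of_le {r s : ℝ} (h : r ≤ s) (x : Fin d → ℝ) : S.P s x ≤ S.P r x := by
  refine P_le_of ?_ fun i => ?_
  · linarith [S.f_zero_le r x]
  · linarith [S.f_succ_le r x i]

theorem P_le_add {r s : ℝ} (h : r ≤ s) (x : Fin d → ℝ) : S.P r x ≤ S.P s x + (s - r) := by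
  refine P_le_of ?_ fun i => ?_
  · linarith [S.f_zero_le s x]
  · linarith [S.f_succ_le s x i]

variable {S} (hbdd : BddBelow (S.f 0 '' S.X))
include hbdd

theorem bddBelow_P (r : ℝ) : BddBelow (S.P r '' S.X) := by
  obtain ⟨c, hc⟩ := hbdd
  refine ⟨c - r, ?_⟩
  rintro _ ⟨x, hx, rfl⟩
  have h1 := hc ⟨x, hx, rfl⟩
  have h2 := S.f_zero_le r x
  linarith

theorem H_le_P (r : ℝ) {x : Fin d → ℝ} (hx : x ∈ S.X) : S.H r ≤ S.P r x :=
  csInf_le (bddBelow_P hbdd r) ⟨x, hx, rfl⟩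

omit hbdd in
theorem exists_P_lt (r : ℝ) {c : ℝ} (hc : S.H r < c) : ∃ x ∈ S.X, S.P r x < c := by
  obtain ⟨_, ⟨x, hx, rfl⟩, h⟩ := exists_lt_of_csInf_lt (S.nonempty.image _) hc
  exact ⟨x, hx, h⟩

theorem H_le_add {r s : ℝ} (h : r ≤ s) : S.H r ≤ S.H s + (s - r) := by
  refine le_of_forall_pos_le_add fun ε hε => ?_
  obtain ⟨x, hx, hP⟩ := S.exists_P_lt s (lt_add_of_pos_right (S.H s) hε)
  linarith [H_le_P hbdd r hx, S.P_le_add h x]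

theorem H_convex {r s : ℝ} {a b : ℝ} (ha : 0 ≤ a) (hb : 0 ≤ b) (hab : a + b = 1) :
    S.H (a * r + b * s) ≤ a * S.H r + b * S.H s := by
  refine le_of_forall_pos_le_add fun ε hε => ?_
  obtain ⟨x, hx, hP⟩ := S.exists_P_lt r (lt_add_of_pos_right (S.H r) hε)
  obtain ⟨y, hy, hP'⟩ := S.exists_P_lt s (lt_add_of_pos_right (S.H s) hε)
  have h1 := H_le_P hbdd (a * r + b * s) (S.convex hx hy ha hb hab)
  have h2 := S.P_convex (r := r) (s := s) hx hy ha hb hab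
  have h3 := mul_le_mul_of_nonneg_left hP.le ha
  have h4 := mul_le_mul_of_nonneg_left hP'.le hb
  have h5 : a * ε + b * ε = ε := by rw [← add_mul, hab, one_mul]
  linarith

theorem fstar_le {x : Fin d → ℝ} (hx : S.Feasible x) : S.fstar ≤ S.f 0 x :=
  csInf_le (hbdd.mono (Set.image_mono fun _ h => h.1)) ⟨x, hx, rfl⟩

/-- A point with P(r, x) below this bound would be feasible with objective value below f*. -/
theorem neg_le_H {r : ℝ} (hr : S.fstar ≤ r) : -(r - S.fstar) ≤ S.H r := by
  refine le_csInf (S.nonempty.image _) ?_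
  rintro _ ⟨x, hx, rfl⟩
  by_contra! h
  have h1 := fstar_le hbdd (feasible_of_P_nonpos hx (r := r) (by linarith))
  linarith [S.f_zero_le r x]

variable (hfeas : S.StrictlyFeasible)
include hfeas

omit hbdd in
theorem exists_feasible_lt {c : ℝ} (hc : S.fstar < c) : ∃ x, S.Feasible x ∧ S.f 0 x < c := by
  obtain ⟨x₀, hx₀, h₀, -⟩ := hfeas
  have hne : (S.f 0 '' {x | S.Feasible x}).Nonempty :=
    ⟨_, x₀, ⟨hx₀, fun i => by linarith [h₀ i]⟩, rfl⟩
  obtain ⟨_, ⟨x, hx, rfl⟩, h⟩ := exists_lt_of_csInf_lt hne hc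
  exact ⟨x, hx, h⟩

theorem H_fstar_nonpos : S.H S.fstar ≤ 0 := by
  refine le_of_forall_pos_le_add fun ε hε => ?_
  obtain ⟨x, hx, h⟩ := exists_feasible_lt hfeas (lt_add_of_pos_right S.fstar hε)
  refine (H_le_P hbdd _ hx.1).trans (P_le_of (by linarith) fun i => ?_)
  linarith [hx.2 i]

theorem H_neg {r : ℝ} (hr : S.fstar < r) : S.H r < 0 := by
  obtain ⟨y, hy, hyr⟩ := exists_feasible_lt hfeas hr
  obtain ⟨x, hx, h, -⟩ := hfeas
  -- Move a little from a feasible point of value below r towards the strictly feasible one: `b` is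
  -- small enough to keep the objective below r, and every constraint becomes strict.
  have hlt : ∃ b : ℝ, 0 < b ∧ b ≤ 1 ∧ b * (S.f 0 x - S.f 0 y) < r - S.f 0 y := by
    rcases le_or_gt (S.f 0 x - S.f 0 y) 0 with h0 | h0
    · exact ⟨1, one_pos, le_rfl, by linarith⟩
    · refine ⟨min 1 ((r - S.f 0 y) / 2 / (S.f 0 x - S.f 0 y)), ?_, min_le_left _ _, ?_⟩
      · have : 0 < r - S.f 0 y := by linarith
        positivity
      · have h1 := mul_le_mul_of_nonneg_right
          (min_le_right 1 ((r - S.f 0 y) / 2 / (S.f 0 x - S.f 0 y))) h0.le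
        rw [div_mul_cancel₀ _ h0.ne'] at h1
        linarith
  obtain ⟨b, hb, hb1, hlt⟩ := hlt
  have hm := S.convex hy.1 hx (sub_nonneg.2 hb1) hb.le (by ring)
  have hf i := (S.convexOn_f i).2 hy.1 hx (sub_nonneg.2 hb1) hb.le (by ring)
  simp only [smul_eq_mul] at hf
  refine (H_le_P hbdd r hm).trans_lt ?_
  obtain ⟨i, hi⟩ := exists_eq_ciSup_of_finite
    (f := fun i => S.f i ((1 - b) • y + b • x) - S.level r i)
  rw [P, ← hi]
  have hb1' := sub_nonneg.2 hb1
  induction i using Fin.cases with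
  | zero => simp only [level, Fin.cons_zero]; linarith [hf 0]
  | succ j =>
    simp only [level, Fin.cons_succ]
    have h1 := mul_nonpos_of_nonneg_of_nonpos hb1' (sub_nonpos.2 (hy.2 j))
    have h2 := mul_neg_of_pos_of_neg hb (h j)
    linarith [hf j.succ]

/-- The chord of the convex function H from f*, where H is nonpositive, to s. -/
theorem H_le_div_mul {r s : ℝ} (hr : S.fstar ≤ r) (hrs : r ≤ s) (hs : S.fstar < s) :
    S.H r ≤ (r - S.fstar) / (s - S.fstar) * S.H s := by
  have hs' : 0 < s - S.fstar := sub_pos.2 hs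
  set a := (r - S.fstar) / (s - S.fstar) with ha
  have ha0 : 0 ≤ a := div_nonneg (sub_nonneg.2 hr) hs'.le
  have ha1 : a ≤ 1 := (div_le_one hs').2 (by linarith)
  have h := H_convex hbdd (r := S.fstar) (s := s) (sub_nonneg.2 ha1) ha0 (by ring)
  have e : (1 - a) * S.fstar + a * s = r := by
    have : a * (s - S.fstar) = r - S.fstar := div_mul_cancel₀ _ hs'.ne'
    linarith
  rw [e] at h
  have h2 := mul_nonpos_of_nonneg_of_nonpos (sub_nonneg.2 ha1) (H_fstar_nonpos hbdd hfeas)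
  linarith

omit hfeas in
-- The level is random, so the comparison point must depend measurably on it. Near-minimizers on a
-- grid of mesh h/2 suffice, because P decreases in r and H falls by at most the increase of r.
theorem exists_measurable_near_minimizer {h : ℝ} (hh : 0 < h) :
    ∃ w : ℝ → Fin d → ℝ, Measurable w ∧ ∀ r, w r ∈ S.X ∧ S.P r (w r) ≤ S.H r + h := by
  choose w hw hP using fun j : ℤ => S.exists_P_lt (j * (h / 2))
    (lt_add_of_pos_right (S.H (j * (h / 2))) (half_pos hh))
  have hh2 := half_pos hh
  refine ⟨fun r => w ⌊r / (h / 2)⌋, (measurable_of_countable w).comp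
    (Int.measurable_floor.comp (measurable_id.div_const _)), fun r => ⟨hw _, ?_⟩⟩
  set j := ⌊r / (h / 2)⌋ with hj
  have h1 : (j : ℝ) * (h / 2) ≤ r := (le_div_iff₀ hh2).1 (Int.floor_le _)
  have h2 : r < (j + 1) * (h / 2) := (div_lt_iff₀ hh2).1 (Int.lt_floor_add_one _)
  have h3 := H_le_add hbdd h1
  have h4 := S.P_le_of_le h1 (w j)
  have h5 := hP j
  change S.P r (w j) ≤ _
  linarith

end SOEC

/-! ### Accuracy of one oracle call -/

namespace FirstOrder

variable {d m : ℕ} {Ξ : Fin (m + 1) → Type*} [∀ i, MeasurableSpace (Ξ i)] {S : SOEC d m Ξ}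
  (A : FirstOrder S)

theorem step_pos (hdx : 0 < A.dx.diam ^ 2) (t : ℕ) : 0 < A.step t := by
  have := A.M_pos hdx
  unfold step; positivity

theorem sum_step_pos (hdx : 0 < A.dx.diam ^ 2) (T : ℕ) :
    0 < ∑ t ∈ Finset.range (T + 1), A.step t :=
  Finset.sum_pos (fun t _ => A.step_pos hdx t) ⟨0, by simp⟩

/-- There are T + 1 steps, each at least the last one, 1/(M √(T+1)). -/
theorem sqrt_le_M_mul_sum_step (hdx : 0 < A.dx.diam ^ 2) (T : ℕ) :
    Real.sqrt T ≤ A.M * ∑ t ∈ Finset.range (T + 1), A.step t := by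
  have hM := A.M_pos hdx
  have hT : 0 < Real.sqrt ((T : ℝ) + 1) := Real.sqrt_pos.2 (by positivity)
  have h : ∀ t ∈ Finset.range (T + 1), 1 / Real.sqrt ((T : ℝ) + 1) ≤ A.M * A.step t := by
    intro t ht
    have ht' : (t : ℝ) ≤ T := by exact_mod_cast Nat.lt_succ_iff.1 (Finset.mem_range.1 ht)
    have h1 : 0 < Real.sqrt ((t : ℝ) + 1) := Real.sqrt_pos.2 (by positivity)
    have : A.M * A.step t = 1 / Real.sqrt ((t : ℝ) + 1) := by
      unfold step; field_simp
    rw [this]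
    exact one_div_le_one_div_of_le h1 (Real.sqrt_le_sqrt (by linarith))
  have h2 := Finset.sum_le_sum h
  rw [← Finset.mul_sum, Finset.sum_const, Finset.card_range, nsmul_eq_mul] at h2
  refine le_trans ?_ h2
  have : ((T + 1 : ℕ) : ℝ) * (1 / Real.sqrt ((T : ℝ) + 1)) = Real.sqrt ((T : ℝ) + 1) := by
    rw [mul_one_div, div_eq_iff hT.ne', Real.mul_self_sqrt (by positivity)]
    push_cast; ring
  rw [this]
  exact Real.sqrt_le_sqrt (by linarith)

theorem inv_sum_step_mul_le (hdx : 0 < A.dx.diam ^ 2) {T : ℕ} (hT : 0 < T) {e : ℝ} (he : 0 ≤ e) :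
    (∑ t ∈ Finset.range (T + 1), A.step t)⁻¹ * e ≤ A.M * e / Real.sqrt T := by
  have h1 := A.sqrt_le_M_mul_sum_step hdx T
  have h2 := A.sum_step_pos hdx T
  have h3 : 0 < Real.sqrt T := Real.sqrt_pos.2 (by exact_mod_cast hT)
  rw [inv_mul_eq_div, div_le_div_iff₀ h2 h3]
  nlinarith

theorem ovsmdX_mem (hdx : 0 < A.dx.diam ^ 2) (T : ℕ) (r : ℝ) (s : ℕ → ∀ i, Ξ i) :
    A.ovsmdX T r s ∈ S.X := by
  have h := S.convex.centerMass_mem (t := Finset.range (T + 1)) (w := A.step)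
    (z := fun t => (A.iter r s t).1) (fun t _ => A.step_nonneg t) (A.sum_step_pos hdx T)
    (fun t _ => A.iter_fst_mem r s t)
  exact h

theorem f_ovsmdX_le (hdx : 0 < A.dx.diam ^ 2) (T : ℕ) (r : ℝ) (s : ℕ → ∀ i, Ξ i)
    (i : Fin (m + 1)) :
    S.f i (A.ovsmdX T r s) ≤ (∑ t ∈ Finset.range (T + 1), A.step t)⁻¹ *
      ∑ t ∈ Finset.range (T + 1), A.step t * S.f i (A.iter r s t).1 := by
  have h := (S.convexOn_f i).map_centerMass_le (t := Finset.range (T + 1)) (w := A.step)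
    (p := fun t => (A.iter r s t).1) (fun t _ => A.step_nonneg t) (A.sum_step_pos hdx T)
    (fun t _ => A.iter_fst_mem r s t)
  simpa [Finset.centerMass, ovsmdX] using h

theorem phi_le_P {w : Fin d → ℝ} (hw : w ∈ S.X) (r : ℝ) {y : Fin (m + 1) → ℝ}
    (hy : y ∈ stdSimplex ℝ (Fin (m + 1))) : A.phi r w y ≤ S.P r w := by
  rw [A.phi_eq hw]
  exact dotProduct_le_ciSup_of_mem_stdSimplex hy _

/-- Regret against `w`, with the noise of Φ(w, ·) split off by `fluct`. The noise costs Q B; the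
regret 1 + B/2 is rounded up to 2B. -/
theorem ovsmdU_le (hdx : 0 < A.dx.diam ^ 2) (hdy : 0 < A.dy.diam ^ 2) {T : ℕ} (hT : 0 < T) (r : ℝ)
    (s : ℕ → ∀ i, Ξ i) {w : Fin d → ℝ} (hw : w ∈ S.X) {B : ℝ} (hB : 1 ≤ B)
    (h1 : ∑ t ∈ Finset.range (T + 1),
      A.step t ^ 2 * A.gradSq r (A.iter r s t).1 (A.iter r s t).2 (s t) ≤ B)
    (h2 : ∑ t ∈ Finset.range (T + 1),
      1 * A.step t * A.M * A.fluct w (s t) ⬝ᵥ (A.iter r s t).2 / A.Q ≤ B) :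
    A.ovsmdU T r s ≤ S.P r w + (A.Q + 2 * A.M) * B / Real.sqrt T := by
  have hM := A.M_pos hdx
  have hQ := A.Q_pos
  have hS := A.sum_step_pos hdx T
  have h2' : ∑ t ∈ Finset.range (T + 1), A.step t * A.fluct w (s t) ⬝ᵥ (A.iter r s t).2 ≤
      A.Q / A.M * B := by
    have e : ∑ t ∈ Finset.range (T + 1),
        1 * A.step t * A.M * A.fluct w (s t) ⬝ᵥ (A.iter r s t).2 / A.Q = A.M / A.Q *
        ∑ t ∈ Finset.range (T + 1), A.step t * A.fluct w (s t) ⬝ᵥ (A.iter r s t).2 := by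
      rw [Finset.mul_sum]
      exact Finset.sum_congr rfl fun t _ => by ring
    rw [e, div_mul_eq_mul_div, div_le_iff₀ hQ] at h2
    rw [div_mul_eq_mul_div, le_div_iff₀ hM]
    linarith
  rw [A.ovsmdU_eq]
  refine ciSup_le fun i => ?_
  have h3 := A.sum_step_Phi_le hdx hdy r s (T + 1) hw (single_mem_stdSimplex ℝ i)
  have h4 : ∑ t ∈ Finset.range (T + 1), A.step t * A.Phi r w (A.iter r s t).2 (s t) ≤
      A.Q / A.M * B + (∑ t ∈ Finset.range (T + 1), A.step t) * S.P r w := by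
    refine le_trans ?_ (add_le_add_left h2' _)
    rw [Finset.sum_mul, ← Finset.sum_add_distrib]
    refine Finset.sum_le_sum fun t _ => ?_
    rw [A.fluct_dot hw r, ← mul_add]
    refine mul_le_mul_of_nonneg_left ?_ (A.step_nonneg t)
    linarith [A.phi_le_P hw r (A.iter_snd_mem r s t)]
  have h5 : ∑ t ∈ Finset.range (T + 1), A.step t * A.Gy r (A.iter r s t).1 (s t) i ≤
      (∑ t ∈ Finset.range (T + 1), A.step t) * S.P r w + (A.Q / A.M + 2) * B := by
    have e : ∀ t, A.Gy r (A.iter r s t).1 (s t) i =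
        A.Phi r (A.iter r s t).1 (Pi.single i 1) (s t) := fun t => by rw [← A.Gy_dot]; simp
    simp only [e]
    linarith
  have h6 := mul_le_mul_of_nonneg_left h5 (inv_pos.2 hS).le
  rw [mul_add, inv_mul_cancel_left₀ hS.ne'] at h6
  refine h6.trans (add_le_add_right ?_ _)
  refine (A.inv_sum_step_mul_le hdx hT (by positivity)).trans (le_of_eq ?_)
  congr 1
  field_simp

/-- By convexity f_i(x̄) is below the average of f_i(x^(t)), and U contains the average of the
sampled values. The regret 1/2 + 2B of the auxiliary sequence is rounded up to 3B. -/
theorem P_ovsmdX_le (hdx : 0 < A.dx.diam ^ 2) (hdy : 0 < A.dy.diam ^ 2) {T : ℕ} (hT : 0 < T)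
    (r : ℝ) (s : ℕ → ∀ i, Ξ i) {B : ℝ} (hB : 1 ≤ B)
    (h1 : ∑ t ∈ Finset.range (T + 1), A.step t ^ 2 * A.fluctSq (A.iter r s t).1 (s t) / 4 ≤ B)
    (h2 : ∑ t ∈ Finset.range (T + 1),
      (-1) * A.step t * A.M * A.fluct (A.iter r s t).1 (s t) ⬝ᵥ A.auxIter r s t / A.Q ≤ B) :
    S.P r (A.ovsmdX T r s) ≤ A.ovsmdU T r s + (A.Q + 3 * A.M) * B / Real.sqrt T := by
  have hM := A.M_pos hdx
  have hQ := A.Q_pos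
  have hS := A.sum_step_pos hdx T
  have h2' : -∑ t ∈ Finset.range (T + 1),
      A.step t * A.fluct (A.iter r s t).1 (s t) ⬝ᵥ A.auxIter r s t ≤ A.Q / A.M * B := by
    have e : ∑ t ∈ Finset.range (T + 1),
        (-1) * A.step t * A.M * A.fluct (A.iter r s t).1 (s t) ⬝ᵥ A.auxIter r s t / A.Q =
        A.M / A.Q * -∑ t ∈ Finset.range (T + 1),
          A.step t * A.fluct (A.iter r s t).1 (s t) ⬝ᵥ A.auxIter r s t := by
      rw [← Finset.sum_neg_distrib, Finset.mul_sum]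
      exact Finset.sum_congr rfl fun t _ => by ring
    rw [e, div_mul_eq_mul_div, div_le_iff₀ hQ] at h2
    rw [div_mul_eq_mul_div, le_div_iff₀ hM]
    linarith
  rw [← Finset.sum_div] at h1
  refine SOEC.P_le_iff.2 fun i => ?_
  have h3 := A.sum_step_fluct_le hdy r s (T + 1) (single_mem_stdSimplex ℝ i)
  have h4 : ∑ t ∈ Finset.range (T + 1), A.step t * S.f i (A.iter r s t).1 =
      ∑ t ∈ Finset.range (T + 1), A.step t * A.Gy r (A.iter r s t).1 (s t) i +
      (∑ t ∈ Finset.range (T + 1), A.step t) * S.level r i -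
      ∑ t ∈ Finset.range (T + 1), A.step t * A.fluct (A.iter r s t).1 (s t) ⬝ᵥ Pi.single i 1 := by
    rw [Finset.sum_mul, ← Finset.sum_add_distrib, ← Finset.sum_sub_distrib]
    refine Finset.sum_congr rfl fun t _ => ?_
    simp only [dotProduct_single, mul_one, Gy, fluct]
    ring
  have h5 : ∑ t ∈ Finset.range (T + 1), A.step t * S.f i (A.iter r s t).1 ≤
      (∑ t ∈ Finset.range (T + 1), A.step t) * S.level r i +
      ∑ t ∈ Finset.range (T + 1), A.step t * A.Gy r (A.iter r s t).1 (s t) i +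
        (A.Q / A.M + 3) * B := by
    rw [h4]
    linarith
  have h6 := (A.f_ovsmdX_le hdx T r s i).trans
    (mul_le_mul_of_nonneg_left h5 (inv_pos.2 hS).le)
  rw [mul_add, mul_add, inv_mul_cancel_left₀ hS.ne'] at h6
  have h7 : (∑ t ∈ Finset.range (T + 1), A.step t)⁻¹ *
      ∑ t ∈ Finset.range (T + 1), A.step t * A.Gy r (A.iter r s t).1 (s t) i ≤
      A.ovsmdU T r s := by
    rw [A.ovsmdU_eq]
    exact le_ciSup (f := fun i => (∑ t ∈ Finset.range (T + 1), A.step t)⁻¹ *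
      ∑ t ∈ Finset.range (T + 1), A.step t * A.Gy r (A.iter r s t).1 (s t) i)
      (Finite.bddAbove_range _) i
  have h8 := A.inv_sum_step_mul_le hdx hT (e := (A.Q / A.M + 3) * B) (by positivity)
  have e : A.M * ((A.Q / A.M + 3) * B) = (A.Q + 3 * A.M) * B := by field_simp
  rw [e] at h8
  linarith

variable {Ω : Type*} [mΩ : MeasurableSpace Ω] {μ : Measure Ω} [IsProbabilityMeasure μ]

/-- With high probability, one call of OVSMD at a random level that is independent of its samples
estimates the level-set function from above and validates its output. -/
theorem measure_ovsmd_bad_le (hdx : 0 < A.dx.diam ^ 2) (hdy : 0 < A.dy.diam ^ 2)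
    (hbdd : BddBelow (S.f 0 '' S.X)) {𝓕 : ℕ → MeasurableSpace Ω} {ζ : ℕ → Ω → ∀ i, Ξ i}
    {R : Ω → ℝ} (hle : ∀ t, 𝓕 t ≤ mΩ) (hmono : Monotone 𝓕)
    (hζ : ∀ t, Measurable[𝓕 (t + 1)] (ζ t))
    (hind : ∀ t, Indep (𝓕 t) (MeasurableSpace.comap (ζ t) inferInstance) μ)
    (hmap : ∀ t, μ.map (ζ t) = S.law) (hR : Measurable[𝓕 0] R)
    (hL : ∀ ω, A.LightTailed (R ω)) {T : ℕ} (hT : 0 < T) {τ : ℝ} (hτ : 0 ≤ τ) {η : ℝ}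
    (hη : η = (A.Q + 3 * A.M) *
      (∑ t ∈ Finset.range (T + 1), 1 / ((t : ℝ) + 1) + τ) / Real.sqrt T) :
    μ {ω | ¬ (S.P (R ω) (A.ovsmdX T (R ω) fun t => ζ t ω) - η ≤
          A.ovsmdU T (R ω) (fun t => ζ t ω) ∧
        A.ovsmdU T (R ω) (fun t => ζ t ω) ≤ S.H (R ω) + η)} ≤
      4 * ENNReal.ofReal (Real.exp (-τ)) := by
  have hM := A.M_pos hdx
  have hQ := A.Q_pos
  set L := ∑ t ∈ Finset.range (T + 1), 1 / ((t : ℝ) + 1) with hLdef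
  have hL1 : 1 ≤ L := by
    rw [hLdef, Finset.sum_range_succ']
    have : 0 ≤ ∑ k ∈ Finset.range T, 1 / (((k + 1 : ℕ) : ℝ) + 1) :=
      Finset.sum_nonneg fun k _ => by positivity
    simp only [Nat.cast_zero, zero_add, div_one]
    linarith
  have hsq : 0 < Real.sqrt T := Real.sqrt_pos.2 (by exact_mod_cast hT)
  have hB : 1 ≤ L + τ := by linarith
  -- The slack of the near-minimizer is the one unit of M by which 3M in η exceeds the 2M of
  -- `ovsmdU_le`.
  obtain ⟨w, hwm, hw⟩ := SOEC.exists_measurable_near_minimizer hbdd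
    (h := A.M * (L + τ) / Real.sqrt T) (by positivity)
  have hRt : ∀ t, Measurable[𝓕 t] R := fun t => hR.mono (hmono (Nat.zero_le t)) le_rfl
  have hζlt : ∀ t, ∀ k < t, Measurable[𝓕 t] (ζ k) := fun t k hk =>
    (hζ k).mono (hmono hk) le_rfl
  have hit : ∀ t, Measurable[𝓕 t] fun ω => A.iter (R ω) (fun k => ζ k ω) t := fun t =>
    A.measurable_iter hdx hdy (hRt t) t (hζlt t)
  have hx : ∀ t, Measurable[𝓕 t] fun ω =>
      (⟨(A.iter (R ω) (fun k => ζ k ω) t).1, A.iter_fst_mem _ _ t⟩ : S.X) := fun t =>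
    (measurable_fst.comp (hit t)).subtype_mk
  have hy : ∀ t, Measurable[𝓕 t] fun ω => (A.iter (R ω) (fun k => ζ k ω) t).2 := fun t =>
    measurable_snd.comp (hit t)
  have hv : ∀ t, Measurable[𝓕 t] fun ω => A.auxIter (R ω) (fun k => ζ k ω) t := fun t =>
    A.measurable_auxIter hdx hdy (hRt t) t (hζlt t)
  have hwt : ∀ t, Measurable[𝓕 t] fun ω => (⟨w (R ω), (hw (R ω)).1⟩ : S.X) := fun t =>
    (hwm.comp (hRt t)).subtype_mk
  -- Four sums are controlled: gradient sizes (`b1`), noise at w along y^(t) (`b2`), fluctuation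
  -- sizes (`b3`) and noise along the auxiliary sequence (`b4`). Each is scaled to have exponential
  -- moments exp(1/(t+1)), so it exceeds L + τ with probability at most exp(-τ).
  have b1 := measure_sum_gt_le (X := fun t ω => (R ω,
      (⟨(A.iter (R ω) (fun k => ζ k ω) t).1, A.iter_fst_mem _ _ t⟩ : S.X),
      (A.iter (R ω) (fun k => ζ k ω) t).2))
    (h := fun t p s => A.step t ^ 2 * A.gradSq p.1 p.2.1 p.2.2 s)
    (c := fun t => 1 / ((t : ℝ) + 1)) hle hmono hζ hind hmap
    (fun t => (hRt t).prodMk ((hx t).prodMk (hy t)))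
    (fun t => (A.measurable_gradSq_comp (measurable_fst.comp measurable_fst)
      (measurable_subtype_coe.comp (measurable_fst.comp (measurable_snd.comp measurable_fst)))
      (fun p => p.1.2.1.2) (measurable_snd.comp (measurable_snd.comp measurable_fst))
      measurable_snd).const_mul _)
    (fun t ω => A.lintegral_exp_gradSq_le hdx (hL ω) (A.iter_fst_mem _ _ t)
      (A.iter_snd_mem _ _ t) t) (T + 1) τ
  have hmeas : ∀ (σ : ℝ) (t : ℕ), Measurable (Function.uncurry
      fun (p : S.X × (Fin (m + 1) → ℝ)) s => σ * A.step t * A.M * A.fluct p.1 s ⬝ᵥ p.2 / A.Q) :=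
    fun σ t => ((A.measurable_fluct_dot_comp
      (measurable_subtype_coe.comp (measurable_fst.comp measurable_fst)) (fun p => p.1.1.2)
      (measurable_snd.comp measurable_fst) measurable_snd).const_mul _).div_const _
  have b2 := measure_sum_gt_le (X := fun t ω => ((⟨w (R ω), (hw (R ω)).1⟩ : S.X),
      (A.iter (R ω) (fun k => ζ k ω) t).2))
    (h := fun t p s => 1 * A.step t * A.M * A.fluct p.1 s ⬝ᵥ p.2 / A.Q)
    (c := fun t => 1 / ((t : ℝ) + 1)) hle hmono hζ hind hmap
    (fun t => (hwt t).prodMk (hy t)) (hmeas 1)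
    (fun t ω => A.lintegral_exp_fluct_dot_le hdx (hL ω) (hw (R ω)).1
      (A.iter_snd_mem _ _ t) (by norm_num) t) (T + 1) τ
  have b3 := measure_sum_gt_le (X := fun t ω =>
      (⟨(A.iter (R ω) (fun k => ζ k ω) t).1, A.iter_fst_mem _ _ t⟩ : S.X))
    (h := fun t p s => A.step t ^ 2 * A.fluctSq p s / 4)
    (c := fun t => 1 / ((t : ℝ) + 1)) hle hmono hζ hind hmap hx
    (fun t => ((A.measurable_fluctSq_comp (measurable_subtype_coe.comp measurable_fst)
      (fun p => p.1.2) measurable_snd).const_mul _).div_const _)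
    (fun t ω => A.lintegral_exp_fluctSq_le hdx (hL ω) (A.iter_fst_mem _ _ t) t) (T + 1) τ
  have b4 := measure_sum_gt_le (X := fun t ω => (
      (⟨(A.iter (R ω) (fun k => ζ k ω) t).1, A.iter_fst_mem _ _ t⟩ : S.X),
      A.auxIter (R ω) (fun k => ζ k ω) t))
    (h := fun t p s => (-1) * A.step t * A.M * A.fluct p.1 s ⬝ᵥ p.2 / A.Q)
    (c := fun t => 1 / ((t : ℝ) + 1)) hle hmono hζ hind hmap
    (fun t => (hx t).prodMk (hv t)) (hmeas (-1))
    (fun t ω => A.lintegral_exp_fluct_dot_le hdx (hL ω) (A.iter_fst_mem _ _ t)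
      (A.auxIter_mem _ _ t) (by norm_num) t) (T + 1) τ
  refine (measure_mono (t := _ ∪ (_ ∪ (_ ∪ _))) ?_).trans
    ((measure_union_le _ _).trans (add_le_add b1 ((measure_union_le _ _).trans
      (add_le_add b2 ((measure_union_le _ _).trans (add_le_add b3 b4)))))) |>.trans
    (le_of_eq (by ring))
  intro ω hω
  by_contra hc
  simp only [Set.mem_union, Set.mem_ofPred_eq, not_or, not_lt] at hc
  obtain ⟨c1, c2, c3, c4⟩ := hc
  refine hω ⟨?_, ?_⟩
  · have := A.P_ovsmdX_le hdx hdy hT (R ω) (fun t => ζ t ω) hB c3 c4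
    rw [hη]; linarith
  · refine (A.ovsmdU_le hdx hdy hT (R ω) (fun t => ζ t ω) (hw (R ω)).1 hB c1 c2).trans ?_
    have e : (A.Q + 3 * A.M) * (L + τ) / Real.sqrt T =
      (A.Q + 2 * A.M) * (L + τ) / Real.sqrt T + A.M * (L + τ) / Real.sqrt T := by ring
    rw [hη, e]
    linarith [(hw (R ω)).2]

end FirstOrder

/-! ### The level iteration with an inexact oracle -/

/-- The deterministic analysis of the level iteration with an inexact oracle. -/
theorem level_iteration {H : ℝ → ℝ} {r U p : ℕ → ℝ} {fs θ η εopt β : ℝ} {n : ℕ}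
    (hθ : 1 < θ) (hη : 0 < η) (hεη : 9 * η ≤ εopt) (h0 : fs < r 0) (hβ : 0 < β)
    (hεH : 2 * εopt ≤ -H (r 0))
    (hrec : ∀ k, r (k + 1) = r k + U k / (2 * θ))
    (hlow : ∀ s, fs ≤ s → -(s - fs) ≤ H s)
    (hchord : ∀ s s', fs ≤ s → s ≤ s' → fs < s' → H s ≤ (s - fs) / (s' - fs) * H s')
    (hβH : ∀ s ∈ Set.Ioc fs (r 0), H s ≤ -(β * (s - fs)))
    (horacle : ∀ k ≤ n, r k ∈ Set.Ioc fs (r 0) →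
      H (r k) ≤ p k ∧ p k - η ≤ U k ∧ U k ≤ H (r k) + η)
    (hn : (r 0 - fs) * Real.exp (-(9 / 20 * (β / θ)) * n) ≤ 8 / 9 * εopt) :
    ∃ k ≤ n, (-εopt ≤ U k ∧ ∀ j < k, U j < -εopt) ∧ (∀ j ≤ k, p j ≤ 0) ∧
      β * (r k - fs) ≤ 2 * εopt := by
  have hθ0 : 0 < θ := by linarith
  have hstep : ∀ k ≤ n, r k ∈ Set.Ioc fs (r 0) → U k < -εopt →
      8 * η < r k - fs ∧ H (r k) ≤ -(8 * η) ∧ 7 / 16 * (r k - fs) ≤ r (k + 1) - fs ∧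
      r (k + 1) ≤ r k ∧ r (k + 1) - fs ≤ (r k - fs) * Real.exp (-(9 / 20 * (β / θ))) := by
    intro k hk hr hU
    obtain ⟨h1, h2, h3⟩ := horacle k hk hr
    have h4 := hlow (r k) hr.1.le
    have h5 := hβH (r k) hr
    have hD : 8 * η < r k - fs := by linarith
    have hUneg : U k / (2 * θ) ≤ 0 := div_nonpos_of_nonpos_of_nonneg (by linarith) (by linarith)
    -- With θ > 1 and η at most 1/8 of the gap, the update removes at most 9/16 of the gap.
    have hUlow : -((r k - fs + η) / 2) ≤ U k / (2 * θ) := by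
      rw [le_div_iff₀ (by positivity)]
      nlinarith
    -- Before the halt η < -U/9, so U ≤ H + η gives U ≤ (9/10) H: the oracle error costs only a
    -- tenth of the decrease.
    have hUup : U k / (2 * θ) ≤ -(9 / 20 * (β / θ)) * (r k - fs) := by
      rw [div_le_iff₀ (by positivity)]
      have : -(9 / 20 * (β / θ)) * (r k - fs) * (2 * θ) = -(9 / 10 * (β * (r k - fs))) := by
        field_simp; ring
      rw [this]; linarith
    refine ⟨hD, by linarith, ?_, ?_, ?_⟩
    · rw [hrec]; linarith
    · rw [hrec]; linarith
    · have h6 := Real.add_one_le_exp (-(9 / 20 * (β / θ)))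
      have h7 := mul_le_mul_of_nonneg_left h6 (show 0 ≤ r k - fs by linarith)
      rw [hrec]; linarith
  have hinv : ∀ k ≤ n, (∀ j < k, U j < -εopt) → r k ∈ Set.Ioc fs (r 0) ∧
      r k - fs ≤ (r 0 - fs) * Real.exp (-(9 / 20 * (β / θ)) * k) := by
    intro k
    induction k with
    | zero => intro _ _; exact ⟨⟨h0, le_rfl⟩, by simp⟩
    | succ k ih =>
      intro hk hU
      obtain ⟨hr, hd⟩ := ih (by omega) fun j hj => hU j (by omega)
      obtain ⟨s1, -, s3, s4, s5⟩ := hstep k (by omega) hr (hU k (by omega))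
      refine ⟨⟨by linarith, s4.trans hr.2⟩, s5.trans ?_⟩
      have := mul_le_mul_of_nonneg_right hd (Real.exp_nonneg (-(9 / 20 * (β / θ))))
      refine this.trans (le_of_eq ?_)
      rw [mul_assoc, ← Real.exp_add]
      congr 2; push_cast; ring
  -- Otherwise H(r n) < -εopt + η ≤ -(8/9) εopt, while the gap, which bounds -H, has already shrunk
  -- to (8/9) εopt.
  have hex : ∃ k, k ≤ n ∧ -εopt ≤ U k := by
    by_contra! hne
    obtain ⟨hr, hd⟩ := hinv n le_rfl fun j hj => hne j hj.le
    obtain ⟨h1, h2, -⟩ := horacle n le_rfl hr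
    linarith [hlow (r n) hr.1.le, hne n le_rfl]
  classical
  obtain ⟨hk, hUk⟩ := Nat.find_spec hex
  have hmin : ∀ j < Nat.find hex, U j < -εopt := fun j hj => by
    have := Nat.find_min hex hj
    push Not at this
    exact this (by omega)
  set k := Nat.find hex
  obtain ⟨hr, -⟩ := hinv k hk hmin
  obtain ⟨h1, h2, h3⟩ := horacle k hk hr
  -- The step into the halting level kept 7/16 of the gap, so the chord inequality keeps 7/16 of H(r
  -- j) ≤ -8η. At k = 0 the assumption on H(r 0) is used.
  have hHk : H (r k) ≤ -(2 * η) := by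
    rcases Nat.eq_zero_or_pos k with h | h
    · rw [h]; linarith
    · obtain ⟨j, hj⟩ := Nat.exists_eq_succ_of_ne_zero h.ne'
      rw [Nat.succ_eq_add_one] at hj
      obtain ⟨hrj, -⟩ := hinv j (by omega) fun i hi => hmin i (by omega)
      obtain ⟨s1, s2, s3, s4, -⟩ := hstep j (by omega) hrj (hmin j (by omega))
      rw [← hj] at s3 s4
      have hD : 0 < r j - fs := sub_pos.2 hrj.1
      have h5 : 7 / 16 ≤ (r k - fs) / (r j - fs) := (le_div_iff₀ hD).2 s3
      have h6 := hchord (r k) (r j) hr.1.le s4 hrj.1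
      nlinarith
  refine ⟨k, hk, ⟨hUk, hmin⟩, fun j hj => ?_, ?_⟩
  · rcases hj.lt_or_eq with hj | rfl
    · obtain ⟨hrj, -⟩ := hinv j (by omega) fun i hi => hmin i (by omega)
      linarith [(horacle j (by omega) hrj).2.1, hmin j hj]
    · linarith
  · linarith [hβH (r k) hr]

/-! ### Oracle calls at random levels -/

namespace FirstOrder

variable {d m : ℕ} {Ξ : Fin (m + 1) → Type*} [∀ i, MeasurableSpace (Ξ i)] {S : SOEC d m Ξ}
  (A : FirstOrder S) {Ω : Type*} [mΩ : MeasurableSpace Ω] {μ : Measure Ω} [IsProbabilityMeasure μ]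

/-- The oracle call number `k` of SFLS fails with small probability, as long as its level is in the
admissible range. -/
theorem measure_sfls_bad_le (hdx : 0 < A.dx.diam ^ 2) (hdy : 0 < A.dy.diam ^ 2) {r₀ : ℝ}
    (hr₀ : S.fstar < r₀) (hL : ∀ r ∈ Set.Ioc S.fstar r₀, A.LightTailed r)
    {ξ : ℕ → ℕ → Ω → ∀ i, Ξ i} (hξ : ∀ k t, Measurable (ξ k t))
    (hmap : ∀ k t, μ.map (ξ k t) = S.law)
    (hind : iIndepFun (fun p : ℕ × ℕ => ξ p.1 p.2) μ) (θ : ℝ) {T : ℕ} (hT : 0 < T) {τ : ℝ}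
    (hτ : 0 ≤ τ) {η : ℝ}
    (hη : η = (A.Q + 3 * A.M) *
      (∑ t ∈ Finset.range (T + 1), 1 / ((t : ℝ) + 1) + τ) / Real.sqrt T) (k : ℕ) :
    μ {ω | A.sflsLevel T θ r₀ (fun k t => ξ k t ω) k ∈ Set.Ioc S.fstar r₀ ∧
      ¬ (S.P (A.sflsLevel T θ r₀ (fun k t => ξ k t ω) k)
            (A.sflsX T θ r₀ (fun k t => ξ k t ω) k) - η ≤
          A.sflsU T θ r₀ (fun k t => ξ k t ω) k ∧
        A.sflsU T θ r₀ (fun k t => ξ k t ω) k ≤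
          S.H (A.sflsLevel T θ r₀ (fun k t => ξ k t ω) k) + η)} ≤
      4 * ENNReal.ofReal (Real.exp (-τ)) := by
  classical
  -- The samples available before draw `t` of call `k`; all of the earlier calls belong to them, so
  -- the level is 𝓕 0-measurable.
  let I : ℕ → Set (ℕ × ℕ) := fun t => {p | p.1 < k ∨ (p.1 = k ∧ p.2 < t)}
  let σ : ℕ × ℕ → MeasurableSpace Ω := fun p => MeasurableSpace.comap (ξ p.1 p.2) inferInstance
  let 𝓕 : ℕ → MeasurableSpace Ω := fun t => ⨆ p ∈ I t, σ p
  have hσ : ∀ p, σ p ≤ mΩ := fun p => (hξ p.1 p.2).comap_le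
  have hmem : ∀ t, ∀ p ∈ I t, Measurable[𝓕 t] (ξ p.1 p.2) := fun t p hp =>
    Measurable.mono (comap_measurable _) (le_iSup₂_of_le p hp le_rfl) le_rfl
  have hmono : Monotone 𝓕 := fun s t hst =>
    biSup_mono fun p hp => hp.imp_right fun h => ⟨h.1, h.2.trans_le hst⟩
  let r : Ω → ℝ := fun ω => A.sflsLevel T θ r₀ (fun k t => ξ k t ω) k
  have hr : Measurable[𝓕 0] r :=
    A.measurable_sflsLevel hdx hdy T θ r₀ k fun j hj t => hmem 0 (j, t) (Or.inl hj)
  -- Light tails hold only for admissible levels, so inadmissible ones are replaced by r₀; on the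
  -- event considered nothing changes.
  let R : Ω → ℝ := fun ω => if r ω ∈ Set.Ioc S.fstar r₀ then r ω else r₀
  have hR : Measurable[𝓕 0] R :=
    Measurable.ite (hr measurableSet_Ioc) hr measurable_const
  have hRmem : ∀ ω, R ω ∈ Set.Ioc S.fstar r₀ := fun ω => by
    by_cases h : r ω ∈ Set.Ioc S.fstar r₀
    · simpa only [R, if_pos h] using h
    · simp only [R, if_neg h]; exact ⟨hr₀, le_rfl⟩
  have hindep : ∀ t, Indep (𝓕 t) (MeasurableSpace.comap (ξ k t) inferInstance) μ := by
    intro t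
    have := indep_iSup_of_disjoint hσ hind.iIndep (S := I t) (T := {(k, t)})
      (Set.disjoint_singleton_right.2 (by simp [I]))
    rwa [iSup_singleton] at this
  refine le_trans (measure_mono ?_) (A.measure_ovsmd_bad_le (ζ := ξ k) (R := R) hdx hdy
    (A.bddBelow_f (hL r₀ ⟨hr₀, le_rfl⟩) 0) (fun t => iSup₂_le fun p _ => hσ p) hmono
    (fun t => hmem (t + 1) (k, t) (Or.inr ⟨rfl, t.lt_succ_self⟩)) hindep (hmap k) hR
    (fun ω => hL _ (hRmem ω)) hT hτ hη)
  rintro ω ⟨h1, h2⟩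
  have e : R ω = A.sflsLevel T θ r₀ (fun k t => ξ k t ω) k := if_pos h1
  simp only [Set.mem_ofPred_eq, e]
  exact h2

end FirstOrder

/-! ### Choice of the parameters and conclusion -/

theorem sum_inv_succ_le_one_add_log (n : ℕ) :
    ∑ t ∈ Finset.range n, 1 / ((t : ℝ) + 1) ≤ 1 + Real.log n := by
  have h := harmonic_le_one_add_log n
  refine le_trans (le_of_eq ?_) h
  rw [harmonic]
  push_cast
  exact Finset.sum_congr rfl fun t _ => by rw [one_div]

theorem SOEC.exists_ne_of_strictlyFeasible {d m : ℕ} {Ξ : Fin (m + 1) → Type*}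
    [∀ i, MeasurableSpace (Ξ i)] {S : SOEC d m Ξ} (h : S.StrictlyFeasible) :
    ∃ x ∈ S.X, ∃ y ∈ S.X, x ≠ y := by
  obtain ⟨x, hx, -, hlt⟩ := id h
  obtain ⟨y, hy, hyx⟩ := SOEC.exists_feasible_lt h hlt
  exact ⟨x, hx, y, hy.1, by rintro rfl; exact lt_irrefl _ hyx⟩

theorem FirstOrder.diam_dx_sq_pos {d m : ℕ} {Ξ : Fin (m + 1) → Type*}
    [∀ i, MeasurableSpace (Ξ i)] {S : SOEC d m Ξ} (A : FirstOrder S) (h : S.StrictlyFeasible) :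
    0 < A.dx.diam ^ 2 := by
  obtain ⟨x, hx, y, hy, hne⟩ := SOEC.exists_ne_of_strictlyFeasible h
  exact A.dx.diam_sq_pos S.convex hx hy hne

theorem FirstOrder.diam_dy_sq_pos {d m : ℕ} {Ξ : Fin (m + 1) → Type*}
    [∀ i, MeasurableSpace (Ξ i)] {S : SOEC d m Ξ} (A : FirstOrder S) (hm : 1 ≤ m) :
    0 < A.dy.diam ^ 2 := by
  refine A.dy.diam_sq_pos (convex_stdSimplex _ _) (single_mem_stdSimplex ℝ 0)
    (single_mem_stdSimplex ℝ (Fin.last m)) fun h => ?_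
  have h0 := congrFun h 0
  have : (0 : Fin (m + 1)) ≠ Fin.last m := by
    intro h; have := congrArg Fin.val h; simp at this; omega
  simp [this] at h0

theorem log_four_mul_le {θ q β N : ℝ} (hθ : 0 < θ) (hq : 0 < q) (hβ : 0 < β)
    (hβq : Real.log (1 / β) ≤ q) (hN : 0 < N) (hle : N ≤ 7 * (θ * q / β)) :
    Real.log (4 * N) ≤ 27 + θ + 2 * q := by
  have h1 : Real.log (4 * N) ≤ Real.log (28 * (θ * q * (1 / β))) := by
    refine Real.log_le_log (by positivity) ?_
    rw [mul_one_div]; linarith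
  have e : Real.log (28 * (θ * q * (1 / β))) =
      Real.log 28 + (Real.log θ + Real.log q + Real.log (1 / β)) := by
    rw [Real.log_mul (by norm_num) (by positivity), Real.log_mul (by positivity) (by positivity),
      Real.log_mul (by positivity) (by positivity)]
  have h2 := Real.log_le_sub_one_of_pos (show (0 : ℝ) < 28 by norm_num)
  have h3 := Real.log_le_sub_one_of_pos hθ
  have h4 := Real.log_le_sub_one_of_pos hq
  linarith

/-- Turns a sum of logarithms into the product in ε; all factors are bounded away from 0. The terms
28, 2p, θ, 2q cost 112 + 4 + 4 + 4 = 124 over ℓ₀. The fourth power of θ in ε comes from the θ in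
εopt. -/
theorem add_logs_le_mul {θ p q ℓ ℓ₀ : ℝ} (hθ : 1 ≤ θ) (hp : 1 / 2 ≤ p) (hq : 1 / 2 ≤ q)
    (hℓ₀ : 0 < ℓ₀) (hℓ : ℓ₀ ≤ ℓ) :
    28 + 2 * p + θ + 2 * q + ℓ ≤ (124 / ℓ₀ + 4) * (θ ^ 3 * ℓ * p * q) ∧
      ℓ / 4 ≤ θ ^ 3 * ℓ * p * q := by
  have hθ3 : θ ≤ θ ^ 3 := le_self_pow₀ hθ three_ne_zero
  have hθ31 : 1 ≤ θ ^ 3 := hθ.trans hθ3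
  have hpq_p : p / 2 ≤ p * q := by
    rw [div_eq_mul_one_div]; exact mul_le_mul_of_nonneg_left hq (by linarith)
  have hpq_q : q / 2 ≤ p * q := by
    rw [div_eq_mul_one_div, mul_comm]; exact mul_le_mul_of_nonneg_right hp (by linarith)
  have hpq4 : 1 / 4 ≤ p * q := by linarith
  have e : θ ^ 3 * ℓ * p * q = ℓ * (θ ^ 3 * (p * q)) := by ring
  rw [e]
  set Y := ℓ * (θ ^ 3 * (p * q)) with hY
  have hYpq : ∀ a b : ℝ, 0 ≤ a → 0 ≤ b → a ≤ θ ^ 3 → b ≤ p * q → ℓ₀ * (a * b) ≤ Y := by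
    intro a b ha hb h1 h2
    have hℓ0 : 0 ≤ ℓ := by linarith
    rw [hY]
    gcongr
  have hYℓ : ℓ / 4 ≤ Y := by
    have : 1 / 4 ≤ θ ^ 3 * (p * q) := hpq4.trans (le_mul_of_one_le_left (by linarith) hθ31)
    rw [hY, div_eq_mul_one_div]
    exact mul_le_mul_of_nonneg_left this (by linarith)
  refine ⟨?_, hYℓ⟩
  have b1 := hYpq 1 (1 / 4) zero_le_one (by norm_num) hθ31 hpq4
  have b2 := hYpq 1 (p / 2) zero_le_one (by linarith) hθ31 hpq_p
  have b3 := hYpq θ (1 / 4) (by linarith) (by norm_num) hθ3 hpq4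
  have b4 := hYpq 1 (q / 2) zero_le_one (by linarith) hθ31 hpq_q
  have b5 : 28 + 2 * p + θ + 2 * q ≤ 124 / ℓ₀ * Y := by
    rw [div_mul_eq_mul_div, le_div_iff₀ hℓ₀]
    linarith
  linarith

/-- The factor 3 in the number of calls makes the exponent at least (27/20) log(T/β), so the gap
shrinks below the fraction β/T, which is smaller than the order 1/√T of εopt. -/
theorem mul_exp_le {G β θ T x D : ℝ} (hG : 0 < G) (hβ : 0 < β) (hβ1 : β ≤ 1) (hθ : 0 < θ)
    (hT : 1 ≤ T) (hq : 0 ≤ Real.log (T / β)) (hx : 3 * (θ * Real.log (T / β) / β) ≤ x)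
    (hD : 9 ≤ 4 * D) :
    G * Real.exp (-(9 / 20 * (β / θ)) * x) ≤ 8 / 9 * (G * D / (2 * Real.sqrt T)) := by
  have hsq : 1 ≤ Real.sqrt T := Real.one_le_sqrt.2 hT
  have h1 : Real.exp (-(9 / 20 * (β / θ)) * x) ≤ β / T := by
    have e : β / T = Real.exp (-Real.log (T / β)) := by
      rw [Real.exp_neg, Real.exp_log (by positivity), inv_div]
    rw [e]
    refine Real.exp_le_exp.2 ?_
    have h2 := mul_le_mul_of_nonneg_left hx (show 0 ≤ 9 / 20 * (β / θ) by positivity)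
    have h3 : 9 / 20 * (β / θ) * (3 * (θ * Real.log (T / β) / β)) =
        27 / 20 * Real.log (T / β) := by field_simp; ring
    linarith
  have h3 : β / T ≤ 8 / 9 * (D / (2 * Real.sqrt T)) := by
    have h6 : 8 / 9 * (D / (2 * Real.sqrt T)) = 4 * D / (9 * Real.sqrt T) := by
      field_simp; ring
    rw [h6, div_le_div_iff₀ (by linarith) (by positivity)]
    have h7 : Real.sqrt T ≤ T := by
      have := Real.mul_self_sqrt (show 0 ≤ T by linarith)
      nlinarith
    calc β * (9 * Real.sqrt T) ≤ 1 * (9 * Real.sqrt T) := by gcongr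
      _ = 9 * Real.sqrt T := one_mul _
      _ ≤ 4 * D * T := by gcongr
  refine (mul_le_mul_of_nonneg_left (h1.trans h3) hG.le).trans (le_of_eq ?_)
  ring

/-- The number of oracle calls and the accuracy that they need, compared with `T`, `θ`, `β`, `δ`. -/
theorem level_iteration_parameters {W gap ℓ₀ C : ℝ} (hW : 0 ≤ W) (hgap : 0 < gap) (hℓ₀ : 0 < ℓ₀)
    (hC : C = 14 + 9 / ℓ₀ + 18 * W * (124 / ℓ₀ + 4) / gap) {θ δ β G E ε : ℝ} {T n : ℕ}
    (hθ : 1 < θ) (hδ : 0 < δ) (hℓ : ℓ₀ ≤ Real.log (1 / δ)) (hT : 2 ≤ T) (hβ : 0 < β) (hβ1 : β ≤ 1)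
    (hG : gap ≤ G) (hE : 0 < E) (hEW : E ≤ W)
    (hn : n = ⌈3 * (θ * Real.log (T / β) / β)⌉₊)
    (hε : ε = C * (θ ^ 4 * Real.log (1 / δ) * Real.log T * Real.log (T / β) / (β * Real.sqrt T))) :
    ((n + 1 : ℕ) : ℝ) ≤ C * (θ ^ 2 / β * Real.log (T / β)) ∧
    ((n + 1 : ℕ) : ℝ) * ((T : ℝ) + 1) ≤ C * (θ ^ 2 * T / β * Real.log (T / β)) ∧
    0 ≤ Real.log (4 * ((n + 1 : ℕ) : ℝ) / δ) ∧ 0 < ε ∧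
    9 * (E * (∑ t ∈ Finset.range (T + 1), 1 / ((t : ℝ) + 1) +
      Real.log (4 * ((n + 1 : ℕ) : ℝ) / δ)) / Real.sqrt T) ≤ β * G * ε / (2 * θ) ∧
    G * Real.exp (-(9 / 20 * (β / θ)) * n) ≤ 8 / 9 * (β * G * ε / (2 * θ)) := by
  have hT' : (2 : ℝ) ≤ T := by exact_mod_cast hT
  have hT0 : (0 : ℝ) < T := by linarith
  have hsq : 1 ≤ Real.sqrt T := Real.one_le_sqrt.2 (by linarith)
  have hsq0 : 0 < Real.sqrt T := by linarith
  have hθ0 : 0 < θ := by linarith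
  have hlog2 : (1 / 2 : ℝ) ≤ Real.log 2 := by linarith [Real.log_two_gt_d9]
  set ℓ := Real.log (1 / δ) with hℓdef
  set p := Real.log T with hp
  set q := Real.log (T / β) with hq
  have hp2 : 1 / 2 ≤ p := hlog2.trans (Real.log_le_log (by norm_num) hT')
  have hq_eq : q = p + Real.log (1 / β) := by
    rw [hq, hp, ← Real.log_mul (by positivity) (by positivity), mul_one_div]
  have hβlog : 0 ≤ Real.log (1 / β) := Real.log_nonneg ((one_le_div hβ).2 hβ1)
  have hq2 : 1 / 2 ≤ q := by linarith
  have hℓpos : 0 < ℓ := by linarith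
  have hGpos : 0 < G := by linarith
  set X := θ * q / β with hX
  have hXq : q ≤ X := by
    rw [hX, le_div_iff₀ hβ]
    have h1 := mul_le_mul_of_nonneg_left hβ1 (show 0 ≤ q by linarith)
    have h2 := mul_le_mul_of_nonneg_right hθ.le (show 0 ≤ q by linarith)
    linarith
  have hn1 : 3 * X ≤ n := by rw [hn]; exact Nat.le_ceil _
  have hn2 : (n : ℝ) < 3 * X + 1 := by
    rw [hn]; exact Nat.ceil_lt_add_one (by positivity)
  have hK : ((n + 1 : ℕ) : ℝ) ≤ 7 * X := by push_cast; linarith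
  have hK0 : (1 : ℝ) ≤ ((n + 1 : ℕ) : ℝ) := by push_cast; linarith [Nat.cast_nonneg (α := ℝ) n]
  have hXle : X ≤ θ ^ 2 / β * q := by
    have : θ ^ 2 / β * q = θ * X := by rw [hX]; ring
    rw [this]; exact le_mul_of_one_le_left (by linarith) hθ.le
  have hc1 : 0 ≤ 9 / ℓ₀ := by positivity
  have hc2 : 0 ≤ 18 * W * (124 / ℓ₀ + 4) / gap := by positivity
  -- Of the three terms of C, 14 serves the iteration counts, 9/ℓ₀ the contraction bound, and the
  -- last one 9η ≤ εopt.
  have hC14 : 14 ≤ C := by linarith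
  have hC0 : 0 < C := by linarith
  set Y := θ ^ 3 * ℓ * p * q with hY
  have hεY : ε = C * (θ * Y / (β * Real.sqrt T)) := by rw [hε, hY]; congr 2; ring
  obtain ⟨hYsum, hYℓ⟩ := add_logs_le_mul hθ.le hp2 hq2 hℓ₀ hℓ
  rw [← hY] at hYsum hYℓ
  have hY0 : 0 < Y := by positivity
  have hεpos : 0 < ε := by rw [hεY]; positivity
  have hlogK : Real.log (4 * ((n + 1 : ℕ) : ℝ) / δ) = Real.log (4 * ((n + 1 : ℕ) : ℝ)) + ℓ := by
    rw [hℓdef, ← Real.log_mul (by positivity) (by positivity), mul_one_div]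
  have hlogK0 : 0 ≤ Real.log (4 * ((n + 1 : ℕ) : ℝ)) := Real.log_nonneg (by linarith)
  have hlog28 : Real.log (4 * ((n + 1 : ℕ) : ℝ)) ≤ 27 + θ + 2 * q :=
    log_four_mul_le hθ0 (by linarith only [hq2]) hβ (by linarith only [hq_eq, hp2])
      (by positivity) hK
  have hL : ∑ t ∈ Finset.range (T + 1), 1 / ((t : ℝ) + 1) ≤ 1 + 2 * p := by
    refine (sum_inv_succ_le_one_add_log (T + 1)).trans (add_le_add_right ?_ 1)
    have : Real.log ((T + 1 : ℕ) : ℝ) ≤ Real.log ((T : ℝ) ^ 2) := by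
      refine Real.log_le_log (by positivity) ?_
      have h1 := mul_le_mul_of_nonneg_right hT' hT0.le
      push_cast
      rw [sq]
      linarith only [h1, hT']
    rwa [Real.log_pow] at this
  have hB : ∑ t ∈ Finset.range (T + 1), 1 / ((t : ℝ) + 1) +
      Real.log (4 * ((n + 1 : ℕ) : ℝ) / δ) ≤ (124 / ℓ₀ + 4) * Y := by
    rw [hlogK]
    linarith only [hL, hlog28, hYsum]
  have hrhs : β * G * ε / (2 * θ) = G * (C * Y) / (2 * Real.sqrt T) := by
    rw [hεY]; field_simp
  refine ⟨?_, ?_, ?_, hεpos, ?_, ?_⟩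
  · have := mul_le_mul_of_nonneg_right hC14 (show 0 ≤ θ ^ 2 / β * q by positivity)
    linarith only [this, hK, hXle, hXq, hq2]
  · have h1 : ((n + 1 : ℕ) : ℝ) * ((T : ℝ) + 1) ≤ 7 * X * (2 * T) := by
      have : (0 : ℝ) ≤ 7 * X := by linarith only [hXq, hq2]
      gcongr
      linarith only [hT']
    have h2 : X * T ≤ θ ^ 2 * T / β * q := by
      have : θ ^ 2 * T / β * q = θ ^ 2 / β * q * T := by ring
      rw [this]; gcongr
    have := mul_le_mul_of_nonneg_right hC14 (show 0 ≤ θ ^ 2 * T / β * q by positivity)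
    linarith only [this, h1, h2]
  · rw [hlogK]; exact add_nonneg hlogK0 hℓpos.le
  · rw [hrhs, ← mul_div_assoc, div_le_div_iff₀ hsq0 (by positivity)]
    have h1 : 18 * W * (124 / ℓ₀ + 4) ≤ gap * C := by
      have h3 : 18 * W * (124 / ℓ₀ + 4) / gap ≤ C := by linarith only [hC, hc1]
      rw [div_le_iff₀ hgap] at h3
      linarith only [h3]
    have h2 : gap * C ≤ G * C := mul_le_mul_of_nonneg_right hG hC0.le
    have h3 : E * (∑ t ∈ Finset.range (T + 1), 1 / ((t : ℝ) + 1) +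
        Real.log (4 * ((n + 1 : ℕ) : ℝ) / δ)) ≤ W * ((124 / ℓ₀ + 4) * Y) :=
      (mul_le_mul_of_nonneg_left hB hE.le).trans
        (mul_le_mul_of_nonneg_right hEW (by positivity))
    have h4 := mul_le_mul_of_nonneg_right (h1.trans h2) hY0.le
    have h5 : 18 * (E * (∑ t ∈ Finset.range (T + 1), 1 / ((t : ℝ) + 1) +
        Real.log (4 * ((n + 1 : ℕ) : ℝ) / δ))) ≤ G * (C * Y) := by linarith only [h3, h4]
    have h6 := mul_le_mul_of_nonneg_right h5 hsq0.le
    linarith only [h6]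
  · rw [hrhs]
    refine mul_exp_le hGpos hβ hβ1 hθ0 (by linarith only [hT']) (by linarith only [hq2]) hn1 ?_
    have h3 : 9 / ℓ₀ ≤ C := by linarith only [hC, hc2]
    have h4 : C * ℓ₀ ≤ C * ℓ := mul_le_mul_of_nonneg_left hℓ hC0.le
    have h5 := mul_le_mul_of_nonneg_left hYℓ hC0.le
    rw [div_le_iff₀ hℓ₀] at h3
    linarith only [h3, h4, h5]

theorem corollary2
    -- the hidden constant depends only on these bounds
    (Mbar Qbar gap δ₀ : ℝ) (hgap : 0 < gap) (hδ₀ : 0 < δ₀) (hδ₀' : δ₀ < 1) :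
    ∃ C : ℝ, 0 < C ∧
      ∀ (d m : ℕ), 1 ≤ m →
      ∀ (Ξ : Fin (m + 1) → Type*) [∀ i, MeasurableSpace (Ξ i)]
        (S : SOEC d m Ξ) (A : FirstOrder S) (r₀ : ℝ),
        S.StrictlyFeasible →
        S.fstar < r₀ →
        (∀ r ∈ Set.Ioc S.fstar r₀, A.LightTailed r) →
        A.M ≤ Mbar → A.Q ≤ Qbar → gap ≤ r₀ - S.fstar →
      -- independent samples, `ξ k t` being the `t`-th sample of the `k`-th oracle call
      ∀ (Ω : Type*) [MeasurableSpace Ω] (μ : Measure Ω) [IsProbabilityMeasure μ]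
        (ξ : ℕ → ℕ → Ω → ∀ i, Ξ i),
        (∀ k t, Measurable (ξ k t)) →
        (∀ k t, μ.map (ξ k t) = S.law) →
        iIndepFun (fun p : ℕ × ℕ => ξ p.1 p.2) μ →
      ∀ (θ δ : ℝ) (T : ℕ), 1 < θ → 0 < δ → δ ≤ δ₀ → 2 ≤ T →
      ∀ ε : ℝ,
        ε = C * (θ ^ 4 * Real.log (1 / δ) * Real.log T * Real.log (T / S.beta r₀) /
              (S.beta r₀ * Real.sqrt T)) →
        ε ≤ 1 →
        ∃ K : ℕ,
          (K : ℝ) ≤ C * (θ ^ 2 / S.beta r₀ * Real.log (T / S.beta r₀)) ∧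
          (gradientIterations T K : ℝ) ≤
            C * (θ ^ 2 * T / S.beta r₀ * Real.log (T / S.beta r₀)) ∧
          ∃ εopt : ℝ, 0 < εopt ∧ εopt ≤ -(1 / θ) * S.H r₀ * ε ∧
            ∃ B : Set Ω, MeasurableSet B ∧ ENNReal.ofReal (1 - δ) ≤ μ B ∧
              ∀ ω ∈ B, ∃ k < K,
                A.HaltsAt T θ r₀ εopt (fun k t => ξ k t ω) k ∧
                (∀ j ≤ k, S.Feasible (A.sflsX T θ r₀ (fun k t => ξ k t ω) j)) ∧
                S.RelOptimal r₀ ε (A.sflsX T θ r₀ (fun k t => ξ k t ω) k) := by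
  have hℓ₀ : 0 < Real.log (1 / δ₀) := Real.log_pos ((one_lt_div hδ₀).2 hδ₀')
  set ℓ₀ := Real.log (1 / δ₀)
  set W := |Qbar| + 3 * |Mbar|
  have hW : 0 ≤ W := by positivity
  refine ⟨14 + 9 / ℓ₀ + 18 * W * (124 / ℓ₀ + 4) / gap, by positivity, ?_⟩
  intro d m hm Ξ _ S A r₀ hS hr₀ hL hM hQ hG Ω _ μ _ ξ hξ hmap hind θ δ T hθ hδ hδδ₀ hT ε hε hε1
  have hdx := A.diam_dx_sq_pos hS
  have hdy := A.diam_dy_sq_pos hm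
  have hM0 := A.M_pos hdx
  have hQ0 := A.Q_pos
  have hbdd := A.bddBelow_f (hL r₀ ⟨hr₀, le_rfl⟩) 0
  have hG0 : 0 < r₀ - S.fstar := sub_pos.2 hr₀
  have hH0 := SOEC.H_neg hbdd hS hr₀
  have hβ : 0 < S.beta r₀ := div_pos (neg_pos.2 hH0) hG0
  have hβ1 : S.beta r₀ ≤ 1 := by
    rw [SOEC.beta, div_le_one hG0]
    linarith [SOEC.neg_le_H hbdd hr₀.le]
  have hβG : S.beta r₀ * (r₀ - S.fstar) = -S.H r₀ := div_mul_cancel₀ _ hG0.ne'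
  have hℓ : ℓ₀ ≤ Real.log (1 / δ) :=
    Real.log_le_log (by positivity) (one_div_le_one_div_of_le hδ hδδ₀)
  have hEW : A.Q + 3 * A.M ≤ W := by
    have := le_abs_self Qbar
    have := le_abs_self Mbar
    simp only [W]; linarith
  obtain ⟨n, hn⟩ : ∃ n, n = ⌈3 * (θ * Real.log (T / S.beta r₀) / S.beta r₀)⌉₊ := ⟨_, rfl⟩
  obtain ⟨c1, c2, c3, hε0, c4, c5⟩ := level_iteration_parameters hW hgap hℓ₀ rfl hθ hδ hℓ hT hβ hβ1
    hG (by positivity : 0 < A.Q + 3 * A.M) hEW hn hε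
  rw [hβG] at c4 c5
  -- Chosen so that 4 exp(-τ) = δ/(n + 1), for a union bound over n + 1 calls.
  set τ := Real.log (4 * ((n + 1 : ℕ) : ℝ) / δ) with hτ
  obtain ⟨η, hη⟩ : ∃ η, η = (A.Q + 3 * A.M) *
      (∑ t ∈ Finset.range (T + 1), 1 / ((t : ℝ) + 1) + τ) / Real.sqrt T := ⟨_, rfl⟩
  have hT0 : 0 < T := by omega
  have hη0 : 0 < η := by
    have h1 : 0 < Real.sqrt T := Real.sqrt_pos.2 (by exact_mod_cast hT0)
    have h2 : 0 < ∑ t ∈ Finset.range (T + 1), 1 / ((t : ℝ) + 1) :=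
      Finset.sum_pos (fun t _ => by positivity) ⟨0, by simp⟩
    rw [hη]; positivity
  rw [← hη] at c4
  have hθ0 : 0 < θ := by linarith
  -- Half of the admissible tolerance: the halting test only yields β times the gap at most 2 εopt.
  obtain ⟨εopt, hεopt⟩ : ∃ e, e = -S.H r₀ * ε / (2 * θ) := ⟨_, rfl⟩
  rw [← hεopt] at c4 c5
  have hεopt0 : 0 < εopt := by
    have := neg_pos.2 hH0
    rw [hεopt]; positivity
  refine ⟨n + 1, c1, ?_, εopt, hεopt0, ?_, ?_⟩
  · refine le_trans (le_of_eq ?_) c2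
    simp [gradientIterations]
  · have : -(1 / θ) * S.H r₀ * ε = 2 * εopt := by rw [hεopt]; field_simp
    linarith
  let bad : ℕ → Set Ω := fun k =>
    {ω | A.sflsLevel T θ r₀ (fun k t => ξ k t ω) k ∈ Set.Ioc S.fstar r₀ ∧
      ¬ (S.P (A.sflsLevel T θ r₀ (fun k t => ξ k t ω) k)
            (A.sflsX T θ r₀ (fun k t => ξ k t ω) k) - η ≤
          A.sflsU T θ r₀ (fun k t => ξ k t ω) k ∧
        A.sflsU T θ r₀ (fun k t => ξ k t ω) k ≤
          S.H (A.sflsLevel T θ r₀ (fun k t => ξ k t ω) k) + η)}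
  have hbad : ∀ k, μ (bad k) ≤ ENNReal.ofReal (δ / ((n + 1 : ℕ) : ℝ)) := by
    intro k
    refine (A.measure_sfls_bad_le hdx hdy hr₀ hL hξ hmap hind θ hT0 c3 hη k).trans (le_of_eq ?_)
    rw [hτ, Real.exp_neg, Real.exp_log (by positivity), inv_div,
      show (4 : ENNReal) = ENNReal.ofReal 4 by simp, ← ENNReal.ofReal_mul (by norm_num)]
    congr 1
    field_simp
  have hunion : μ (⋃ k ∈ Finset.range (n + 1), bad k) ≤ ENNReal.ofReal δ := by
    refine (measure_biUnion_finset_le _ _).trans ((Finset.sum_le_sum fun k _ => hbad k).trans ?_)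
    rw [Finset.sum_const, Finset.card_range, nsmul_eq_mul, ← ENNReal.ofReal_natCast,
      ← ENNReal.ofReal_mul (by positivity), mul_div_cancel₀ _ (by positivity)]
  -- A measurable hull has the same measure, so the bad events themselves need not be shown
  -- measurable.
  refine ⟨(toMeasurable μ (⋃ k ∈ Finset.range (n + 1), bad k))ᶜ,
    (measurableSet_toMeasurable _ _).compl, ?_, ?_⟩
  · rw [prob_compl_eq_one_sub (measurableSet_toMeasurable _ _), measure_toMeasurable,
      ENNReal.ofReal_sub _ hδ.le, ENNReal.ofReal_one]
    exact tsub_le_tsub_left hunion 1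
  intro ω hω
  have hgood : ∀ k ≤ n, ω ∉ bad k := fun k hk hb =>
    hω (subset_toMeasurable _ _ (Set.mem_biUnion (Finset.mem_coe.2
      (Finset.mem_range.2 (Nat.lt_succ_of_le hk))) hb))
  set s : ℕ → ℕ → ∀ i, Ξ i := fun k t => ξ k t ω
  have hXmem : ∀ k, A.sflsX T θ r₀ s k ∈ S.X := fun k => A.ovsmdX_mem hdx _ _ _
  obtain ⟨k, hk, hhalt, hfeas, hopt⟩ := level_iteration (H := S.H) (r := A.sflsLevel T θ r₀ s)
    (U := A.sflsU T θ r₀ s) (p := fun k => S.P (A.sflsLevel T θ r₀ s k) (A.sflsX T θ r₀ s k))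
    (fs := S.fstar) (n := n) hθ hη0 c4 hr₀ hβ
    (by
      change 2 * εopt ≤ -S.H r₀
      have : 2 * εopt = -S.H r₀ * (ε / θ) := by rw [hεopt]; field_simp
      rw [this]
      have h1 : ε / θ ≤ 1 := (div_le_one hθ0).2 (by linarith)
      exact mul_le_of_le_one_right (neg_pos.2 hH0).le h1)
    (fun k => rfl) (fun u hu => SOEC.neg_le_H hbdd hu)
    (fun u v h1 h2 h3 => SOEC.H_le_div_mul hbdd hS h1 h2 h3)
    (fun u hu => by
      refine (SOEC.H_le_div_mul hbdd hS hu.1.le hu.2 hr₀).trans (le_of_eq ?_)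
      change (u - S.fstar) / (r₀ - S.fstar) * S.H r₀ = _
      rw [SOEC.beta]; ring)
    (fun k hk hr => by
      refine ⟨SOEC.H_le_P hbdd _ (hXmem k), ?_⟩
      by_contra hc
      exact hgood k hk ⟨hr, hc⟩)
    c5
  refine ⟨k, Nat.lt_succ_of_le hk, hhalt,
    fun j hj => SOEC.feasible_of_P_nonpos (hXmem j) (hfeas j hj), ?_⟩
  -- Here f_0(x^(k)) ≤ r^(k) ≤ f* + 2 εopt/β, and 2 εopt/β = (r₀ - f*) ε/θ.
  rw [SOEC.RelOptimal, div_le_iff₀ hG0]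
  have h1 := S.f_zero_le (A.sflsLevel T θ r₀ s k) (A.sflsX T θ r₀ s k)
  have h2 : S.P (A.sflsLevel T θ r₀ s k) (A.sflsX T θ r₀ s k) ≤ 0 := hfeas k le_rfl
  have h3 : 2 * εopt = S.beta r₀ * ((r₀ - S.fstar) * (ε / θ)) := by
    rw [← mul_assoc, hβG, hεopt]; field_simp
  have h4 := le_of_mul_le_mul_left (hopt.trans h3.le) hβ
  have h5 : ε / θ ≤ ε := div_le_self hε0.le hθ.le
  have h6 := mul_le_mul_of_nonneg_left h5 hG0.le
  linarith
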